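/- Work over $\mathbb{C}$. Let $\mathbb{A}^{18}$ have coordinates $s,t$, $x=(x_1,x_2,x_3)$, $y=(y_1,y_2,y_3)$ (column vectors), $a_{11},a_{12},a_{21}$, $b_{11},b_{12},b_{21}$, $c_{11},c_{12},c_{21},c_{22}$, and put \[ P=\begin{pmatrix} a_{11}&b_{11}&1\\ a_{12}&b_{12}&0\\ c_{11}&c_{12}&0\end{pmatrix},\qquad Q=\begin{pmatrix} a_{21}&b_{21}&0\\ -a_{11}&-b_{11}&1\\ c_{21}&c_{22}&0\end{pmatrix},\qquad C=\begin{pmatrix} c_{11}&c_{12}\\ c_{21}&c_{22}\end{pmatrix}. \] Let $x^\sharp={}^tPx\times{}^tQx$, $y^\sharp=Py\times Qy$ (cross products). Let $N_x(x)$, $N_y(y)$ be the cubic forms with $(x^\sharp)^\sharp=N_x(x)\,x$, $(y^\sharp)^\sharp=N_y(y)\,y$, and let $\beta(x,y)$ be the bilinear form determined by $\partial_{x'}N_x(x)=\beta(x',x^\sharp)$ and $\partial_{y'}N_y(y)=\beta(y^\sharp,y')$; explicitly $\beta(x,y)={}^tx\,\bigl(P\,(\operatorname{adj}(P+Q)-\operatorname{adj}P-\operatorname{adj}Q)\,Q-Q\operatorname{adj}(P)\,Q-P\operatorname{adj}(Q)\,P\bigr)\,y$.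 Let $\mathfrak{U}=\mathfrak{U}^{14}_{\mathbb{A}}\subset\mathbb{A}^{18}$ be the closed subscheme defined by the nine equations \[ sx=y^\sharp,\quad ty=x^\sharp,\quad st=\tfrac13\beta(x,y),\quad {}^txPy=0,\quad {}^txQy=0 . \] Let $L=\{x=y=0,\ s=t=0\}\subset\mathfrak{U}$, let $\mathsf{S}_x=\{x_1=x_2=0,\ y=0,\ s=t=0,\ C=O\}$, and let $\mathsf{S}_y$ be the closure of \[ \Bigl\{x=0,\ s=t=y_3=0,\ \begin{pmatrix} a_{11}&b_{11}\\ a_{12}&b_{12}\\ a_{21}&b_{21}\\ c_{11}&c_{12}\\ c_{21}&c_{22}\end{pmatrix}\begin{pmatrix}y_1\\ y_2\end{pmatrix}=0\Bigr\}\setminus L . \] Then the open subset $\mathfrak{U}\setminus L$ is $14$-dimensional and irreducible. Its singular locus (the set of points whose local ring is not regular) is equal to the $7$-dimensional locus $\Delta=(\mathsf{S}_x\cup\mathsf{S}_y)\setminus L$. Moreover $\mathfrak{U}\setminus L$ has $c(\mathrm{G}(2,5))$-singularities along $\Delta$: writing $c(\mathrm{G}(2,5))\subset\bigwedge^2\mathbb{C}^5$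 for the affine cone over the Grassmannian $\mathrm{G}(2,5)$ in its Pl\"ucker embedding, every point of $\Delta$ has an open neighbourhood $V$ in $\mathfrak{U}\setminus L$ with an open immersion of $\mathbb{C}$-schemes $V\hookrightarrow c(\mathrm{G}(2,5))\times\mathbb{A}^7$ under which $V\cap\Delta$ is the inverse image of $\{\text{vertex}\}\times\mathbb{A}^7$. -/

import Mathlib

open AlgebraicGeometry CategoryTheory
open scoped Matrix

noncomputable section

namespace KeyVariety

section Forms

variable {A : Type*} [CommRing A]

/-- `x^♯ = ᵗP x × ᵗQ x`. -/
def sharpX (P Q : Matrix (Fin 3) (Fin 3) A) (x : Fin 3 → A) : Fin 3 → A :=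
  crossProduct (Pᵀ *ᵥ x) (Qᵀ *ᵥ x)

/-- `y^♯ = P y × Q y`. -/
def sharpY (P Q : Matrix (Fin 3) (Fin 3) A) (y : Fin 3 → A) : Fin 3 → A :=
  crossProduct (P *ᵥ y) (Q *ᵥ y)

/-- The matrix of the bilinear trace `β^{PQ}`, in closed form. The properties that determine
`β^{PQ}` are proved below (`sharpY_sharpX`, `sharpX_sharpY`, `normX_add`, `normY_add`). -/
def betaMatrix (P Q : Matrix (Fin 3) (Fin 3) A) : Matrix (Fin 3) (Fin 3) A :=
  P * ((P + Q).adjugate - P.adjugate - Q.adjugate) * Q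
    - Q * P.adjugate * Q - P * Q.adjugate * P

/-- The bilinear trace `β^{PQ}(x, y)`. -/
def beta (P Q : Matrix (Fin 3) (Fin 3) A) (x y : Fin 3 → A) : A :=
  x ⬝ᵥ (betaMatrix P Q *ᵥ y)

/-- The cubic form `N_x^{PQ}`. -/
def normX (P Q : Matrix (Fin 3) (Fin 3) A) (x : Fin 3 → A) : A :=
  -(x ⬝ᵥ ((Q * P.adjugate * Q) *ᵥ sharpX P Q x))

/-- The cubic form `N_y^{PQ}`. -/
def normY (P Q : Matrix (Fin 3) (Fin 3) A) (y : Fin 3 → A) : A :=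
  -(sharpY P Q y ⬝ᵥ ((Q * P.adjugate * Q) *ᵥ y))

end Forms

/-- The coordinates of the affine `18`-space; `x i` and `y i` stand for `x_{i+1}` and `y_{i+1}`. -/
inductive Coord : Type
  | s | t
  | x (i : Fin 3) | y (i : Fin 3)
  | a11 | a12 | a21
  | b11 | b12 | b21
  | c11 | c12 | c21 | c22
  deriving DecidableEq, Fintype

section Equations

variable {A : Type*} [CommRing A]

/-- The matrix `P` of a point `v` of the affine `18`-space. -/
def matP (v : Coord → A) : Matrix (Fin 3) (Fin 3) A :=
  !![v .a11, v .b11, 1;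
     v .a12, v .b12, 0;
     v .c11, v .c12, 0]

/-- The matrix `Q` of a point `v` of the affine `18`-space. -/
def matQ (v : Coord → A) : Matrix (Fin 3) (Fin 3) A :=
  !![v .a21, v .b21, 0;
     -v .a11, -v .b11, 1;
     v .c21, v .c22, 0]

/-- `(x^♯)^♯ = N_x(x) x`. -/
theorem sharpY_sharpX (v : Coord → A) (x : Fin 3 → A) :
    sharpY (matP v) (matQ v) (sharpX (matP v) (matQ v) x) = normX (matP v) (matQ v) x • x := by
  funext i
  fin_cases i <;>
  simp [matP, matQ, sharpX, sharpY, normX, crossProduct, Matrix.mulVec, Matrix.mul_apply,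
    dotProduct, Fin.sum_univ_three, Matrix.adjugate_fin_three] <;> ring

/-- `(y^♯)^♯ = N_y(y) y`. -/
theorem sharpX_sharpY (v : Coord → A) (y : Fin 3 → A) :
    sharpX (matP v) (matQ v) (sharpY (matP v) (matQ v) y) = normY (matP v) (matQ v) y • y := by
  funext i
  fin_cases i <;>
  simp [matP, matQ, sharpX, sharpY, normY, crossProduct, Matrix.mulVec, Matrix.mul_apply,
    dotProduct, Fin.sum_univ_three, Matrix.adjugate_fin_three] <;> ring

set_option maxHeartbeats 4000000 in
/-- `∂_{x'} N_x(x) = β(x', x^♯)`, as an expansion of the cubic form `N_x`. -/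
theorem normX_add (v : Coord → A) (x x' : Fin 3 → A) :
    normX (matP v) (matQ v) (x + x') =
      normX (matP v) (matQ v) x + beta (matP v) (matQ v) x' (sharpX (matP v) (matQ v) x)
        + beta (matP v) (matQ v) x (sharpX (matP v) (matQ v) x') + normX (matP v) (matQ v) x' := by
  simp [matP, matQ, sharpX, normX, beta, betaMatrix, crossProduct, Matrix.mulVec,
    Matrix.mul_apply, dotProduct, Fin.sum_univ_three, Matrix.adjugate_fin_three]
  ring

set_option maxHeartbeats 4000000 in
/-- `∂_{y'} N_y(y) = β(y^♯, y')`, as an expansion of the cubic form `N_y`. -/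
theorem normY_add (v : Coord → A) (y y' : Fin 3 → A) :
    normY (matP v) (matQ v) (y + y') =
      normY (matP v) (matQ v) y + beta (matP v) (matQ v) (sharpY (matP v) (matQ v) y) y'
        + beta (matP v) (matQ v) (sharpY (matP v) (matQ v) y') y + normY (matP v) (matQ v) y' := by
  simp [matP, matQ, sharpY, normY, beta, betaMatrix, crossProduct, Matrix.mulVec,
    Matrix.mul_apply, dotProduct, Fin.sum_univ_three, Matrix.adjugate_fin_three]
  ring

/-- The vector `x` of a point. -/
def vecX (v : Coord → A) : Fin 3 → A := fun i => v (.x i)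

/-- The vector `y` of a point. -/
def vecY (v : Coord → A) : Fin 3 → A := fun i => v (.y i)

/-- The nine equations `s x = y^♯`, `t y = x^♯`, `s t = β(x, y) / 3`, `ᵗx P y = 0`,
`ᵗx Q y = 0`. -/
def equations [Algebra ℂ A] (v : Coord → A) : Set A :=
  Set.range (v .s • vecX v - sharpY (matP v) (matQ v) (vecY v)) ∪
  Set.range (v .t • vecY v - sharpX (matP v) (matQ v) (vecX v)) ∪
  {v .s * v .t - (1 / 3 : ℂ) • beta (matP v) (matQ v) (vecX v) (vecY v),
    vecX v ⬝ᵥ (matP v *ᵥ vecY v),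
    vecX v ⬝ᵥ (matQ v *ᵥ vecY v)}

end Equations

/-- The ideal of the nine equations in the polynomial ring in `18` variables. -/
def idealU : Ideal (MvPolynomial Coord ℂ) :=
  Ideal.span (equations (MvPolynomial.X : Coord → MvPolynomial Coord ℂ))

/-- The coordinate ring of `𝔘`. -/
abbrev RingU : Type := MvPolynomial Coord ℂ ⧸ idealU

/-- The coordinate functions on `𝔘`. -/
def coordU (i : Coord) : RingU := Ideal.Quotient.mk idealU (MvPolynomial.X i)

/-- The affine scheme `𝔘`. -/
abbrev schemeU : Scheme := Spec (CommRingCat.of RingU)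

/-- The structure morphism of `𝔘` over `ℂ`. -/
def schemeUToC : schemeU ⟶ Spec (CommRingCat.of ℂ) :=
  Spec.map (CommRingCat.ofHom (algebraMap ℂ RingU))

/-- The closed subset of `𝔘` on which the functions in `T` vanish. -/
def locus (T : Set RingU) : Set schemeU := PrimeSpectrum.zeroLocus T

theorem isClosed_locus (T : Set RingU) : IsClosed (locus T) :=
  PrimeSpectrum.isClosed_zeroLocus T

/-- The locus `{x = y = 0, s = t = 0}`. -/
def baseLocus : Set schemeU :=
  locus (Set.range (fun i => coordU (.x i)) ∪ Set.range (fun i => coordU (.y i)) ∪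
    {coordU .s, coordU .t})

/-- The open subset `𝔘 ∖ {x = y = 0, s = t = 0}`. -/
def openU : schemeU.Opens :=
  ⟨baseLocusᶜ, (isClosed_locus _).isOpen_compl⟩

/-- `S_x = {x₁ = x₂ = 0, y = 0, s = t = 0, C = 0}`. -/
def locusSx : Set schemeU :=
  locus (Set.range (fun i => coordU (.y i)) ∪
    {coordU (.x 0), coordU (.x 1), coordU .s, coordU .t,
      coordU .c11, coordU .c12, coordU .c21, coordU .c22})

/-- The locus `{x = 0, s = t = y₃ = 0, K · ᵗ(y₁, y₂) = 0}`, where `K` is the `5 × 2` matrix with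
rows `(a₁₁, b₁₁)`, `(a₁₂, b₁₂)`, `(a₂₁, b₂₁)`, `(c₁₁, c₁₂)`, `(c₂₁, c₂₂)`. -/
def locusPreSy : Set schemeU :=
  locus (Set.range (fun i => coordU (.x i)) ∪ {coordU .s, coordU .t, coordU (.y 2)} ∪
    Set.range
      (!![coordU .a11, coordU .b11;
          coordU .a12, coordU .b12;
          coordU .a21, coordU .b21;
          coordU .c11, coordU .c12;
          coordU .c21, coordU .c22] *ᵥ ![coordU (.y 0), coordU (.y 1)]))

/-- `S_y` is the closure of `locusPreSy ∖ {x = y = 0, s = t = 0}`. -/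
def locusSy : Set schemeU := closure (locusPreSy \ baseLocus)

/-- `Δ = (S_x ∪ S_y) ∖ {x = y = 0, s = t = 0}`. -/
def locusDelta : Set schemeU := (locusSx ∪ locusSy) \ baseLocus

/-- The singular locus of a scheme: the points whose local ring is not regular. -/
def singularLocus (X : Scheme) : Set X :=
  {p | ¬ IsRegularLocalRing (X.presheaf.stalk p)}

/-- The index set of the ten Plücker coordinates `p_{ij}`, `i < j`. -/
abbrev PluckerIndex : Type := {p : Fin 5 × Fin 5 // p.1 < p.2}

/-- The decomposable bivectors `u ∧ v` in `⋀² ℂ⁵`, in Plücker coordinates: the points of the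
affine cone over `G(2,5) ⊆ ℙ(⋀² ℂ⁵)`. -/
def decomposable : Set (PluckerIndex → ℂ) :=
  {w | ∃ u v : Fin 5 → ℂ, ∀ p, w p = u p.1.1 * v p.1.2 - u p.1.2 * v p.1.1}

/-- The coordinate ring of the affine cone over `G(2,5)` in its Plücker embedding. -/
abbrev RingCone : Type :=
  MvPolynomial PluckerIndex ℂ ⧸ MvPolynomial.vanishingIdeal ℂ decomposable

/-- The affine cone over `G(2,5)`. -/
abbrev coneG : Scheme := Spec (CommRingCat.of RingCone)

/-- The structure morphism of the cone over `ℂ`. -/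
def coneGToC : coneG ⟶ Spec (CommRingCat.of ℂ) :=
  Spec.map (CommRingCat.ofHom (algebraMap ℂ RingCone))

/-- The vertex of the cone, as the closed subset on which all Plücker coordinates vanish. -/
def coneVertex : Set coneG :=
  PrimeSpectrum.zeroLocus
    (Set.range fun p : PluckerIndex => (Ideal.Quotient.mk _ (MvPolynomial.X p) : RingCone))

/-- The `ℂ`-scheme `X` has `c(G(2,5))`-singularities along the `d`-dimensional locus `D`: near each
point of `D`, the pair `(X, D)` is isomorphic over `ℂ` to an open part of the pair
`(c(G(2,5)) × 𝔸^d, vertex × 𝔸^d)`. -/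
def HasConeSingularitiesAlong {X : Scheme} (f : X ⟶ Spec (CommRingCat.of ℂ)) (D : Set X) (d : ℕ) :
    Prop :=
  ∀ p ∈ D, ∃ V : X.Opens, p ∈ V ∧ ∃ j : (V : Scheme) ⟶ 𝔸(Fin d; coneG),
    IsOpenImmersion j ∧
    j ≫ (𝔸(Fin d; coneG) ↘ coneG) ≫ coneGToC = V.ι ≫ f ∧
    ∀ q : V, V.ι q ∈ D ↔ (𝔸(Fin d; coneG) ↘ coneG) (j q) ∈ coneVertex

end KeyVariety

end

/-! Where `x_k` is invertible, the equation `s x_k = (y^♯)_k` only eliminates `s`, and the remaining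
equations `t y = ᵗPx × ᵗQx`, `y · ᵗPx = 0`, `y · ᵗQx = 0` imply all the others
(`isPoint_of_isUnit_x`). These five are exactly the Plücker relations for the bivector in `⋀² A⁵`
with components `(t, y, ᵗPx, ᵗQx)` (`bivectorX`). Once `x_k` is inverted, the ten components
together with seven suitable coordinates form a coordinate system, so `{x_k ≠ 0}` is an open part of
`c(G(2,5)) × 𝔸⁷`. In the same way, where `y_1` or `y_2` is invertible, `t` is eliminated and the
bivector `(s, x, Py, Qy)` gives a chart (`bivectorY`). Where `s` is invertible, `𝔘` is the graph of
`x = y^♯/s`, `t = N_y(y)/s²` over an open part of `𝔸¹⁴`, and symmetrically for `t`. These seven open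
sets cover `𝔘 ∖ L`, since the third component of `s x = y^♯` puts `y_3²` in the ideal `(s, y_1,
y_2)`.

The charts are ring maps `f : B → RingU` out of a domain that become isomorphisms after inverting
`b` and `f b` (`IsAwayIso`). Injectivity comes from a point of `𝔘` with values in `B_b`, and
surjectivity up to powers of `f b` from solving for the missing coordinates. Mapping out of the ring
of the cone requires that the vanishing ideal of the decomposable bivectors be generated by the five
quadrics; `vanishingIdeal_decomposable` proves this by saturation.

Everything is then read off on charts (`exists_chart`). The product `c(G(2,5)) × 𝔸⁷` is regular
exactly off `vertex × 𝔸⁷`: off the vertex the cone is locally open in `𝔸⁷`, and along the vertex the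
local ring is a regular local domain modulo a nonzero ideal in the square of the maximal ideal. On
each cone chart `Δ` is the vanishing locus of the bivector (`mem_locusDelta_iff_bivectorX`,
`mem_locusDelta_iff_bivectorY`), and it misses the two smooth charts. Irreducibility holds because
the charts are irreducible and share a complex point; the dimensions are computed chart by chart. -/

noncomputable section

namespace KeyVariety

/-! ### Vector identities for the sharp maps and the form `β` -/

section Identities

variable {A : Type*} [CommRing A]

theorem dotProduct_mulVec_matP (v : Coord → A) (x y : Fin 3 → A) :
    x ⬝ᵥ (matP v *ᵥ y) = ((matP v)ᵀ *ᵥ x) ⬝ᵥ y := by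
  rw [Matrix.dotProduct_mulVec, Matrix.mulVec_transpose]

theorem dotProduct_mulVec_matQ (v : Coord → A) (x y : Fin 3 → A) :
    x ⬝ᵥ (matQ v *ᵥ y) = ((matQ v)ᵀ *ᵥ x) ⬝ᵥ y := by
  rw [Matrix.dotProduct_mulVec, Matrix.mulVec_transpose]

/-- If `ᵗx P y = ᵗx Q y = 0`, then `x` and `y^♯` are proportional. -/
theorem mul_sharpY_comm (P Q : Matrix (Fin 3) (Fin 3) A) (x y : Fin 3 → A)
    (hP : x ⬝ᵥ (P *ᵥ y) = 0) (hQ : x ⬝ᵥ (Q *ᵥ y) = 0) (i j : Fin 3) :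
    x i * sharpY P Q y j = x j * sharpY P Q y i := by
  have h : crossProduct x (sharpY P Q y) = 0 := by
    funext k
    simp only [sharpY]
    generalize P *ᵥ y = p at *
    generalize Q *ᵥ y = q at *
    simp only [dotProduct, Fin.sum_univ_three] at hP hQ
    fin_cases k <;> simp [cross_apply]
    · linear_combination p 0 * hQ - q 0 * hP
    · linear_combination p 1 * hQ - q 1 * hP
    · linear_combination p 2 * hQ - q 2 * hP
  have h0 := congrFun h 0
  have h1 := congrFun h 1
  have h2 := congrFun h 2
  simp [cross_apply] at h0 h1 h2
  fin_cases i <;> fin_cases j <;> simp only [Fin.mk_zero, Fin.mk_one, Fin.reduceFinMk]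
  · linear_combination h2
  · linear_combination -h1
  · linear_combination -h2
  · linear_combination h0
  · linear_combination h1
  · linear_combination -h0

/-- If `ᵗx P y = ᵗx Q y = 0`, then `y` and `x^♯` are proportional. -/
theorem mul_sharpX_comm (P Q : Matrix (Fin 3) (Fin 3) A) (x y : Fin 3 → A)
    (hP : x ⬝ᵥ (P *ᵥ y) = 0) (hQ : x ⬝ᵥ (Q *ᵥ y) = 0) (i j : Fin 3) :
    y i * sharpX P Q x j = y j * sharpX P Q x i := by
  have key := mul_sharpY_comm Pᵀ Qᵀ y x
    (by rw [Matrix.dotProduct_mulVec, Matrix.vecMul_transpose, dotProduct_comm]; exact hP)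
    (by rw [Matrix.dotProduct_mulVec, Matrix.vecMul_transpose, dotProduct_comm]; exact hQ)
  exact key i j

-- Modulo `ᵗxPy` and `ᵗxQy`, the polarization of `y ↦ y^♯` at the pair `(x^♯, y)` is `(2/3) β(x, y)
-- x`. The two correction terms are written out so that this is a polynomial identity. When `x^♯ = t
-- y` the left side becomes `6 t y^♯`, which is how the equation `st = β/3` is recovered from the
-- others.
set_option maxHeartbeats 4000000 in
theorem three_mul_polar_sharpY_sharpX (v : Coord → A) (x y : Fin 3 → A) (k : Fin 3) :
    3 * (crossProduct (matP v *ᵥ sharpX (matP v) (matQ v) x) (matQ v *ᵥ y)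
      + crossProduct (matP v *ᵥ y) (matQ v *ᵥ sharpX (matP v) (matQ v) x)) k
      = 2 * beta (matP v) (matQ v) x y * x k
        + (x ⬝ᵥ (matP v *ᵥ y)) *
          (x ᵥ* (2 • (matP v * (matQ v).adjugate) - matQ v *
            ((matP v + matQ v).adjugate - (matP v).adjugate - (matQ v).adjugate))) k
        + (x ⬝ᵥ (matQ v *ᵥ y)) *
          (x ᵥ* (2 • (matQ v * (matP v).adjugate) - matP v *
            ((matP v + matQ v).adjugate - (matP v).adjugate - (matQ v).adjugate))) k := by
  fin_cases k <;>
  simp [matP, matQ, sharpX, beta, betaMatrix, cross_apply, Matrix.mulVec, Matrix.vecMul,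
    dotProduct, Fin.sum_univ_three, Matrix.adjugate_fin_three] <;>
  ring

set_option maxHeartbeats 4000000 in
theorem three_mul_polar_sharpX_sharpY (v : Coord → A) (x y : Fin 3 → A) (k : Fin 3) :
    3 * (crossProduct ((matP v)ᵀ *ᵥ sharpY (matP v) (matQ v) y) ((matQ v)ᵀ *ᵥ x)
      + crossProduct ((matP v)ᵀ *ᵥ x) ((matQ v)ᵀ *ᵥ sharpY (matP v) (matQ v) y)) k
      = 2 * beta (matP v) (matQ v) x y * y k
        + (x ⬝ᵥ (matP v *ᵥ y)) *
          ((2 • ((matQ v).adjugate * matP v) -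
            ((matP v + matQ v).adjugate - (matP v).adjugate - (matQ v).adjugate) * matQ v) *ᵥ y) k
        + (x ⬝ᵥ (matQ v *ᵥ y)) *
          ((2 • ((matP v).adjugate * matQ v) -
            ((matP v + matQ v).adjugate - (matP v).adjugate - (matQ v).adjugate) * matP v) *ᵥ y)
              k := by
  fin_cases k <;>
  simp [matP, matQ, sharpY, beta, betaMatrix, cross_apply, Matrix.mulVec,
    dotProduct, Fin.sum_univ_three, Matrix.adjugate_fin_three] <;>
  ring

end Identities

/-! ### Compatibility of the forms with ring homomorphisms -/

section Naturality

variable {A B : Type*} [CommRing A] [CommRing B] (φ : A →+* B)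

theorem matP_comp (v : Coord → A) : matP (φ ∘ v) = φ.mapMatrix (matP v) := by
  ext i j
  fin_cases i <;> fin_cases j <;> simp [matP]

theorem matQ_comp (v : Coord → A) : matQ (φ ∘ v) = φ.mapMatrix (matQ v) := by
  ext i j
  fin_cases i <;> fin_cases j <;> simp [matQ]

theorem map_mulVec_mapMatrix (M : Matrix (Fin 3) (Fin 3) A) (x : Fin 3 → A) :
    φ.mapMatrix M *ᵥ (φ ∘ x) = φ ∘ (M *ᵥ x) := by
  funext i
  simp [Matrix.mulVec, dotProduct]

theorem map_dotProduct_fin_three (x y : Fin 3 → A) : (φ ∘ x) ⬝ᵥ (φ ∘ y) = φ (x ⬝ᵥ y) := by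
  simp [dotProduct]

theorem map_crossProduct (x y : Fin 3 → A) :
    crossProduct (φ ∘ x) (φ ∘ y) = φ ∘ crossProduct x y := by
  funext i
  fin_cases i <;> simp [cross_apply]

theorem sharpX_map (P Q : Matrix (Fin 3) (Fin 3) A) (x : Fin 3 → A) :
    sharpX (φ.mapMatrix P) (φ.mapMatrix Q) (φ ∘ x) = φ ∘ sharpX P Q x := by
  have h (M : Matrix (Fin 3) (Fin 3) A) : (φ.mapMatrix M)ᵀ = φ.mapMatrix Mᵀ := rfl
  rw [sharpX, h, h, map_mulVec_mapMatrix, map_mulVec_mapMatrix, map_crossProduct, sharpX]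

theorem sharpY_map (P Q : Matrix (Fin 3) (Fin 3) A) (y : Fin 3 → A) :
    sharpY (φ.mapMatrix P) (φ.mapMatrix Q) (φ ∘ y) = φ ∘ sharpY P Q y := by
  rw [sharpY, map_mulVec_mapMatrix, map_mulVec_mapMatrix, map_crossProduct, sharpY]

theorem beta_map (P Q : Matrix (Fin 3) (Fin 3) A) (x y : Fin 3 → A) :
    beta (φ.mapMatrix P) (φ.mapMatrix Q) (φ ∘ x) (φ ∘ y) = φ (beta P Q x y) := by
  have h : betaMatrix (φ.mapMatrix P) (φ.mapMatrix Q) = φ.mapMatrix (betaMatrix P Q) := by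
    simp only [betaMatrix, map_sub, map_mul, map_add, RingHom.map_adjugate]
  rw [beta, h, map_mulVec_mapMatrix, map_dotProduct_fin_three, beta]

theorem vecX_comp (v : Coord → A) : vecX (φ ∘ v) = φ ∘ vecX v := rfl

theorem vecY_comp (v : Coord → A) : vecY (φ ∘ v) = φ ∘ vecY v := rfl

end Naturality

/-- The nine equations of `𝔘` hold at the `A`-valued point `v` of the affine `18`-space. -/
structure IsPoint {A : Type*} [CommRing A] [Algebra ℂ A] (v : Coord → A) : Prop where
  sx : ∀ i, v .s * v (.x i) = sharpY (matP v) (matQ v) (vecY v) i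
  ty : ∀ i, v .t * v (.y i) = sharpX (matP v) (matQ v) (vecX v) i
  st : v .s * v .t = (1 / 3 : ℂ) • beta (matP v) (matQ v) (vecX v) (vecY v)
  xPy : vecX v ⬝ᵥ (matP v *ᵥ vecY v) = 0
  xQy : vecX v ⬝ᵥ (matQ v *ᵥ vecY v) = 0

/-! ### Points of `𝔘` and redundancy of the equations where a coordinate is invertible -/

section Points

variable {A B : Type*} [CommRing A] [CommRing B] [Algebra ℂ A] [Algebra ℂ B]

theorem isPoint_iff (v : Coord → A) : IsPoint v ↔ ∀ r ∈ equations v, r = 0 := by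
  constructor
  · rintro h r ((⟨i, rfl⟩ | ⟨i, rfl⟩) | (rfl | rfl | rfl))
    · exact sub_eq_zero.2 (h.sx i)
    · exact sub_eq_zero.2 (h.ty i)
    · exact sub_eq_zero.2 h.st
    · exact h.xPy
    · exact h.xQy
  · intro h
    refine ⟨fun i => sub_eq_zero.1 (h _ (.inl (.inl ⟨i, rfl⟩))),
      fun i => sub_eq_zero.1 (h _ (.inl (.inr ⟨i, rfl⟩))),
      sub_eq_zero.1 (h _ (.inr (.inl rfl))), h _ (.inr (.inr (.inl rfl))),
      h _ (.inr (.inr (.inr rfl)))⟩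

theorem equations_comp (φ : A →ₐ[ℂ] B) (v : Coord → A) :
    equations (φ ∘ v) = φ '' equations v := by
  have hP := matP_comp (φ : A →+* B) v
  have hQ := matQ_comp (φ : A →+* B) v
  have hφ : (⇑(φ : A →+* B)) = φ := rfl
  have hX := vecX_comp (φ : A →+* B) v
  have hY := vecY_comp (φ : A →+* B) v
  rw [hφ] at hP hQ hX hY
  have hsX := sharpX_map (φ : A →+* B) (matP v) (matQ v) (vecX v)
  have hsY := sharpY_map (φ : A →+* B) (matP v) (matQ v) (vecY v)
  have hβ := beta_map (φ : A →+* B) (matP v) (matQ v) (vecX v) (vecY v)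
  have hmP := map_mulVec_mapMatrix (φ : A →+* B) (matP v) (vecY v)
  have hmQ := map_mulVec_mapMatrix (φ : A →+* B) (matQ v) (vecY v)
  have hd := map_dotProduct_fin_three (φ : A →+* B)
  rw [hφ] at hsX hsY hβ hmP hmQ hd
  unfold equations
  rw [hP, hQ, hX, hY, hsX, hsY, hβ, hmP, hmQ, hd, hd]
  rw [Set.image_union, Set.image_union, ← Set.range_comp, ← Set.range_comp, Set.image_insert_eq,
    Set.image_insert_eq, Set.image_singleton]
  congr 2
  · congr 2
    funext i
    simp [vecX]
  · congr 1
    funext i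
    simp [vecY]
  · simp

/-- The `ℂ`-algebra homomorphism on the coordinate ring of `𝔘` given by a point. -/
def liftU (v : Coord → A) (hv : IsPoint v) : RingU →ₐ[ℂ] A :=
  Ideal.Quotient.liftₐ idealU (MvPolynomial.aeval v) (by
    intro a ha
    have h : idealU ≤ RingHom.ker (MvPolynomial.aeval v : MvPolynomial Coord ℂ →ₐ[ℂ] A) := by
      refine Ideal.span_le.2 fun r hr => ?_
      have h1 := Set.mem_image_of_mem (MvPolynomial.aeval v : MvPolynomial Coord ℂ →ₐ[ℂ] A) hr
      rw [← equations_comp] at h1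
      have h2 : (MvPolynomial.aeval v : MvPolynomial Coord ℂ →ₐ[ℂ] A) ∘ MvPolynomial.X = v := by
        funext i; simp
      rw [h2] at h1
      exact (isPoint_iff v).1 hv _ h1
    exact h ha)

@[simp]
theorem liftU_coordU (v : Coord → A) (hv : IsPoint v) (i : Coord) :
    liftU v hv (coordU i) = v i := by
  exact MvPolynomial.aeval_X v i

theorem isPoint_coordU : IsPoint coordU := by
  rw [isPoint_iff]
  intro r hr
  have h : coordU = Ideal.Quotient.mkₐ ℂ idealU ∘ MvPolynomial.X := rfl
  rw [h, equations_comp] at hr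
  obtain ⟨r, hr, rfl⟩ := hr
  exact Ideal.Quotient.eq_zero_iff_mem.2 (Ideal.subset_span hr)

theorem adjoin_coordU : Algebra.adjoin ℂ (Set.range coordU) = ⊤ := by
  have h : Set.range coordU = Ideal.Quotient.mkₐ ℂ idealU '' Set.range MvPolynomial.X := by
    rw [← Set.range_comp]; rfl
  rw [h, ← AlgHom.map_adjoin, MvPolynomial.adjoin_range_X, Algebra.map_top,
    AlgHom.range_eq_top]
  exact Ideal.Quotient.mkₐ_surjective _ _

theorem isPoint_of_isUnit_x (v : Coord → A) (k : Fin 3) (hk : IsUnit (v (.x k)))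
    (sx : v .s * v (.x k) = sharpY (matP v) (matQ v) (vecY v) k)
    (ty : ∀ i, v .t * v (.y i) = sharpX (matP v) (matQ v) (vecX v) i)
    (xPy : vecX v ⬝ᵥ (matP v *ᵥ vecY v) = 0) (xQy : vecX v ⬝ᵥ (matQ v *ᵥ vecY v) = 0) :
    IsPoint v := by
  have hs (i) : v .s * v (.x i) = sharpY (matP v) (matQ v) (vecY v) i := by
    have h := mul_sharpY_comm _ _ _ _ xPy xQy i k
    simp only [vecX] at h
    apply hk.mul_left_cancel
    linear_combination v (.x i) * sx + h
  refine ⟨hs, ty, ?_, xPy, xQy⟩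
  have h := three_mul_polar_sharpY_sharpX v (vecX v) (vecY v) k
  have hX : sharpX (matP v) (matQ v) (vecX v) = v .t • vecY v := by
    funext i; simp [ty i, vecY]
  rw [xPy, xQy, hX, Matrix.mulVec_smul, Matrix.mulVec_smul] at h
  simp only [map_smul, LinearMap.smul_apply, Pi.add_apply, Pi.smul_apply, smul_eq_mul,
    zero_mul, add_zero] at h
  -- Both polar terms equal `t y^♯`, so the identity reads `6 t s x_k = 2 β x_k`, and `x_k` can be
  -- cancelled.
  change 3 * (v .t * sharpY (matP v) (matQ v) (vecY v) k
    + v .t * sharpY (matP v) (matQ v) (vecY v) k) = _ at h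
  rw [← sx] at h
  have h6 : (6 : ℂ) • (v .s * v .t) = (2 : ℂ) • beta (matP v) (matQ v) (vecX v) (vecY v) := by
    apply hk.mul_right_cancel
    simp only [vecX, Algebra.smul_def, map_ofNat] at h ⊢
    linear_combination h
  calc v .s * v .t = (1 / 6 : ℂ) • (6 : ℂ) • (v .s * v .t) := by
        rw [smul_smul]; norm_num
    _ = _ := by rw [h6, smul_smul]; norm_num

theorem isPoint_of_isUnit_y (v : Coord → A) (k : Fin 3) (hk : IsUnit (v (.y k)))
    (ty : v .t * v (.y k) = sharpX (matP v) (matQ v) (vecX v) k)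
    (sx : ∀ i, v .s * v (.x i) = sharpY (matP v) (matQ v) (vecY v) i)
    (xPy : vecX v ⬝ᵥ (matP v *ᵥ vecY v) = 0) (xQy : vecX v ⬝ᵥ (matQ v *ᵥ vecY v) = 0) :
    IsPoint v := by
  have ht (i) : v .t * v (.y i) = sharpX (matP v) (matQ v) (vecX v) i := by
    have h := mul_sharpX_comm _ _ _ _ xPy xQy i k
    simp only [vecY] at h
    apply hk.mul_left_cancel
    linear_combination v (.y i) * ty + h
  refine ⟨sx, ht, ?_, xPy, xQy⟩
  have h := three_mul_polar_sharpX_sharpY v (vecX v) (vecY v) k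
  have hY : sharpY (matP v) (matQ v) (vecY v) = v .s • vecX v := by
    funext i; simp [sx i, vecX]
  rw [xPy, xQy, hY, Matrix.mulVec_smul, Matrix.mulVec_smul] at h
  simp only [map_smul, LinearMap.smul_apply, Pi.add_apply, Pi.smul_apply, smul_eq_mul,
    zero_mul, add_zero] at h
  change 3 * (v .s * sharpX (matP v) (matQ v) (vecX v) k
    + v .s * sharpX (matP v) (matQ v) (vecX v) k) = _ at h
  rw [← ty] at h
  have h6 : (6 : ℂ) • (v .s * v .t) = (2 : ℂ) • beta (matP v) (matQ v) (vecX v) (vecY v) := by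
    apply hk.mul_right_cancel
    simp only [vecY, Algebra.smul_def, map_ofNat] at h ⊢
    linear_combination h
  calc v .s * v .t = (1 / 6 : ℂ) • (6 : ℂ) • (v .s * v .t) := by
        rw [smul_smul]; norm_num
    _ = _ := by rw [h6, smul_smul]; norm_num

/-- Euler's identity for the cubic form: comparing `N_y(2y) = 8 N_y(y)` with the expansion of `N_y(y
+ y)` gives `2β(y^♯, y) = 6 N_y(y)`. -/
theorem beta_sharpY_self (v : Coord → A) (y : Fin 3 → A) :
    beta (matP v) (matQ v) (sharpY (matP v) (matQ v) y) y = 3 * normY (matP v) (matQ v) y := by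
  have hs (c : A) : sharpY (matP v) (matQ v) (c • y) = c ^ 2 • sharpY (matP v) (matQ v) y := by
    simp only [sharpY, Matrix.mulVec_smul, map_smul, LinearMap.smul_apply, smul_smul, sq]
  have hN : normY (matP v) (matQ v) ((2 : A) • y) = 8 * normY (matP v) (matQ v) y := by
    simp only [normY, hs, Matrix.mulVec_smul, smul_dotProduct, dotProduct_smul, smul_eq_mul]
    ring
  have h := normY_add v y y
  rw [← two_smul A y, hN] at h
  have h2 : (2 : A) * beta (matP v) (matQ v) (sharpY (matP v) (matQ v) y) y
      = 2 * (3 * normY (matP v) (matQ v) y) := by linear_combination -h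
  have hu : IsUnit (2 : A) := by
    have := (IsUnit.mk0 (2 : ℂ) two_ne_zero).map (algebraMap ℂ A)
    rwa [map_ofNat] at this
  exact hu.mul_left_cancel h2

theorem beta_self_sharpX (v : Coord → A) (x : Fin 3 → A) :
    beta (matP v) (matQ v) x (sharpX (matP v) (matQ v) x) = 3 * normX (matP v) (matQ v) x := by
  have hs (c : A) : sharpX (matP v) (matQ v) (c • x) = c ^ 2 • sharpX (matP v) (matQ v) x := by
    simp only [sharpX, Matrix.mulVec_smul, map_smul, LinearMap.smul_apply, smul_smul, sq]
  have hN : normX (matP v) (matQ v) ((2 : A) • x) = 8 * normX (matP v) (matQ v) x := by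
    simp only [normX, hs, Matrix.mulVec_smul, smul_dotProduct, dotProduct_smul, smul_eq_mul]
    ring
  have h := normX_add v x x
  rw [← two_smul A x, hN] at h
  have h2 : (2 : A) * beta (matP v) (matQ v) x (sharpX (matP v) (matQ v) x)
      = 2 * (3 * normX (matP v) (matQ v) x) := by linear_combination -h
  have hu : IsUnit (2 : A) := by
    have := (IsUnit.mk0 (2 : ℂ) two_ne_zero).map (algebraMap ℂ A)
    rwa [map_ofNat] at this
  exact hu.mul_left_cancel h2

/-- Substituting `y^♯ = s x` into `(y^♯)^♯ = N_y(y) y` gives `s² x^♯ = s² t y`, and into Euler's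
identity gives `s β(x, y) = 3 s² t`. The two bilinear equations hold because `Py × Qy` is orthogonal
to `Py` and to `Qy`. -/
theorem isPoint_of_isUnit_s (v : Coord → A) (hs : IsUnit (v .s))
    (sx : ∀ i, v .s * v (.x i) = sharpY (matP v) (matQ v) (vecY v) i)
    (st : v .s ^ 2 * v .t = normY (matP v) (matQ v) (vecY v)) : IsPoint v := by
  have hY : sharpY (matP v) (matQ v) (vecY v) = v .s • vecX v := by
    funext i; simp [sx i, vecX]
  refine ⟨sx, fun i => ?_, ?_, ?_, ?_⟩
  · have h := congrFun (sharpX_sharpY v (vecY v)) i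
    rw [hY, ← st] at h
    simp only [sharpX, Matrix.mulVec_smul, map_smul, LinearMap.smul_apply,
      Pi.smul_apply, smul_eq_mul] at h
    apply (hs.mul hs).mul_left_cancel
    rw [sharpX]
    simp only [vecY] at h
    linear_combination -h
  · have h := beta_sharpY_self v (vecY v)
    rw [← st, hY] at h
    have h3 : v .s * beta (matP v) (matQ v) (vecX v) (vecY v) = 3 * (v .s ^ 2 * v .t) := by
      rw [← h, beta, beta, smul_dotProduct, smul_eq_mul]
    have h4 : beta (matP v) (matQ v) (vecX v) (vecY v) = (3 : ℂ) • (v .s * v .t) := by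
      apply hs.mul_left_cancel
      rw [h3, Algebra.smul_def, map_ofNat]
      ring
    rw [h4, smul_smul]
    norm_num
  · apply hs.mul_left_cancel
    rw [← smul_eq_mul, ← smul_dotProduct, ← hY, mul_zero, sharpY]
    exact (dotProduct_comm _ _).trans (dot_self_cross _ _)
  · apply hs.mul_left_cancel
    rw [← smul_eq_mul, ← smul_dotProduct, ← hY, mul_zero, sharpY]
    exact (dotProduct_comm _ _).trans (dot_cross_self _ _)

theorem isPoint_of_isUnit_t (v : Coord → A) (ht : IsUnit (v .t))
    (ty : ∀ i, v .t * v (.y i) = sharpX (matP v) (matQ v) (vecX v) i)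
    (st : v .t ^ 2 * v .s = normX (matP v) (matQ v) (vecX v)) : IsPoint v := by
  have hX : sharpX (matP v) (matQ v) (vecX v) = v .t • vecY v := by
    funext i; simp [ty i, vecY]
  refine ⟨fun i => ?_, ty, ?_, ?_, ?_⟩
  · have h := congrFun (sharpY_sharpX v (vecX v)) i
    rw [hX, ← st] at h
    simp only [sharpY, Matrix.mulVec_smul, map_smul, LinearMap.smul_apply,
      Pi.smul_apply, smul_eq_mul] at h
    apply (ht.mul ht).mul_left_cancel
    rw [sharpY]
    simp only [vecX] at h
    linear_combination -h
  · have h := beta_self_sharpX v (vecX v)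
    rw [← st, hX] at h
    have h3 : v .t * beta (matP v) (matQ v) (vecX v) (vecY v) = 3 * (v .t ^ 2 * v .s) := by
      rw [← h, beta, beta, Matrix.mulVec_smul, dotProduct_smul, smul_eq_mul]
    have h4 : beta (matP v) (matQ v) (vecX v) (vecY v) = (3 : ℂ) • (v .s * v .t) := by
      apply ht.mul_left_cancel
      rw [h3, Algebra.smul_def, map_ofNat]
      ring
    rw [h4, smul_smul]
    norm_num
  · apply ht.mul_left_cancel
    rw [dotProduct_mulVec_matP, ← smul_eq_mul, ← dotProduct_smul, ← hX, mul_zero, sharpX]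
    exact dot_self_cross _ _
  · apply ht.mul_left_cancel
    rw [dotProduct_mulVec_matQ, ← smul_eq_mul, ← dotProduct_smul, ← hX, mul_zero, sharpX]
    exact dot_cross_self _ _

end Points

/-- The Plücker index `(i, j)`. -/
abbrev ix (i j : Fin 5) (h : i < j := by decide) : PluckerIndex := ⟨(i, j), h⟩

theorem forall_pluckerIndex {C : PluckerIndex → Prop} (h01 : C (ix 0 1)) (h02 : C (ix 0 2))
    (h03 : C (ix 0 3)) (h04 : C (ix 0 4)) (h12 : C (ix 1 2)) (h13 : C (ix 1 3))
    (h14 : C (ix 1 4)) (h23 : C (ix 2 3)) (h24 : C (ix 2 4)) (h34 : C (ix 3 4)) :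
    ∀ p, C p := by
  rintro ⟨⟨i, j⟩, h⟩
  fin_cases i <;> fin_cases j <;> first | assumption | exact absurd h (by decide)

/-- The five Plücker relations. -/
structure IsPlucker {A : Type*} [CommRing A] (w : PluckerIndex → A) : Prop where
  r0123 : w (ix 0 1) * w (ix 2 3) - w (ix 0 2) * w (ix 1 3) + w (ix 0 3) * w (ix 1 2) = 0
  r0124 : w (ix 0 1) * w (ix 2 4) - w (ix 0 2) * w (ix 1 4) + w (ix 0 4) * w (ix 1 2) = 0
  r0134 : w (ix 0 1) * w (ix 3 4) - w (ix 0 3) * w (ix 1 4) + w (ix 0 4) * w (ix 1 3) = 0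
  r0234 : w (ix 0 2) * w (ix 3 4) - w (ix 0 3) * w (ix 2 4) + w (ix 0 4) * w (ix 2 3) = 0
  r1234 : w (ix 1 2) * w (ix 3 4) - w (ix 1 3) * w (ix 2 4) + w (ix 1 4) * w (ix 2 3) = 0

theorem IsPlucker.map {A B : Type*} [CommRing A] [CommRing B] (φ : A →+* B)
    {w : PluckerIndex → A} (hw : IsPlucker w) : IsPlucker (φ ∘ w) := by
  constructor
  · simpa using congrArg φ hw.r0123
  · simpa using congrArg φ hw.r0124
  · simpa using congrArg φ hw.r0134
  · simpa using congrArg φ hw.r0234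
  · simpa using congrArg φ hw.r1234

theorem isPlucker_wedge {A : Type*} [CommRing A] (u v : Fin 5 → A) :
    IsPlucker fun p : PluckerIndex => u p.1.1 * v p.1.2 - u p.1.2 * v p.1.1 := by
  constructor <;> ring

/-! ### Saturation of ideals in polynomial rings -/

section Saturation

variable {R : Type*} [CommRing R] [IsDomain R]

/-- A variable `e` is a nonzerodivisor modulo two equations that are linear in further variables
`p` and `q` with coefficient `e`. -/
theorem mem_span_pair_of_mul_mem {e : R} (he : e ≠ 0) (ε : R →+* R) (hεe : ε e = 0)
    (hε : ∀ a, e ∣ a - ε a) {p q c d : R} (hc : ε c = c) (hd : ε d = d) (hcp : Prime c)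
    (hcd : ¬ c ∣ d) {f : R} (hf : e * f ∈ Ideal.span {e * p + c, e * q + d}) :
    f ∈ Ideal.span {e * p + c, e * q + d} := by
  obtain ⟨a, b, hab⟩ := Ideal.mem_span_pair.1 hf
  have h1 := congrArg ε hab
  simp only [map_add, map_mul, hεe, hc, hd, zero_mul, zero_add] at h1
  obtain ⟨k, hk⟩ : c ∣ ε b := by
    refine (hcp.dvd_or_dvd (a := ε b) (b := d) ?_).resolve_right hcd
    exact ⟨-ε a, by linear_combination h1⟩
  have ha : ε a = -k * d := by
    apply mul_left_cancel₀ hcp.ne_zero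
    rw [hk] at h1
    linear_combination h1
  obtain ⟨a', ha'⟩ := hε a
  obtain ⟨b', hb'⟩ := hε b
  -- Setting `e = 0` turns the relation into a syzygy of `c` and `d`, which must be the Koszul one,
  -- `(-kd, kc)`. It contributes `k (c (eq + d) - d (ep + c)) = e k (cq - dp)`, and this is `e`
  -- times the element of the ideal with coefficients `kq`, `-kp`.
  refine Ideal.mem_span_pair.2 ⟨a' + k * q, b' - k * p, ?_⟩
  apply mul_left_cancel₀ he
  rw [hk] at hb'
  linear_combination hab - (e * p + c) * ha' - (e * q + d) * hb' - (e * p + c) * ha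

/-- A variable `τ` is a nonzerodivisor modulo the equations `τ η = r`, `P = Q = 0`. -/
theorem mem_of_mul_mem_of_forall {τ : R} (hτ : τ ≠ 0) (ε : R →+* R) (hετ : ε τ = 0)
    (hε : ∀ a, τ ∣ a - ε a) {η r : Fin 3 → R} {P Q : R} (hr : ∀ i, ε (r i) = r i)
    (hP : ε P = P) (hQ : ε Q = Q)
    (h : ∀ a : Fin 3 → R, ∑ i, a i * r i ∈ Ideal.span {P, Q} →
      ∑ i, a i * η i ∈ Ideal.span {P, Q}) {f : R}
    (hf : τ * f ∈ Ideal.span (Set.range (fun i => τ * η i - r i)) ⊔ Ideal.span {P, Q}) :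
    f ∈ Ideal.span (Set.range (fun i => τ * η i - r i)) ⊔ Ideal.span {P, Q} := by
  obtain ⟨g, hg, g', hg', hgf⟩ := Submodule.mem_sup.1 hf
  obtain ⟨a, rfl⟩ := (Ideal.mem_span_range_iff_exists_fun).1 hg
  obtain ⟨b, c, rfl⟩ := Ideal.mem_span_pair.1 hg'
  have h1 := congrArg ε hgf
  simp only [map_add, map_sum, map_mul, map_sub, hετ, hr, hP, hQ, zero_mul, zero_sub] at h1
  have h2 : ∑ i, ε (a i) * r i ∈ Ideal.span {P, Q} := by
    refine Ideal.mem_span_pair.2 ⟨ε b, ε c, ?_⟩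
    rw [add_eq_zero_iff_eq_neg'] at h1
    rw [h1, ← Finset.sum_neg_distrib]
    exact Finset.sum_congr rfl fun i _ => by ring
  have h3 := h _ h2
  choose a' ha' using fun i => hε (a i)
  obtain ⟨b', hb'⟩ := hε b
  obtain ⟨c', hc'⟩ := hε c
  -- Split every coefficient as `a = τ a' + ε a`. The parts free of `τ` contribute `τ ∑ ε(a_i) η_i`,
  -- because their remaining terms cancel by `h1`.
  have h4 : f = ∑ i, a' i * (τ * η i - r i) + (∑ i, ε (a i) * η i + (b' * P + c' * Q)) := by
    apply mul_left_cancel₀ hτ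
    simp only [Fin.sum_univ_three] at hgf h1 ⊢
    linear_combination -hgf + h1 + (τ * η 0 - r 0) * ha' 0 + (τ * η 1 - r 1) * ha' 1
      + (τ * η 2 - r 2) * ha' 2 + P * hb' + Q * hc'
  rw [h4]
  refine Submodule.add_mem_sup ((Ideal.mem_span_range_iff_exists_fun).2 ⟨a', rfl⟩)
    (add_mem h3 (Ideal.mem_span_pair.2 ⟨b', c', rfl⟩))

/-- If, modulo `I` and up to powers of `e`, every variable is a polynomial in the variables in `T`,
then so is every polynomial. -/
theorem exists_pow_mul_sub_mem {σ : Type*} (I : Ideal (MvPolynomial σ ℂ)) (T : Set σ)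
    (e : MvPolynomial σ ℂ) (he : e ∈ MvPolynomial.supported ℂ T)
    (h : ∀ i ∉ T, ∃ F ∈ MvPolynomial.supported ℂ T, e * MvPolynomial.X i - F ∈ I)
    (f : MvPolynomial σ ℂ) :
    ∃ n : ℕ, ∃ F ∈ MvPolynomial.supported ℂ T, e ^ n * f - F ∈ I := by
  induction f using MvPolynomial.induction_on with
  | C a => exact ⟨0, _, (MvPolynomial.supported ℂ T).algebraMap_mem a,
      by simp [MvPolynomial.algebraMap_eq]⟩
  | add f g hf hg =>
    obtain ⟨n, F, hF, hF'⟩ := hf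
    obtain ⟨m, G, hG, hG'⟩ := hg
    refine ⟨n + m, e ^ m * F + e ^ n * G, add_mem (mul_mem (pow_mem he _) hF)
      (mul_mem (pow_mem he _) hG), ?_⟩
    have := add_mem (I.mul_mem_left (e ^ m) hF') (I.mul_mem_left (e ^ n) hG')
    convert this using 1
    ring
  | mul_X f i hf =>
    obtain ⟨n, F, hF, hF'⟩ := hf
    by_cases hi : i ∈ T
    · refine ⟨n, F * MvPolynomial.X i, mul_mem hF (MvPolynomial.X_mem_supported.2 hi), ?_⟩
      convert I.mul_mem_right (MvPolynomial.X i) hF' using 1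
      ring
    · obtain ⟨G, hG, hG'⟩ := h i hi
      refine ⟨n + 1, F * G, mul_mem hF hG, ?_⟩
      have := add_mem (I.mul_mem_right (e * MvPolynomial.X i) hF') (I.mul_mem_left F hG')
      convert this using 1
      ring

/-- The value of a polynomial in the variables in `T` depends on the coordinates in `T` only. -/
theorem eval_eq_of_mem_supported {σ : Type*} {T : Set σ} {F : MvPolynomial σ ℂ}
    (hF : F ∈ MvPolynomial.supported ℂ T) {a b : σ → ℂ} (hab : ∀ i ∈ T, a i = b i) :
    MvPolynomial.eval a F = MvPolynomial.eval b F := by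
  refine MvPolynomial.eval₂Hom_congr' rfl (fun i hi _ => hab i ?_) rfl
  exact MvPolynomial.mem_supported.1 hF hi

/-- A polynomial in the variables in `T` is zero if its values vanish where `X i` does not. -/
theorem eq_zero_of_forall_eval {σ : Type*} {F : MvPolynomial σ ℂ} (i : σ)
    (h : ∀ a : σ → ℂ, a i ≠ 0 → MvPolynomial.eval a F = 0) : F = 0 := by
  have : MvPolynomial.X i * F = 0 := by
    apply MvPolynomial.funext
    intro a
    by_cases ha : a i = 0 <;> simp [ha, h]
  exact (mul_eq_zero.1 this).resolve_left (MvPolynomial.X_ne_zero i)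

/-- The substitution `X i = 0`. -/
def killVar {σ : Type*} [DecidableEq σ] (i : σ) : MvPolynomial σ ℂ →ₐ[ℂ] MvPolynomial σ ℂ :=
  MvPolynomial.aeval (Function.update MvPolynomial.X i 0)

@[simp]
theorem killVar_self {σ : Type*} [DecidableEq σ] (i : σ) :
    killVar i (MvPolynomial.X i) = 0 := by
  simp [killVar]

theorem killVar_of_ne {σ : Type*} [DecidableEq σ] {i j : σ} (h : j ≠ i) :
    killVar i (MvPolynomial.X j) = MvPolynomial.X j := by
  simp [killVar, h]

theorem X_dvd_sub_killVar {σ : Type*} [DecidableEq σ] (i : σ) (f : MvPolynomial σ ℂ) :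
    MvPolynomial.X i ∣ f - killVar i f := by
  have h : (Ideal.Quotient.mkₐ ℂ (Ideal.span {(MvPolynomial.X i : MvPolynomial σ ℂ)})).comp
      (killVar i) = Ideal.Quotient.mkₐ ℂ _ := by
    ext j
    by_cases hj : j = i
    · subst hj
      simp
    · simp [killVar_of_ne hj]
  rw [← Ideal.mem_span_singleton, ← Ideal.Quotient.eq]
  exact (DFunLike.congr_fun h f).symm

end Saturation

/-! ### The five Plücker quadrics generate the ideal of the cone -/

section Plucker

open MvPolynomial

/-- The polynomial ring in the ten Plücker coordinates. -/
abbrev RingPl : Type := MvPolynomial PluckerIndex ℂ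

/-- The coordinates `η` with `p_{jk} = ε_{ijk} η_i` for `i, j, k ≤ 2`. -/
def plEta : Fin 3 → RingPl := ![X (ix 1 2), -X (ix 0 2), X (ix 0 1)]

/-- The quadrics `(p × q)_i` with `p_i = p_{i3}`, `q_i = p_{i4}`. -/
def plCross : Fin 3 → RingPl :=
  ![X (ix 1 3) * X (ix 2 4) - X (ix 1 4) * X (ix 2 3),
    X (ix 0 4) * X (ix 2 3) - X (ix 0 3) * X (ix 2 4),
    X (ix 0 3) * X (ix 1 4) - X (ix 0 4) * X (ix 1 3)]

/-- The Plücker quadric on the indices `0, 1, 2, 3`. -/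
def plP : RingPl := X (ix 1 2) * X (ix 0 3) + (X (ix 0 1) * X (ix 2 3) - X (ix 0 2) * X (ix 1 3))

/-- The Plücker quadric on the indices `0, 1, 2, 4`. -/
def plQ : RingPl := X (ix 1 2) * X (ix 0 4) + (X (ix 0 1) * X (ix 2 4) - X (ix 0 2) * X (ix 1 4))

/-- The ideal generated by the Plücker quadrics. -/
def pluckerIdeal : Ideal RingPl :=
  Ideal.span (Set.range fun i => X (ix 3 4) * plEta i - plCross i) ⊔ Ideal.span {plP, plQ}

/-- The polynomial is linear in `p_{23}`, with leading coefficient `p_{01}` coprime to the constant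
term. -/
theorem prime_bilinear : Prime (X (ix 0 1) * X (ix 2 3) - X (ix 0 2) * X (ix 1 3) : RingPl) := by
  rw [← irreducible_iff_prime, sub_eq_add_neg]
  refine irreducible_mul_X_add _ _ _ (X_ne_zero _) (by simp [vars_X]) ?_ ?_
  · rw [vars_neg]
    intro h
    simpa [vars_X] using vars_mul _ _ h
  · rw [(X_prime (R := ℂ) (i := ix 0 1)).irreducible.isRelPrime_iff_not_dvd]
    rintro ⟨g, hg⟩
    have := congrArg (eval fun p : PluckerIndex => if p = ix 0 1 then (0 : ℂ) else 1) hg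
    simp at this

theorem mem_of_X_mul_mem {f : RingPl} (hf : X (ix 1 2) * f ∈ Ideal.span {plP, plQ}) :
    f ∈ Ideal.span {plP, plQ} := by
  refine mem_span_pair_of_mul_mem (X_ne_zero _) (killVar (ix 1 2) : RingPl →+* RingPl)
    (killVar_self _) (X_dvd_sub_killVar _) ?_ ?_ prime_bilinear ?_ hf
  · simp [killVar_of_ne]
  · simp [killVar_of_ne]
  · rintro ⟨g, hg⟩
    have := congrArg (eval fun p : PluckerIndex => if p = ix 0 1 ∨ p = ix 2 4 then (1 : ℂ) else 0) hg
    simp at this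

theorem mem_of_X_pow_mul_mem {f : RingPl} {n : ℕ}
    (hf : X (ix 1 2) ^ n * f ∈ Ideal.span {plP, plQ}) : f ∈ Ideal.span {plP, plQ} := by
  induction n with
  | zero => simpa using hf
  | succ n ih =>
    apply ih
    apply mem_of_X_mul_mem
    rwa [← mul_assoc, ← pow_succ']

/-- Where `p_{12} ≠ 0`, the equations `plP = plQ = 0` can be solved for `p_{03}` and `p_{04}`, so
they impose nothing on the other eight coordinates. -/
theorem eq_zero_of_mem_supported_of_mem_span {F : RingPl}
    (hF : F ∈ supported ℂ ({ix 0 3, ix 0 4}ᶜ : Set PluckerIndex))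
    (hF' : F ∈ Ideal.span {plP, plQ}) : F = 0 := by
  refine eq_zero_of_forall_eval (ix 1 2) fun a ha => ?_
  let b : PluckerIndex → ℂ := fun p =>
    if p = ix 0 3 then -(a (ix 0 1) * a (ix 2 3) - a (ix 0 2) * a (ix 1 3)) / a (ix 1 2)
    else if p = ix 0 4 then -(a (ix 0 1) * a (ix 2 4) - a (ix 0 2) * a (ix 1 4)) / a (ix 1 2)
    else a p
  rw [eval_eq_of_mem_supported hF (b := b) fun i hi => by
    simp only [Set.mem_compl_iff, Set.mem_insert_iff, Set.mem_singleton_iff, not_or] at hi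
    simp [b, hi.1, hi.2]]
  obtain ⟨c, d, rfl⟩ := Ideal.mem_span_pair.1 hF'
  have h1 : eval b plP = 0 := by
    simp [plP, b]
    field_simp
    ring
  have h2 : eval b plQ = 0 := by
    simp [plQ, b]
    field_simp
    ring
  simp [h1, h2]

/-- After multiplication by a power of `p_{12}`, `f` becomes a polynomial free of `p_{03}` and
`p_{04}` modulo the ideal. `plCross 0` is also free of them, so the product is zero as a polynomial.
Then the power of `p_{12}`, a nonzerodivisor, is removed. -/
theorem mem_of_plCross_mul_mem {f : RingPl} (hf : plCross 0 * f ∈ Ideal.span {plP, plQ}) :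
    f ∈ Ideal.span {plP, plQ} := by
  obtain ⟨n, F, hF, hF'⟩ := exists_pow_mul_sub_mem (Ideal.span {plP, plQ})
    ({ix 0 3, ix 0 4}ᶜ : Set PluckerIndex) (X (ix 1 2)) (X_mem_supported.2 (by simp)) (by
      intro i hi
      simp only [Set.mem_compl_iff, not_not] at hi
      rcases hi with rfl | rfl
      · refine ⟨-(X (ix 0 1) * X (ix 2 3) - X (ix 0 2) * X (ix 1 3)), ?_, ?_⟩
        · refine neg_mem (sub_mem (mul_mem ?_ ?_) (mul_mem ?_ ?_)) <;>
            exact X_mem_supported.2 (by simp)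
        · rw [sub_neg_eq_add]
          exact Ideal.subset_span (.inl rfl)
      · refine ⟨-(X (ix 0 1) * X (ix 2 4) - X (ix 0 2) * X (ix 1 4)), ?_, ?_⟩
        · refine neg_mem (sub_mem (mul_mem ?_ ?_) (mul_mem ?_ ?_)) <;>
            exact X_mem_supported.2 (by simp)
        · rw [sub_neg_eq_add]
          exact Ideal.subset_span (.inr rfl)) f
  have hr : plCross 0 ∈ supported ℂ ({ix 0 3, ix 0 4}ᶜ : Set PluckerIndex) := by
    refine sub_mem (mul_mem ?_ ?_) (mul_mem ?_ ?_) <;> exact X_mem_supported.2 (by simp)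
  have h1 : plCross 0 * F ∈ Ideal.span {plP, plQ} := by
    have := sub_mem (Ideal.mul_mem_left _ (X (ix 1 2) ^ n) hf)
      (Ideal.mul_mem_left _ (plCross 0) hF')
    convert this using 1
    ring
  have h2 := eq_zero_of_mem_supported_of_mem_span (mul_mem hr hF) h1
  have h3 : plCross 0 ≠ 0 := by
    intro h
    have := congrArg (eval fun p : PluckerIndex => if p = ix 1 3 ∨ p = ix 2 4 then (1 : ℂ) else 0) h
    simp [plCross] at this
  rw [(mul_eq_zero.1 h2).resolve_left h3, sub_zero] at hF'
  exact mem_of_X_pow_mul_mem hF'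

/-- Modulo `plP` and `plQ` the vectors `plCross` and `plEta` are proportional, by the triple product
formula. Hence `plCross 0 * ∑ a_i η_i` is congruent to `η_0 ∑ a_i r_i`, and the nonzerodivisor
`plCross 0` cancels. -/
theorem sum_mul_plEta_mem (a : Fin 3 → RingPl)
    (h : ∑ i, a i * plCross i ∈ Ideal.span {plP, plQ}) :
    ∑ i, a i * plEta i ∈ Ideal.span {plP, plQ} := by
  apply mem_of_plCross_mul_mem
  obtain ⟨b, c, hbc⟩ := Ideal.mem_span_pair.1 h
  refine Ideal.mem_span_pair.2 ⟨plEta 0 * b + a 1 * X (ix 2 4) - a 2 * X (ix 1 4),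
    plEta 0 * c - a 1 * X (ix 2 3) + a 2 * X (ix 1 3), ?_⟩
  simp only [Fin.sum_univ_three, plP, plQ, plEta, plCross, Matrix.cons_val] at hbc ⊢
  linear_combination X (ix 1 2) * hbc

theorem mem_of_X_mul_mem_pluckerIdeal {f : RingPl} (hf : X (ix 3 4) * f ∈ pluckerIdeal) :
    f ∈ pluckerIdeal := by
  refine mem_of_mul_mem_of_forall (X_ne_zero _) (killVar (ix 3 4) : RingPl →+* RingPl)
    (killVar_self _) (X_dvd_sub_killVar _) (fun i => ?_) ?_ ?_ sum_mul_plEta_mem hf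
  · fin_cases i <;> simp [plCross, killVar_of_ne]
  · simp [plP, killVar_of_ne]
  · simp [plQ, killVar_of_ne]

theorem mem_of_X_pow_mul_mem_pluckerIdeal {f : RingPl} {n : ℕ}
    (hf : X (ix 3 4) ^ n * f ∈ pluckerIdeal) : f ∈ pluckerIdeal := by
  induction n with
  | zero => simpa using hf
  | succ n ih =>
    apply ih
    apply mem_of_X_mul_mem_pluckerIdeal
    rwa [← mul_assoc, ← pow_succ']

theorem IsPlucker.pluckerIdeal_le {A : Type*} [CommRing A] [Algebra ℂ A] {w : PluckerIndex → A}
    (hw : IsPlucker w) : pluckerIdeal ≤ RingHom.ker (aeval w : RingPl →ₐ[ℂ] A) := by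
  refine sup_le (Ideal.span_le.2 ?_) (Ideal.span_le.2 ?_)
  · rintro _ ⟨i, rfl⟩
    fin_cases i <;> simp [plEta, plCross]
    · linear_combination hw.r1234
    · linear_combination -hw.r0234
    · linear_combination hw.r0134
  · rintro _ (rfl | rfl) <;> simp [plP, plQ]
    · linear_combination hw.r0123
    · linear_combination hw.r0124

theorem mem_vanishingIdeal_decomposable {f : RingPl} : f ∈ vanishingIdeal ℂ decomposable ↔
    ∀ u v : Fin 5 → ℂ, eval (fun p => u p.1.1 * v p.1.2 - u p.1.2 * v p.1.1) f = 0 := by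
  rw [mem_vanishingIdeal_iff]
  constructor
  · intro h u v
    simpa using h _ ⟨u, v, fun p => rfl⟩
  · rintro h w ⟨u, v, hw⟩
    have : w = fun p => u p.1.1 * v p.1.2 - u p.1.2 * v p.1.1 := funext hw
    simpa [this] using h u v

/-- The Plücker quadrics generate the ideal of the cone over `G(2,5)`. -/
theorem vanishingIdeal_decomposable : vanishingIdeal ℂ decomposable = pluckerIdeal := by
  have hle : pluckerIdeal ≤ vanishingIdeal ℂ decomposable := by
    intro f hf
    rw [mem_vanishingIdeal_decomposable]
    intro u v
    exact (isPlucker_wedge u v).pluckerIdeal_le hf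
  refine le_antisymm (fun f hf => ?_) hle
  obtain ⟨n, F, hF, hF'⟩ := exists_pow_mul_sub_mem pluckerIdeal
    ({ix 0 1, ix 0 2, ix 1 2}ᶜ : Set PluckerIndex) (X (ix 3 4)) (X_mem_supported.2 (by simp)) (by
      have hmem (i) : X (ix 3 4) * plEta i - plCross i ∈ pluckerIdeal :=
        Ideal.mem_sup_left (Ideal.subset_span ⟨i, rfl⟩)
      intro i hi
      simp only [Set.mem_compl_iff, not_not] at hi
      rcases hi with rfl | rfl | rfl
      · refine ⟨_, ?_, hmem 2⟩
        refine sub_mem (mul_mem ?_ ?_) (mul_mem ?_ ?_) <;> exact X_mem_supported.2 (by simp)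
      · refine ⟨-plCross 1, ?_, ?_⟩
        · refine neg_mem (sub_mem (mul_mem ?_ ?_) (mul_mem ?_ ?_)) <;>
            exact X_mem_supported.2 (by simp)
        · convert neg_mem (hmem 1) using 1
          simp [plEta]
          ring
      · refine ⟨_, ?_, hmem 0⟩
        refine sub_mem (mul_mem ?_ ?_) (mul_mem ?_ ?_) <;> exact X_mem_supported.2 (by simp)) f
  have hFJ : F ∈ vanishingIdeal ℂ decomposable := by
    have := sub_mem (Ideal.mul_mem_left _ (X (ix 3 4) ^ n) hf) (hle hF')
    simpa using this
  rw [mem_vanishingIdeal_decomposable] at hFJ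
  have hF0 : F = 0 := by
    refine eq_zero_of_forall_eval (ix 3 4) fun a ha => ?_
    -- For `p_{34} ≠ 0`, these two vectors have wedge with any prescribed values of `p_{34}`,
    -- `p_{i3}`, `p_{i4}`. So a polynomial in these seven coordinates that vanishes on decomposable
    -- bivectors is zero.
    rw [← hFJ ![a (ix 0 3), a (ix 1 3), a (ix 2 3), 0, -a (ix 3 4)]
      ![a (ix 0 4) / a (ix 3 4), a (ix 1 4) / a (ix 3 4), a (ix 2 4) / a (ix 3 4), 1, 0]]
    refine eval_eq_of_mem_supported hF ?_
    refine forall_pluckerIndex ?_ ?_ ?_ ?_ ?_ ?_ ?_ ?_ ?_ ?_ <;> simp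
    all_goals field_simp
  rw [hF0, sub_zero] at hF'
  exact mem_of_X_pow_mul_mem_pluckerIdeal hF'

end Plucker

/-! ### Krull dimension and open covers -/

section Topology

open Topology TopologicalSpace

/-- The Krull dimension of a space is bounded by the dimensions of the members of an open cover. -/
theorem topologicalKrullDim_le_of_cover {X : Type*} [TopologicalSpace X] {n : WithBot ℕ∞}
    (h : ∀ x : X, ∃ U : Set X, IsOpen U ∧ x ∈ U ∧ topologicalKrullDim U ≤ n) :
    topologicalKrullDim X ≤ n := by
  -- Coheights are local: every irreducible closed set containing `Z` meets a given open
  -- neighbourhood of a point of `Z`, so the chains above `Z` are seen in that neighbourhood.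
  rw [topologicalKrullDim, Order.krullDim_eq_iSup_coheight]
  refine iSup_le fun Z => ?_
  obtain ⟨x, hx⟩ := Z.isIrreducible.nonempty
  obtain ⟨U, hU, hxU, hn⟩ := h x
  have he : IsOpenEmbedding (Subtype.val : U → X) := hU.isOpenEmbedding_subtypeVal
  let Z' : {V : IrreducibleCloseds X | ((Subtype.val : U → X) ⁻¹' V).Nonempty} :=
    ⟨Z, ⟨⟨x, hxU⟩, hx⟩⟩
  have h1 : IrreducibleCloseds.map (Subtype.val : U → X) he.continuous
      ((IrreducibleCloseds.orderIsoOfIsOpenEmbedding _ he).symm Z') = Z :=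
    congrArg Subtype.val ((IrreducibleCloseds.orderIsoOfIsOpenEmbedding _ he).apply_symm_apply Z')
  rw [← h1, he.coheight_map]
  exact (Order.coheight_le_krullDim _).trans hn

end Topology

/-! ### Ring maps that become isomorphisms after inverting one element -/

section IsAwayIso

variable {B R : Type*} [CommRing B] [CommRing R]

/-- `f` is injective and becomes an isomorphism after inverting `b` and `f b`. -/
structure IsAwayIso (f : B →+* R) (b : B) : Prop where
  injective : Function.Injective f
  surj : ∀ r, ∃ n : ℕ, ∃ b', f b ^ n * r = f b'

theorem IsAwayIso.isLocalization_away {f : B →+* R} {b : B} (h : IsAwayIso f b) (L : Type*)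
    [CommRing L] [Algebra R L] [IsLocalization.Away (f b) L] [Algebra B L]
    (hL : algebraMap B L = (algebraMap R L).comp f) : IsLocalization.Away b L := by
  have hu : IsUnit (algebraMap R L (f b)) := IsLocalization.Away.algebraMap_isUnit _
  refine IsLocalization.Away.mk _ (by rw [hL]; exact hu) (fun z => ?_) (fun x y hxy => ?_)
  · obtain ⟨n, r, hr⟩ := IsLocalization.Away.surj (f b) z
    obtain ⟨m, b', hb'⟩ := h.surj r
    refine ⟨n + m, b', ?_⟩
    simp only [hL, RingHom.comp_apply, ← hb', map_mul, map_pow, ← hr]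
    ring
  · simp only [hL, RingHom.comp_apply] at hxy
    obtain ⟨n, hn⟩ := IsLocalization.Away.exists_of_eq (f b) hxy
    refine ⟨n, h.injective ?_⟩
    simpa using hn

/-- A denominator outside `p`, multiplied by a power of `f b`, is the image of an element outside
`p.comap f`. Hence `L` is already the localization of `B`, which transports regularity between
charts. -/
theorem IsAwayIso.nonempty_ringEquiv {f : B →+* R} {b : B} (h : IsAwayIso f b) (p : Ideal R)
    [p.IsPrime] (hb : f b ∉ p) (L : Type*) [CommRing L] [Algebra R L]
    [IsLocalization.AtPrime L p] : Nonempty (Localization.AtPrime (p.comap f) ≃+* L) := by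
  let _ : Algebra B L := ((algebraMap R L).comp f).toAlgebra
  have hL (x : B) : algebraMap B L x = algebraMap R L (f x) := rfl
  have : IsLocalization (p.comap f).primeCompl L := by
    refine (isLocalization_iff _ _).2 ⟨fun y => ?_, fun z => ?_, fun {x y} hxy => ?_⟩
    · rw [hL]
      exact IsLocalization.map_units L (⟨f y, y.2⟩ : p.primeCompl)
    · obtain ⟨⟨r, s⟩, hrs⟩ := IsLocalization.surj p.primeCompl z
      obtain ⟨n, b₁, h₁⟩ := h.surj r
      obtain ⟨m, b₂, h₂⟩ := h.surj s
      have hs : b ^ n * b₂ ∈ (p.comap f).primeCompl := by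
        change f (b ^ n * b₂) ∉ p
        rw [map_mul, map_pow, ← h₂]
        exact (p.primeCompl.mul_mem (p.primeCompl.pow_mem hb n)
          (p.primeCompl.mul_mem (p.primeCompl.pow_mem hb m) s.2))
      refine ⟨⟨b ^ m * b₁, ⟨_, hs⟩⟩, ?_⟩
      simp only [hL, map_mul, map_pow, ← h₁, ← h₂] at hrs ⊢
      linear_combination (algebraMap R L (f b)) ^ (n + m) * hrs
    · rw [hL, hL] at hxy
      obtain ⟨s, hs⟩ := IsLocalization.exists_of_eq (M := p.primeCompl) hxy
      obtain ⟨m, b₂, h₂⟩ := h.surj s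
      have hs' : b₂ ∈ (p.comap f).primeCompl := by
        change f b₂ ∉ p
        rw [← h₂]
        exact p.primeCompl.mul_mem (p.primeCompl.pow_mem hb m) s.2
      refine ⟨⟨b₂, hs'⟩, h.injective ?_⟩
      rw [map_mul, map_mul, ← h₂]
      linear_combination f b ^ m * hs
  exact ⟨(IsLocalization.algEquiv (p.comap f).primeCompl
    (Localization.AtPrime (p.comap f)) L).toRingEquiv⟩

theorem IsAwayIso.map_mvPolynomial {f : B →+* R} {b : B} (h : IsAwayIso f b) (σ : Type*) :
    IsAwayIso (MvPolynomial.map f : MvPolynomial σ B →+* MvPolynomial σ R)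
      (MvPolynomial.C b) := by
  refine ⟨MvPolynomial.map_injective f h.injective, fun r => ?_⟩
  induction r using MvPolynomial.induction_on with
  | C a =>
    obtain ⟨n, b', hb'⟩ := h.surj a
    exact ⟨n, MvPolynomial.C b', by simp [← hb']⟩
  | add p q hp hq =>
    obtain ⟨n, p', hp'⟩ := hp
    obtain ⟨m, q', hq'⟩ := hq
    refine ⟨n + m, MvPolynomial.C b ^ m * p' + MvPolynomial.C b ^ n * q', ?_⟩
    simp only [map_add, map_mul, map_pow, ← hp', ← hq']
    ring
  | mul_X p i hp =>
    obtain ⟨n, p', hp'⟩ := hp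
    refine ⟨n, p' * MvPolynomial.X i, ?_⟩
    rw [map_mul, ← hp', MvPolynomial.map_X]
    ring

/-- A domain embeds in its localization, so an inverse of the chart over `B_b` suffices. In the
applications `g` is the evaluation at a point with values in `B_b`. -/
theorem injective_of_comp_eq_algebraMap [IsDomain B] {b : B} (hb : b ≠ 0) {f : B →+* R}
    (g : R →+* Localization.Away b) (hg : g.comp f = algebraMap B (Localization.Away b)) :
    Function.Injective f := by
  have : Function.Injective (algebraMap B (Localization.Away b)) :=
    IsLocalization.injective _ (powers_le_nonZeroDivisors_of_noZeroDivisors hb)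
  rw [← hg] at this
  exact Function.Injective.of_comp this

variable [Algebra ℂ B] [Algebra ℂ R]

/-- The elements of `R` that lie in the image of `f` up to powers of `f b`. -/
def awayRange (f : B →ₐ[ℂ] R) (b : B) : Subalgebra ℂ R where
  carrier := {r | ∃ n : ℕ, ∃ b', f b ^ n * r = f b'}
  mul_mem' := by
    rintro r s ⟨n, b₁, h₁⟩ ⟨m, b₂, h₂⟩
    exact ⟨n + m, b₁ * b₂, by rw [map_mul, ← h₁, ← h₂]; ring⟩
  add_mem' := by
    rintro r s ⟨n, b₁, h₁⟩ ⟨m, b₂, h₂⟩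
    refine ⟨n + m, b ^ m * b₁ + b ^ n * b₂, ?_⟩
    simp only [map_add, map_mul, map_pow, ← h₁, ← h₂]
    ring
  algebraMap_mem' c := ⟨0, algebraMap ℂ B c, by simp⟩

theorem map_mem_awayRange (f : B →ₐ[ℂ] R) (b b' : B) : f b' ∈ awayRange f b :=
  ⟨0, b', by simp⟩

theorem mem_awayRange_of_mul_mem {f : B →ₐ[ℂ] R} {b : B} {r : R}
    (h : f b * r ∈ awayRange f b) : r ∈ awayRange f b := by
  obtain ⟨n, b', hb'⟩ := h
  exact ⟨n + 1, b', by rw [← hb']; ring⟩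

theorem isAwayIso_of_awayRange_eq_top {f : B →ₐ[ℂ] R} {b : B} (hf : Function.Injective f)
    (h : awayRange f b = ⊤) : IsAwayIso (f : B →+* R) b :=
  ⟨hf, fun r => (h ▸ Algebra.mem_top : r ∈ awayRange f b)⟩

end IsAwayIso

/-! ### A criterion for non-regularity -/

section Regular

open IsLocalRing

/-- A quotient of a regular local domain by a nonzero ideal inside the square of the maximal ideal
is not regular. -/
theorem not_isRegularLocalRing_of_surjective {S A : Type*} [CommRing S] [IsDomain S]
    [IsRegularLocalRing S] [CommRing A] (π : S →+* A) (hπ : Function.Surjective π)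
    (hker : RingHom.ker π ≤ maximalIdeal S ^ 2) (h0 : RingHom.ker π ≠ ⊥) :
    ¬ IsRegularLocalRing A := by
  intro hA
  obtain ⟨r, hr, hr0⟩ := Submodule.exists_mem_ne_zero_of_ne_bot h0
  have hdim := ringKrullDim_succ_le_of_surjective π hπ (mem_nonZeroDivisors_of_ne_zero hr0) hr
  have hloc : IsLocalHom π := IsLocalHom.of_surjective π hπ
  have hfgA : (maximalIdeal A).FG := (maximalIdeal A).fg_of_isNoetherianRing
  have hfgS : (maximalIdeal S).FG := (maximalIdeal S).fg_of_isNoetherianRing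
  have hfin := Submodule.FG.finite_generators hfgA
  obtain ⟨t, ht⟩ : ∃ t : A → S, ∀ a, π (t a) = a := ⟨fun a => (hπ a).choose,
    fun a => (hπ a).choose_spec⟩
  have hmap : (maximalIdeal A).comap π = maximalIdeal S :=
    IsLocalRing.maximalIdeal_comap π
  -- Nakayama: lifts of generators of the maximal ideal of `A` generate that of `S` up to the
  -- kernel, which lies in the square. The embedding dimension therefore does not drop, while the
  -- dimension drops by at least one.
  have hspan : maximalIdeal S = Ideal.span (t '' (maximalIdeal A).generators) := by
    apply le_antisymm
    · refine Submodule.le_of_le_smul_of_le_jacobson_bot hfgS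
        (IsLocalRing.maximalIdeal_le_jacobson _) ?_
      intro x hx
      rw [← hmap] at hx
      have h1 : (maximalIdeal A) =
          (Ideal.span (t '' (maximalIdeal A).generators)).map π := by
        rw [Ideal.map_span, Set.image_image]
        simp only [ht, Set.image_id']
        exact (Submodule.span_generators (maximalIdeal A)).symm
      have h2 : π x ∈ (Ideal.span (t '' (maximalIdeal A).generators)).map π := by
        rw [← h1]; exact hx
      obtain ⟨y, hy, hyx⟩ := (Ideal.mem_map_iff_of_surjective π hπ).1 h2
      have h3 : x - y ∈ maximalIdeal S ^ 2 := hker (by simp [RingHom.mem_ker, hyx])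
      rw [sq] at h3
      have := Submodule.add_mem_sup hy h3
      simpa using this
    · refine Ideal.span_le.2 ?_
      rintro _ ⟨a, ha, rfl⟩
      rw [← hmap]
      change π (t a) ∈ maximalIdeal A
      rw [ht]
      have h1 := Submodule.span_generators (maximalIdeal A)
      rw [← h1]
      exact Submodule.subset_span ha
  have hle : (maximalIdeal S).spanFinrank ≤ (maximalIdeal A).spanFinrank := by
    rw [hspan, ← Submodule.FG.generators_ncard hfgA]
    exact (Submodule.spanFinrank_span_le_ncard_of_finite (hfin.image _)).trans
      (Set.ncard_image_le hfin)
  have hS := (isRegularLocalRing_iff S).1 ‹_›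
  have hA' := (isRegularLocalRing_iff A).1 hA
  rw [← hS, ← hA'] at hdim
  have : (maximalIdeal A).spanFinrank + 1 ≤ (maximalIdeal S).spanFinrank := by exact_mod_cast hdim
  omega

end Regular

/-! ### Dimensions of polynomial rings and of their localizations -/

section Dimension

open MvPolynomial

theorem ringKrullDim_mvPolynomial_complex (σ : Type*) [Finite σ] :
    ringKrullDim (MvPolynomial σ ℂ) = Nat.card σ := by
  rw [MvPolynomial.ringKrullDim_of_isNoetherianRing, ringKrullDim_eq_zero_of_field, zero_add]

/-- Setting `X i = 1` maps the localization onto the polynomial ring in the other variables and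
kills the nonzerodivisor `X i - 1`, so the dimension is at least one more than the number of those
variables. -/
theorem card_le_ringKrullDim_away_X {σ : Type*} [Finite σ] (i : σ) :
    (Nat.card σ : WithBot ℕ∞) ≤ ringKrullDim (Localization.Away (X i : MvPolynomial σ ℂ)) := by
  classical
  let τ := {j : σ // j ≠ i}
  let v : σ → MvPolynomial τ ℂ := fun j => if h : j = i then 1 else X ⟨j, h⟩
  let φ : MvPolynomial σ ℂ →+* MvPolynomial τ ℂ := (aeval v : MvPolynomial σ ℂ →ₐ[ℂ] _)
  have hφ : φ (X i) = 1 := by simp [φ, v]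
  let ψ : Localization.Away (X i : MvPolynomial σ ℂ) →+* MvPolynomial τ ℂ :=
    IsLocalization.Away.lift (X i) (g := φ) (by rw [hφ]; exact isUnit_one)
  have hψ (f) : ψ (algebraMap _ _ f) = φ f := IsLocalization.Away.lift_eq _ _ f
  have hs : Function.Surjective ψ := by
    intro f
    refine ⟨algebraMap _ _ (rename Subtype.val f), ?_⟩
    rw [hψ]
    change aeval v (rename Subtype.val f) = f
    rw [aeval_rename]
    have : v ∘ Subtype.val = X := by
      funext j
      simp [v, j.2]
    rw [this, aeval_X_left_apply]
  have hinj : Function.Injective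
      (algebraMap (MvPolynomial σ ℂ) (Localization.Away (X i : MvPolynomial σ ℂ))) :=
    IsLocalization.injective _ (powers_le_nonZeroDivisors_of_noZeroDivisors (X_ne_zero i))
  have : IsDomain (Localization.Away (X i : MvPolynomial σ ℂ)) :=
    IsLocalization.isDomain_localization
      (powers_le_nonZeroDivisors_of_noZeroDivisors (X_ne_zero i))
  have h0 : algebraMap (MvPolynomial σ ℂ) (Localization.Away (X i : MvPolynomial σ ℂ))
      (X i - 1) ≠ 0 := by
    rw [Ne, map_eq_zero_iff _ hinj]
    intro h
    have := congrArg (eval fun _ => (0 : ℂ)) h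
    simp at this
  have h1 := ringKrullDim_succ_le_of_surjective ψ hs (mem_nonZeroDivisors_of_ne_zero h0)
    (by rw [hψ, map_sub, hφ, map_one, sub_self])
  rw [ringKrullDim_mvPolynomial_complex] at h1
  have hc : Nat.card σ = Nat.card τ + 1 := by
    have := Nat.card_congr (Equiv.optionSubtypeNe i)
    rw [← this, Finite.card_option]
  rw [hc]
  exact_mod_cast h1

end Dimension

/-! ### The coordinate ring of the cone over `G(2,5)` -/

section Cone

open MvPolynomial

instance instCommSemiringRingCone : CommSemiring RingCone :=
  CommRing.toCommSemiring (s := Ideal.Quotient.commRing _)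

/-- The Plücker coordinates on the cone over `G(2,5)`. -/
def coneCoord (p : PluckerIndex) : RingCone := Ideal.Quotient.mk _ (X p)

/-- The generic decomposable bivector. -/
def genericWedge (p : PluckerIndex) : MvPolynomial (Bool × Fin 5) ℂ :=
  X (true, p.1.1) * X (false, p.1.2) - X (true, p.1.2) * X (false, p.1.1)

/-- A polynomial over the infinite field `ℂ` is determined by its values, so vanishing on all
decomposable bivectors is vanishing on the generic one. This makes the ring of the cone a domain. -/
theorem vanishingIdeal_eq_ker : vanishingIdeal ℂ decomposable =
    RingHom.ker (aeval genericWedge : RingPl →ₐ[ℂ] MvPolynomial (Bool × Fin 5) ℂ) := by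
  have key (a : Bool × Fin 5 → ℂ) (f : RingPl) : eval a (aeval genericWedge f) =
      eval (fun p => a (true, p.1.1) * a (false, p.1.2) - a (true, p.1.2) * a (false, p.1.1)) f := by
    have : ((aeval a : MvPolynomial (Bool × Fin 5) ℂ →ₐ[ℂ] ℂ).comp (aeval genericWedge)) =
        aeval (fun p : PluckerIndex =>
          a (true, p.1.1) * a (false, p.1.2) - a (true, p.1.2) * a (false, p.1.1)) := by
      ext p
      simp [genericWedge]
    exact DFunLike.congr_fun this f
  ext f
  rw [mem_vanishingIdeal_decomposable, RingHom.mem_ker]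
  constructor
  · intro h
    apply MvPolynomial.funext
    intro a
    change eval a (aeval genericWedge f) = _
    rw [key, h (fun i => a (true, i)) (fun i => a (false, i)), map_zero]
  · intro h u v
    have h1 := key (fun k => if k.1 then u k.2 else v k.2) f
    change aeval genericWedge f = 0 at h
    rw [h, map_zero] at h1
    simpa using h1.symm

instance : (vanishingIdeal ℂ decomposable).IsPrime := by
  rw [vanishingIdeal_eq_ker]
  exact RingHom.ker_isPrime _

instance : IsDomain RingCone := Ideal.Quotient.isDomain _

theorem isPlucker_coneCoord : IsPlucker coneCoord := by
  have h (f : RingPl) (hf : f ∈ pluckerIdeal) :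
      Ideal.Quotient.mk (vanishingIdeal ℂ decomposable) f = 0 :=
    Ideal.Quotient.eq_zero_iff_mem.2 (vanishingIdeal_decomposable ▸ hf)
  have hmem (i) : X (ix 3 4) * plEta i - plCross i ∈ pluckerIdeal :=
    Ideal.mem_sup_left (Ideal.subset_span ⟨i, rfl⟩)
  have hP := h _ (Ideal.mem_sup_right (Ideal.subset_span (.inl rfl) : plP ∈ _))
  have hQ := h _ (Ideal.mem_sup_right (Ideal.subset_span (.inr rfl) : plQ ∈ _))
  have h0 := h _ (hmem 0)
  have h1 := h _ (hmem 1)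
  have h2 := h _ (hmem 2)
  simp only [plP, plQ, plEta, plCross, Matrix.cons_val, map_add, map_sub, map_mul,
    map_neg] at hP hQ h0 h1 h2
  constructor <;> simp only [coneCoord]
  · linear_combination hP
  · linear_combination hQ
  · linear_combination h2
  · linear_combination -h1
  · linear_combination h0

theorem adjoin_coneCoord : Algebra.adjoin ℂ (Set.range coneCoord) = ⊤ := by
  have h : Set.range coneCoord = Ideal.Quotient.mkₐ ℂ (vanishingIdeal ℂ decomposable) ''
      Set.range X := by
    rw [← Set.range_comp]; rfl
  rw [h, ← AlgHom.map_adjoin, adjoin_range_X, Algebra.map_top, AlgHom.range_eq_top]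
  exact Ideal.Quotient.mkₐ_surjective _ _

variable {A : Type*} [CommRing A] [Algebra ℂ A]

/-- The homomorphism on the coordinate ring of the cone given by a solution of the Plücker
relations. -/
def liftCone (w : PluckerIndex → A) (hw : IsPlucker w) : RingCone →ₐ[ℂ] A :=
  Ideal.Quotient.liftₐ _ (aeval w) fun _ ha =>
    hw.pluckerIdeal_le (vanishingIdeal_decomposable ▸ ha)

@[simp]
theorem liftCone_coneCoord (w : PluckerIndex → A) (hw : IsPlucker w) (p : PluckerIndex) :
    liftCone w hw (coneCoord p) = w p := by
  exact aeval_X w p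

end Cone

section Skew

variable {A : Type*} [CommRing A]

/-- The skew-symmetric extension of a bivector to all pairs of indices. -/
def skew (w : PluckerIndex → A) (i j : Fin 5) : A :=
  if h : i < j then w ⟨(i, j), h⟩ else if h : j < i then -w ⟨(j, i), h⟩ else 0

theorem skew_apply (w : PluckerIndex → A) (p : PluckerIndex) : skew w p.1.1 p.1.2 = w p := by
  rw [skew, dif_pos p.2]

theorem skew_self (w : PluckerIndex → A) (i : Fin 5) : skew w i i = 0 := by
  simp [skew]

theorem skew_comm (w : PluckerIndex → A) (i j : Fin 5) : skew w j i = -skew w i j := by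
  rcases lt_trichotomy i j with h | rfl | h
  · simp [skew, h, h.not_gt]
  · simp [skew]
  · simp [skew, h, h.not_gt]

theorem map_skew {B : Type*} [CommRing B] (φ : A →+* B) (w : PluckerIndex → A) (i j : Fin 5) :
    φ (skew w i j) = skew (φ ∘ w) i j := by
  unfold skew
  split_ifs <;> simp

theorem skew_wedge (u v : Fin 5 → A) (i j : Fin 5) :
    skew (fun p => u p.1.1 * v p.1.2 - u p.1.2 * v p.1.1) i j = u i * v j - u j * v i := by
  rcases lt_trichotomy i j with h | rfl | h
  · simp [skew, h]
  · simp [skew]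
  · simp [skew, h, h.not_gt]

end Skew

/-! ### Affine charts of the cone away from its vertex -/

section Charts

open MvPolynomial

theorem skew_coneCoord (i j k l : Fin 5) :
    skew coneCoord i j * skew coneCoord k l = skew coneCoord i k * skew coneCoord j l
      - skew coneCoord i l * skew coneCoord j k := by
  have hinj : Function.Injective (Ideal.Quotient.liftₐ (vanishingIdeal ℂ decomposable)
      (aeval genericWedge : RingPl →ₐ[ℂ] MvPolynomial (Bool × Fin 5) ℂ)
      fun a ha => by rwa [vanishingIdeal_eq_ker] at ha) := by
    rw [injective_iff_map_eq_zero]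
    intro a ha
    obtain ⟨a, rfl⟩ := Ideal.Quotient.mk_surjective a
    rw [Ideal.Quotient.eq_zero_iff_mem, vanishingIdeal_eq_ker]
    exact ha
  set φ := Ideal.Quotient.liftₐ (vanishingIdeal ℂ decomposable)
      (aeval genericWedge : RingPl →ₐ[ℂ] MvPolynomial (Bool × Fin 5) ℂ)
      fun a ha => by rwa [vanishingIdeal_eq_ker] at ha with hφ
  have h (i j : Fin 5) : φ (skew coneCoord i j) =
      X (true, i) * X (false, j) - X (true, j) * X (false, i) := by
    have h1 : (φ : RingCone →+* MvPolynomial (Bool × Fin 5) ℂ) ∘ coneCoord = genericWedge := by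
      funext p
      exact aeval_X genericWedge p
    have h2 := map_skew (φ : RingCone →+* MvPolynomial (Bool × Fin 5) ℂ) coneCoord i j
    rw [h1] at h2
    refine h2.trans ?_
    exact skew_wedge (fun i => X (true, i)) (fun i => X (false, i)) i j
  apply hinj
  simp only [map_mul, map_sub, h]
  ring

/-- The Plücker indices that meet the index `q`. -/
abbrev Meeting (q : PluckerIndex) : Type :=
  {p : PluckerIndex // (p.1.1 = q.1.1 ∨ p.1.1 = q.1.2) ∨ (p.1.2 = q.1.1 ∨ p.1.2 = q.1.2)}

theorem card_meeting (q : PluckerIndex) : Nat.card (Meeting q) = 7 := by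
  rw [Nat.card_eq_fintype_card]
  revert q
  decide

/-- The index `q` meets itself. -/
abbrev Meeting.self (q : PluckerIndex) : Meeting q := ⟨q, .inl (.inl rfl)⟩

/-- The inclusion of the polynomial ring in the coordinates that meet `q`. -/
def coneChart (q : PluckerIndex) : MvPolynomial (Meeting q) ℂ →ₐ[ℂ] RingCone :=
  aeval fun p => coneCoord p.1

theorem skew_mem_range_coneChart (q : PluckerIndex) (i k : Fin 5)
    (hi : i = q.1.1 ∨ i = q.1.2) : ∃ g, coneChart q g = skew coneCoord i k := by
  rcases lt_trichotomy i k with h | rfl | h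
  · exact ⟨X ⟨⟨(i, k), h⟩, .inl hi⟩, by simp [coneChart, skew, h]⟩
  · exact ⟨0, by simp [skew]⟩
  · exact ⟨-X ⟨⟨(k, i), h⟩, .inr hi⟩, by simp [coneChart, skew, h, h.not_gt]⟩

/-- With `q = (i, j)`, the relation `p_{ij} p_{kl} = p_{ik} p_{jl} - p_{il} p_{jk}` expresses every
coordinate through the seven that meet `q`. Conversely, the `i`-th and `j`-th rows of the skew
matrix, with the second divided by `p_{ij}`, define a decomposable bivector with prescribed values
of those seven. -/
theorem isAwayIso_coneChart (q : PluckerIndex) :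
    IsAwayIso (coneChart q : MvPolynomial (Meeting q) ℂ →+* RingCone) (X (Meeting.self q)) := by
  have hq : coneChart q (X (Meeting.self q)) = skew coneCoord q.1.1 q.1.2 := by
    simp [coneChart, skew_apply]
  apply isAwayIso_of_awayRange_eq_top
  · let b : MvPolynomial (Meeting q) ℂ := X (Meeting.self q)
    let x : PluckerIndex → Localization.Away b := fun p =>
      if h : (p.1.1 = q.1.1 ∨ p.1.1 = q.1.2) ∨ (p.1.2 = q.1.1 ∨ p.1.2 = q.1.2) then
        algebraMap (MvPolynomial (Meeting q) ℂ) (Localization.Away b) (X ⟨p, h⟩) else 0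
    let inv : Localization.Away b := IsLocalization.Away.invSelf b
    have hinv : skew x q.1.1 q.1.2 * inv = 1 := by
      rw [skew_apply]
      have : x q = algebraMap _ _ b := by simp [x, b]
      rw [this]
      exact IsLocalization.Away.mul_invSelf b
    let g := liftCone _ (isPlucker_wedge (fun k => skew x q.1.1 k) (fun k => skew x q.1.2 k * inv))
    refine injective_of_comp_eq_algebraMap (b := b) (X_ne_zero _)
      (f := (coneChart q : MvPolynomial (Meeting q) ℂ →+* RingCone)) (g : RingCone →+* _) ?_
    have : g.comp (coneChart q) = IsScalarTower.toAlgHom ℂ _ _ := by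
      ext p
      have hx : algebraMap (MvPolynomial (Meeting q) ℂ) (Localization.Away b) (X p)
          = skew x p.1.1.1 p.1.1.2 := by
        rw [skew_apply]
        simp only [x]
        rw [dif_pos p.2]
      simp only [AlgHom.comp_apply, coneChart, aeval_X, g, liftCone_coneCoord,
        IsScalarTower.coe_toAlgHom', hx]
      obtain ⟨⟨⟨k, l⟩, hkl⟩, (h | h) | (h | h)⟩ := p <;> simp only at h ⊢ <;> subst h
      · rw [skew_self, skew_comm x q.1.1 q.1.2]
        linear_combination skew x q.1.1 l * hinv
      · rw [skew_self]
        linear_combination skew x q.1.2 l * hinv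
      · rw [skew_self, skew_comm x q.1.1 q.1.2, skew_comm x q.1.1 k]
        linear_combination -skew x q.1.1 k * hinv
      · rw [skew_self, skew_comm x q.1.2 k]
        linear_combination -skew x q.1.2 k * hinv
    exact RingHom.ext fun p => DFunLike.congr_fun this p
  · rw [eq_top_iff, ← adjoin_coneCoord, Algebra.adjoin_le_iff]
    rintro _ ⟨p, rfl⟩
    apply mem_awayRange_of_mul_mem
    have hm (i k) (hi : i = q.1.1 ∨ i = q.1.2) :
        skew coneCoord i k ∈ awayRange (coneChart q) (X (Meeting.self q)) := by
      obtain ⟨g, hg⟩ := skew_mem_range_coneChart q i k hi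
      rw [← hg]
      exact map_mem_awayRange _ _ _
    rw [hq, ← skew_apply coneCoord p, skew_coneCoord]
    exact sub_mem (mul_mem (hm _ _ (.inl rfl)) (hm _ _ (.inr rfl)))
      (mul_mem (hm _ _ (.inl rfl)) (hm _ _ (.inr rfl)))

end Charts

/-! ### The cone has dimension at most seven -/

section ConeDimension

open MvPolynomial

theorem exists_sub_algebraMap_mem (r : RingCone) :
    ∃ c : ℂ, r - algebraMap ℂ RingCone c ∈ Ideal.span (Set.range coneCoord) := by
  have hr : r ∈ Algebra.adjoin ℂ (Set.range coneCoord) := adjoin_coneCoord ▸ Algebra.mem_top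
  induction hr using Algebra.adjoin_induction with
  | mem x hx => exact ⟨0, by simpa using Ideal.subset_span hx⟩
  | algebraMap c => exact ⟨c, by simp⟩
  | add x y _ _ hx hy =>
    obtain ⟨c, hc⟩ := hx
    obtain ⟨d, hd⟩ := hy
    refine ⟨c + d, ?_⟩
    convert add_mem hc hd using 1
    rw [map_add]
    ring
  | mul x y _ _ hx hy =>
    obtain ⟨c, hc⟩ := hx
    obtain ⟨d, hd⟩ := hy
    refine ⟨c * d, ?_⟩
    convert add_mem (Ideal.mul_mem_right y _ hc) (Ideal.mul_mem_left _ (algebraMap ℂ RingCone c) hd)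
      using 1
    rw [map_mul]
    ring

/-- A system of parameters at the vertex of the cone. -/
def coneParameters : Finset RingCone := by
  classical
  exact {coneCoord (ix 0 1), coneCoord (ix 0 2), coneCoord (ix 0 3) + coneCoord (ix 1 2),
    coneCoord (ix 0 4) + coneCoord (ix 1 3), coneCoord (ix 1 4) + coneCoord (ix 2 3),
    coneCoord (ix 2 4), coneCoord (ix 3 4)}

/-- Once the seven linear forms vanish, three Plücker relations become successively `p_{03} p_{12} =
0`, `p_{04} p_{13} = 0`, `p_{14} p_{23} = 0`. In each product the two factors are negatives of each
other, so their square is zero. -/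
theorem IsPlucker.eq_zero_of_parameters {D : Type*} [CommRing D] [IsDomain D]
    {w : PluckerIndex → D} (hw : IsPlucker w) (e1 : w (ix 0 1) = 0) (e2 : w (ix 0 2) = 0)
    (e3 : w (ix 0 3) + w (ix 1 2) = 0) (e4 : w (ix 0 4) + w (ix 1 3) = 0)
    (e5 : w (ix 1 4) + w (ix 2 3) = 0) (e6 : w (ix 2 4) = 0) (e7 : w (ix 3 4) = 0) :
    ∀ p, w p = 0 := by
  have r1 := hw.r0123
  have r2 := hw.r0134
  have r3 := hw.r1234
  rw [e1, e2] at r1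
  have z03 : w (ix 0 3) = 0 := by
    refine pow_eq_zero_iff two_ne_zero |>.1 ?_
    linear_combination w (ix 0 3) * e3 - r1
  have z12 : w (ix 1 2) = 0 := by linear_combination e3 - z03
  rw [z03, e7] at r2
  have z04 : w (ix 0 4) = 0 := by
    refine pow_eq_zero_iff two_ne_zero |>.1 ?_
    linear_combination w (ix 0 4) * e4 - r2
  have z13 : w (ix 1 3) = 0 := by linear_combination e4 - z04
  rw [z12, e7, e6] at r3
  have z14 : w (ix 1 4) = 0 := by
    refine pow_eq_zero_iff two_ne_zero |>.1 ?_
    linear_combination w (ix 1 4) * e5 - r3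
  have z23 : w (ix 2 3) = 0 := by linear_combination e5 - z14
  refine forall_pluckerIndex ?_ ?_ ?_ ?_ ?_ ?_ ?_ ?_ ?_ ?_ <;> assumption

theorem coneCoord_mem_of_coneParameters_subset (Q : Ideal RingCone) [Q.IsPrime]
    (h : (coneParameters : Set RingCone) ⊆ Q) (p : PluckerIndex) : coneCoord p ∈ Q := by
  have hw := IsPlucker.map (B := RingCone ⧸ Q) (Ideal.Quotient.mk Q) isPlucker_coneCoord
  have key {x : RingCone} (hx : x ∈ coneParameters) : Ideal.Quotient.mk Q x = 0 :=
    Ideal.Quotient.eq_zero_iff_mem.2 (h hx)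
  refine Ideal.Quotient.eq_zero_iff_mem.1 (hw.eq_zero_of_parameters ?_ ?_ ?_ ?_ ?_ ?_ ?_ p) <;>
    simp only [Function.comp_apply, ← map_add] <;> exact key (by simp [coneParameters])

/-- Off the vertex, local rings are those of a polynomial ring in seven variables. The vertex ideal
is minimal over seven elements, so Krull's height theorem applies there. -/
theorem ringKrullDim_ringCone_le : ringKrullDim RingCone ≤ 7 := by
  rw [ringKrullDim_le_iff_height_le]
  intro p hp
  by_cases h : ∀ q, coneCoord q ∈ p
  · have hmin : p ∈ (Ideal.span (coneParameters : Set RingCone)).minimalPrimes := by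
      refine ⟨⟨hp, Ideal.span_le.2 ?_⟩, ?_⟩
      · intro x hx
        simp only [coneParameters, Finset.coe_insert, Finset.coe_singleton, Set.mem_insert_iff,
          Set.mem_singleton_iff] at hx
        rcases hx with rfl | rfl | rfl | rfl | rfl | rfl | rfl <;>
          first | exact h _ | exact add_mem (h _) (h _)
      · rintro Q ⟨hQ, hQ'⟩ hQp r hr
        have hQc := coneCoord_mem_of_coneParameters_subset Q (Ideal.span_le.1 hQ')
        have hle : Ideal.span (Set.range coneCoord) ≤ Q := by
          refine Ideal.span_le.2 ?_
          rintro _ ⟨q, rfl⟩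
          exact hQc q
        obtain ⟨c, hc⟩ := exists_sub_algebraMap_mem r
        have hcp : algebraMap ℂ RingCone c ∈ p := by
          have := sub_mem hr (hQp (hle hc))
          simpa using this
        have hc0 : c = 0 := by
          by_contra hc0
          exact hp.ne_top (Ideal.eq_top_of_isUnit_mem _ hcp
            ((IsUnit.mk0 c hc0).map (algebraMap ℂ RingCone)))
        rw [hc0, map_zero, sub_zero] at hc
        exact hle hc
    have h1 := Ideal.height_le_card_of_mem_minimalPrimes_span_finset hmin
    have h2 : coneParameters.card ≤ 7 := by
      classical
      exact (Finset.card_insert_le _ _).trans (Nat.succ_le_succ Finset.card_le_six)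
    exact WithBot.coe_le_coe.2 (h1.trans (by exact_mod_cast h2))
  · push Not at h
    obtain ⟨q, hq⟩ := h
    have hq' : (coneChart q : MvPolynomial (Meeting q) ℂ →+* RingCone) (X (Meeting.self q)) ∉ p := by
      simpa [coneChart] using hq
    obtain ⟨e⟩ := (isAwayIso_coneChart q).nonempty_ringEquiv p hq' (Localization.AtPrime p)
    rw [← IsLocalization.AtPrime.ringKrullDim_eq_height p (Localization.AtPrime p),
      ← ringKrullDim_eq_of_ringEquiv e,
      IsLocalization.AtPrime.ringKrullDim_eq_height
        (p.comap (coneChart q : MvPolynomial (Meeting q) ℂ →+* RingCone))]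
    refine Ideal.height_le_ringKrullDim_of_isPrime.trans ?_
    rw [ringKrullDim_mvPolynomial_complex, card_meeting]
    rfl

end ConeDimension

/-! ### Regular points of the product of the cone with `𝔸⁷` -/

section ConeTimesAffine

open MvPolynomial IsLocalRing

/-- The coordinate ring of the product of the cone over `G(2,5)` with the affine `7`-space. -/
abbrev RingConeA : Type := MvPolynomial (Fin 7) RingCone

theorem ringKrullDim_ringConeA_le : ringKrullDim RingConeA ≤ 14 := by
  rw [MvPolynomial.ringKrullDim_of_isNoetherianRing]
  calc ringKrullDim RingCone + (Nat.card (Fin 7) : WithBot ℕ∞) ≤ 7 + 7 := by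
        gcongr
        · exact ringKrullDim_ringCone_le
        · simp
    _ = 14 := by norm_num

theorem isRegularLocalRing_of_coneCoord_notMem (Q : Ideal RingConeA) [Q.IsPrime]
    {q : PluckerIndex} (hq : C (coneCoord q) ∉ Q) :
    IsRegularLocalRing (Localization.AtPrime Q) := by
  have h := (isAwayIso_coneChart q).map_mvPolynomial (Fin 7)
  obtain ⟨e⟩ := h.nonempty_ringEquiv Q (by simpa [coneChart] using hq) (Localization.AtPrime Q)
  exact IsRegularLocalRing.of_ringEquiv e

theorem pluckerIdeal_le_sq : pluckerIdeal ≤ Ideal.span (Set.range X) ^ 2 := by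
  have h (p q : PluckerIndex) : (X p * X q : RingPl) ∈ Ideal.span (Set.range X) ^ 2 := by
    rw [sq]
    exact Ideal.mul_mem_mul (Ideal.subset_span ⟨p, rfl⟩) (Ideal.subset_span ⟨q, rfl⟩)
  refine sup_le (Ideal.span_le.2 ?_) (Ideal.span_le.2 ?_)
  · rintro _ ⟨i, rfl⟩
    fin_cases i
    · exact sub_mem (h _ _) (sub_mem (h _ _) (h _ _))
    · refine sub_mem ?_ (sub_mem (h _ _) (h _ _))
      simpa [plEta] using h _ _
    · exact sub_mem (h _ _) (sub_mem (h _ _) (h _ _))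
  · rintro _ (rfl | rfl) <;> exact add_mem (h _ _) (sub_mem (h _ _) (h _ _))

theorem plP_ne_zero : plP ≠ 0 := by
  intro h
  have := congrArg (eval fun p : PluckerIndex => if p = ix 1 2 ∨ p = ix 0 3 then (1 : ℂ) else 0) h
  simp [plP] at this

/-- The local ring is a quotient of a local ring of `𝔸¹⁰ × 𝔸⁷`. The kernel comes from quadrics in
the Plücker coordinates, all of which lie in the maximal ideal, so it is contained in the square of
that ideal. It is nonzero because it contains `plP`. -/
theorem not_isRegularLocalRing_of_coneCoord_mem (Q : Ideal RingConeA) [Q.IsPrime]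
    (hQ : ∀ q, C (coneCoord q) ∈ Q) : ¬ IsRegularLocalRing (Localization.AtPrime Q) := by
  let J := vanishingIdeal ℂ decomposable
  let π : MvPolynomial (Fin 7) RingPl →+* RingConeA := map (Ideal.Quotient.mk J)
  have hπ : Function.Surjective π := map_surjective _ Ideal.Quotient.mk_surjective
  let N := Q.comap π
  let S := Localization.AtPrime N
  let ρ : S →+* Localization.AtPrime Q := Localization.localRingHom N Q π rfl
  have hker : RingHom.ker π ≤ N ^ 2 := by
    rw [ker_map, Ideal.mk_ker]
    change (vanishingIdeal ℂ decomposable).map C ≤ N ^ 2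
    rw [vanishingIdeal_decomposable]
    refine (Ideal.map_mono pluckerIdeal_le_sq).trans ?_
    rw [Ideal.map_pow]
    refine Ideal.pow_right_mono ?_ 2
    rw [Ideal.map_span, Ideal.span_le]
    rintro _ ⟨_, ⟨q, rfl⟩, rfl⟩
    change π (C (X q)) ∈ Q
    simp only [π, map_C]
    exact hQ q
  have hmap : N.map (algebraMap _ S) = maximalIdeal S := Localization.AtPrime.map_eq_maximalIdeal
  have hρ : Function.Surjective ρ := RingHom.surjective_localRingHom_of_surjective π hπ Q
  have : IsDomain S := IsLocalization.isDomain_localization N.primeCompl_le_nonZeroDivisors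
  have : IsRegularLocalRing S := inferInstance
  refine not_isRegularLocalRing_of_surjective (S := S) (A := Localization.AtPrime Q) ρ hρ ?_ ?_
  · intro x hx
    obtain ⟨s, u, rfl⟩ := IsLocalization.exists_mk'_eq N.primeCompl x
    have hx' : ρ (algebraMap _ S s) = 0 := by
      have h1 := congrArg ρ (IsLocalization.mk'_spec S s u)
      rw [map_mul, RingHom.mem_ker.1 hx, zero_mul] at h1
      exact h1.symm
    have h2 : algebraMap RingConeA (Localization.AtPrime Q) (π s) = 0 := by
      rw [← hx']
      exact (Localization.localRingHom_to_map N Q π rfl s).symm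
    have h3 : π s = 0 := by
      rw [map_eq_zero_iff] at h2
      · exact h2
      · exact IsLocalization.injective _ Q.primeCompl_le_nonZeroDivisors
    have h4 : algebraMap _ S s ∈ maximalIdeal S ^ 2 := by
      rw [← hmap, ← Ideal.map_pow]
      exact Ideal.mem_map_of_mem _ (hker h3)
    rw [← IsLocalization.mk'_spec S s u] at h4
    exact (Ideal.mul_unit_mem_iff_mem _ (IsLocalization.map_units S u)).1 h4
  · intro h
    have h1 : algebraMap (MvPolynomial (Fin 7) RingPl) S (C plP) ∈ RingHom.ker ρ := by
      rw [RingHom.mem_ker]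
      refine (Localization.localRingHom_to_map N Q π rfl _).trans ?_
      have : π (C plP) = 0 := by
        simp only [π, map_C]
        rw [Ideal.Quotient.eq_zero_iff_mem.2, C_0]
        change plP ∈ vanishingIdeal ℂ decomposable
        rw [vanishingIdeal_decomposable]
        exact Ideal.mem_sup_right (Ideal.subset_span (.inl rfl))
      rw [this, map_zero]
    rw [h, Submodule.mem_bot, map_eq_zero_iff _
      (IsLocalization.injective S N.primeCompl_le_nonZeroDivisors)] at h1
    exact plP_ne_zero (C_injective _ _ (h1.trans C_0.symm))

theorem isRegularLocalRing_localization_iff (Q : Ideal RingConeA) [Q.IsPrime] :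
    IsRegularLocalRing (Localization.AtPrime Q) ↔ ∃ q, C (coneCoord q) ∉ Q := by
  constructor
  · intro h
    by_contra! h'
    exact not_isRegularLocalRing_of_coneCoord_mem Q h' h
  · rintro ⟨q, hq⟩
    exact isRegularLocalRing_of_coneCoord_notMem Q hq

end ConeTimesAffine

/-! ### The equations of `𝔘` as Plücker relations -/

section Bivector

variable {A B : Type*} [CommRing A] [CommRing B]

/-- The bivector in five variables with components `τ`, `η`, `p`, `q`. -/
def bivector (τ : A) (η p q : Fin 3 → A) : PluckerIndex → A := fun i =>
  (!![0, η 2, -η 1, p 0, q 0;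
      0, 0, η 0, p 1, q 1;
      0, 0, 0, p 2, q 2;
      0, 0, 0, 0, τ;
      0, 0, 0, 0, 0] : Matrix (Fin 5) (Fin 5) A) i.1.1 i.1.2

theorem map_bivector (φ : A →+* B) (τ : A) (η p q : Fin 3 → A) :
    φ ∘ bivector τ η p q = bivector (φ τ) (φ ∘ η) (φ ∘ p) (φ ∘ q) := by
  funext i
  revert i
  refine forall_pluckerIndex ?_ ?_ ?_ ?_ ?_ ?_ ?_ ?_ ?_ ?_ <;> simp [bivector]

/-- The three relations that involve both indices `3` and `4` are the components of `τ η = p × q`;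
the other two are `p · η = 0` and `q · η = 0`. -/
theorem isPlucker_bivector {τ : A} {η p q : Fin 3 → A}
    (h : ∀ i, τ * η i = crossProduct p q i) (hp : p ⬝ᵥ η = 0) (hq : q ⬝ᵥ η = 0) :
    IsPlucker (bivector τ η p q) := by
  have h0 := h 0
  have h1 := h 1
  have h2 := h 2
  simp [cross_apply] at h0 h1 h2
  simp only [dotProduct, Fin.sum_univ_three] at hp hq
  constructor <;> simp [bivector]
  · linear_combination hp
  · linear_combination hq
  · linear_combination h2
  · linear_combination -h1
  · linear_combination h0

theorem of_isPlucker_bivector {τ : A} {η p q : Fin 3 → A} (h : IsPlucker (bivector τ η p q)) :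
    (∀ i, τ * η i = crossProduct p q i) ∧ p ⬝ᵥ η = 0 ∧ q ⬝ᵥ η = 0 := by
  obtain ⟨h0, h1, h2, h3, h4⟩ := h
  simp [bivector] at h0 h1 h2 h3 h4
  refine ⟨fun i => ?_, ?_, ?_⟩
  · fin_cases i <;> simp [cross_apply]
    · linear_combination h4
    · linear_combination -h3
    · linear_combination h2
  · simp only [dotProduct, Fin.sum_univ_three]
    linear_combination h0
  · simp only [dotProduct, Fin.sum_univ_three]
    linear_combination h1

/-- The bivector with components `t`, `y`, `ᵗP x`, `ᵗQ x`. -/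
def bivectorX (v : Coord → A) : PluckerIndex → A :=
  bivector (v .t) (vecY v) ((matP v)ᵀ *ᵥ vecX v) ((matQ v)ᵀ *ᵥ vecX v)

/-- The bivector with components `s`, `x`, `P y`, `Q y`. -/
def bivectorY (v : Coord → A) : PluckerIndex → A :=
  bivector (v .s) (vecX v) (matP v *ᵥ vecY v) (matQ v *ᵥ vecY v)

theorem bivectorX_comp (φ : A →+* B) (v : Coord → A) :
    bivectorX (φ ∘ v) = φ ∘ bivectorX v := by
  have h (M : Matrix (Fin 3) (Fin 3) A) : (φ.mapMatrix M)ᵀ = φ.mapMatrix Mᵀ := rfl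
  rw [bivectorX, bivectorX, map_bivector, matP_comp, matQ_comp, vecX_comp, vecY_comp, h, h,
    map_mulVec_mapMatrix, map_mulVec_mapMatrix, Function.comp_apply]

theorem bivectorY_comp (φ : A →+* B) (v : Coord → A) :
    bivectorY (φ ∘ v) = φ ∘ bivectorY v := by
  rw [bivectorY, bivectorY, map_bivector, matP_comp, matQ_comp, vecX_comp, vecY_comp,
    map_mulVec_mapMatrix, map_mulVec_mapMatrix, Function.comp_apply]

variable [Algebra ℂ A]

theorem IsPoint.isPlucker_bivectorX {v : Coord → A} (hv : IsPoint v) :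
    IsPlucker (bivectorX v) :=
  isPlucker_bivector hv.ty ((dotProduct_mulVec_matP _ _ _).symm.trans hv.xPy)
    ((dotProduct_mulVec_matQ _ _ _).symm.trans hv.xQy)

theorem IsPoint.isPlucker_bivectorY {v : Coord → A} (hv : IsPoint v) :
    IsPlucker (bivectorY v) :=
  isPlucker_bivector hv.sx ((dotProduct_comm _ _).trans hv.xPy)
    ((dotProduct_comm _ _).trans hv.xQy)

theorem isPoint_of_isPlucker_bivectorX {v : Coord → A} (h : IsPlucker (bivectorX v)) (k : Fin 3)
    (hk : IsUnit (v (.x k))) (hs : v .s * v (.x k) = sharpY (matP v) (matQ v) (vecY v) k) :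
    IsPoint v := by
  obtain ⟨h1, h2, h3⟩ := of_isPlucker_bivector h
  exact isPoint_of_isUnit_x v k hk hs h1 ((dotProduct_mulVec_matP _ _ _).trans h2)
    ((dotProduct_mulVec_matQ _ _ _).trans h3)

theorem isPoint_of_isPlucker_bivectorY {v : Coord → A} (h : IsPlucker (bivectorY v)) (k : Fin 3)
    (hk : IsUnit (v (.y k))) (ht : v .t * v (.y k) = sharpX (matP v) (matQ v) (vecX v) k) :
    IsPoint v := by
  obtain ⟨h1, h2, h3⟩ := of_isPlucker_bivector h
  exact isPoint_of_isUnit_y v k hk ht h1 ((dotProduct_comm _ _).trans h2)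
    ((dotProduct_comm _ _).trans h3)

end Bivector

/-! ### Subalgebras closed under the sharp maps -/

section Subalgebra

variable {A : Type*} [CommRing A] [Algebra ℂ A]

/-- The matrices and `y` do not involve `s`, so replacing `s` by `0` gives a point with values in
`S` and the same `y^♯`. -/
theorem sharpY_mem (S : Subalgebra ℂ A) (v : Coord → A) (h : ∀ c ≠ .s, v c ∈ S) (k : Fin 3) :
    sharpY (matP v) (matQ v) (vecY v) k ∈ S := by
  let v' : Coord → S := fun c => if hc : c = .s then 0 else ⟨v c, h c hc⟩
  have hP : matP v = matP ((S.val : S →+* A) ∘ v') := by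
    simp [matP, v']
  have hQ : matQ v = matQ ((S.val : S →+* A) ∘ v') := by
    simp [matQ, v']
  have hY : vecY v = (S.val : S →+* A) ∘ vecY v' := by
    funext i
    simp [vecY, v']
  rw [hP, hQ, hY, matP_comp, matQ_comp, sharpY_map]
  exact (sharpY (matP v') (matQ v') (vecY v') k).2

theorem sharpX_mem (S : Subalgebra ℂ A) (v : Coord → A) (h : ∀ c ≠ .t, v c ∈ S) (k : Fin 3) :
    sharpX (matP v) (matQ v) (vecX v) k ∈ S := by
  let v' : Coord → S := fun c => if hc : c = .t then 0 else ⟨v c, h c hc⟩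
  have hP : matP v = matP ((S.val : S →+* A) ∘ v') := by
    simp [matP, v']
  have hQ : matQ v = matQ ((S.val : S →+* A) ∘ v') := by
    simp [matQ, v']
  have hX : vecX v = (S.val : S →+* A) ∘ vecX v' := by
    funext i
    simp [vecX, v']
  rw [hP, hQ, hX, matP_comp, matQ_comp, sharpX_map]
  exact (sharpX (matP v') (matQ v') (vecX v') k).2

end Subalgebra

/-! ### Maps from the ring of `c(G(2,5)) × 𝔸⁷` to the ring of `𝔘` -/

section ConeCharts

open MvPolynomial

/-- The homomorphism from the coordinate ring of `c(G(2,5)) × 𝔸⁷` given by the bivector `w` and the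
coordinates `z`. -/
def chartHom (w : PluckerIndex → RingU) (hw : IsPlucker w) (z : Fin 7 → Coord) :
    RingConeA →ₐ[ℂ] RingU :=
  aevalTower (liftCone w hw) fun i => coordU (z i)

@[simp]
theorem chartHom_C (w : PluckerIndex → RingU) (hw : IsPlucker w) (z : Fin 7 → Coord)
    (p : PluckerIndex) : chartHom w hw z (C (coneCoord p)) = w p := by
  simp [chartHom]

@[simp]
theorem chartHom_X (w : PluckerIndex → RingU) (hw : IsPlucker w) (z : Fin 7 → Coord)
    (i : Fin 7) : chartHom w hw z (X i) = coordU (z i) := by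
  simp [chartHom]

theorem ringConeA_hom_ext {A : Type*} [CommRing A] [Algebra ℂ A] {f g : RingConeA →ₐ[ℂ] A}
    (hC : ∀ p, f (C (coneCoord p)) = g (C (coneCoord p))) (hX : ∀ i, f (X i) = g (X i)) :
    f = g := by
  have h : (f : RingConeA →+* A) = g := by
    refine MvPolynomial.ringHom_ext' ?_ hX
    have h1 : f.comp (Algebra.algHom ℂ RingCone RingConeA) =
        g.comp (Algebra.algHom ℂ RingCone RingConeA) := by
      refine AlgHom.ext_of_adjoin_eq_top adjoin_coneCoord ?_
      rintro _ ⟨p, rfl⟩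
      exact hC p
    exact congrArg (fun φ : RingCone →ₐ[ℂ] A => (φ : RingCone →+* A)) h1
  exact AlgHom.ext fun x => DFunLike.congr_fun h x

theorem chartHom_injective {w : PluckerIndex → RingU} {hw : IsPlucker w} {z : Fin 7 → Coord}
    {b : RingConeA} (hb : b ≠ 0) (v : Coord → Localization.Away b) (hv : IsPoint v)
    (h1 : ∀ p, liftU v hv (w p) = algebraMap RingConeA _ (C (coneCoord p)))
    (h2 : ∀ i, v (z i) = algebraMap RingConeA _ (X i)) :
    Function.Injective (chartHom w hw z) := by
  refine injective_of_comp_eq_algebraMap hb (f := (chartHom w hw z : RingConeA →+* RingU))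
    (liftU v hv : RingU →+* Localization.Away b) ?_
  have : (liftU v hv).comp (chartHom w hw z) = IsScalarTower.toAlgHom ℂ _ _ := by
    refine ringConeA_hom_ext (fun p => ?_) (fun i => ?_)
    · simp [h1]
    · simp [h2]
  exact RingHom.ext fun p => DFunLike.congr_fun this p

/-- The chart of `𝔘` near points with `x ≠ 0`. -/
abbrev chartX (z : Fin 7 → Coord) : RingConeA →ₐ[ℂ] RingU :=
  chartHom (bivectorX coordU) isPoint_coordU.isPlucker_bivectorX z

/-- The chart of `𝔘` near points with `y ≠ 0`. -/
abbrev chartY (z : Fin 7 → Coord) : RingConeA →ₐ[ℂ] RingU :=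
  chartHom (bivectorY coordU) isPoint_coordU.isPlucker_bivectorY z

theorem awayRange_eq_top_of_coordU_mem {B : Type*} [CommRing B] [Algebra ℂ B] {f : B →ₐ[ℂ] RingU}
    {b : B} (h : ∀ c, coordU c ∈ awayRange f b) : awayRange f b = ⊤ := by
  rw [eq_top_iff, ← adjoin_coordU, Algebra.adjoin_le_iff]
  rintro _ ⟨c, rfl⟩
  exact h c

/-- The point `v` over `B_b` has the tautological bivector and seven tautological coordinates, so
evaluation at it inverts the chart. For surjectivity `s` comes last: `x_k s = (y^♯)_k`, and `y^♯`
involves only the coordinates already reached. -/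
theorem isAwayIso_chartX {z : Fin 7 → Coord} {b : RingConeA} (hb : b ≠ 0)
    (v : Coord → Localization.Away b)
    (hw : bivectorX v = fun p => algebraMap RingConeA _ (C (coneCoord p)))
    (hz : ∀ i, v (z i) = algebraMap RingConeA _ (X i)) (k : Fin 3)
    (hk : v (.x k) = algebraMap RingConeA _ b)
    (hs : v .s = IsLocalization.Away.invSelf b * sharpY (matP v) (matQ v) (vecY v) k)
    (hbk : chartX z b = coordU (.x k))
    (hmem : ∀ c ≠ .s, coordU c ∈ awayRange (chartX z) b) :
    IsAwayIso (chartX z : RingConeA →+* RingU) b := by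
  have hu : IsUnit (v (.x k)) := by
    rw [hk]
    exact IsLocalization.Away.algebraMap_isUnit b
  have hs' : v .s * v (.x k) = sharpY (matP v) (matQ v) (vecY v) k := by
    have h := IsLocalization.Away.mul_invSelf (S := Localization.Away b) b
    rw [hs, hk]
    linear_combination sharpY (matP v) (matQ v) (vecY v) k * h
  have hW : IsPlucker (bivectorX v) := by
    rw [hw]
    exact (isPlucker_coneCoord.map (C : RingCone →+* RingConeA)).map
      (algebraMap RingConeA (Localization.Away b))
  have hv := isPoint_of_isPlucker_bivectorX hW k hu hs'
  refine isAwayIso_of_awayRange_eq_top (chartHom_injective hb v hv (fun p => ?_) hz)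
    (awayRange_eq_top_of_coordU_mem fun c => ?_)
  · have h := congrFun (bivectorX_comp (liftU v hv : RingU →+* Localization.Away b) coordU) p
    have h2 : (liftU v hv : RingU →+* Localization.Away b) ∘ coordU = v := by
      funext i
      exact liftU_coordU v hv i
    rw [h2, hw] at h
    exact h.symm
  · by_cases hc : c = .s
    · subst hc
      apply mem_awayRange_of_mul_mem
      rw [hbk, mul_comm, isPoint_coordU.sx]
      exact sharpY_mem _ _ hmem k
    · exact hmem c hc

theorem isAwayIso_chartY {z : Fin 7 → Coord} {b : RingConeA} (hb : b ≠ 0)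
    (v : Coord → Localization.Away b)
    (hw : bivectorY v = fun p => algebraMap RingConeA _ (C (coneCoord p)))
    (hz : ∀ i, v (z i) = algebraMap RingConeA _ (X i)) (k : Fin 3)
    (hk : v (.y k) = algebraMap RingConeA _ b)
    (ht : v .t = IsLocalization.Away.invSelf b * sharpX (matP v) (matQ v) (vecX v) k)
    (hbk : chartY z b = coordU (.y k))
    (hmem : ∀ c ≠ .t, coordU c ∈ awayRange (chartY z) b) :
    IsAwayIso (chartY z : RingConeA →+* RingU) b := by
  have hu : IsUnit (v (.y k)) := by
    rw [hk]
    exact IsLocalization.Away.algebraMap_isUnit b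
  have ht' : v .t * v (.y k) = sharpX (matP v) (matQ v) (vecX v) k := by
    have h := IsLocalization.Away.mul_invSelf (S := Localization.Away b) b
    rw [ht, hk]
    linear_combination sharpX (matP v) (matQ v) (vecX v) k * h
  have hW : IsPlucker (bivectorY v) := by
    rw [hw]
    exact (isPlucker_coneCoord.map (C : RingCone →+* RingConeA)).map
      (algebraMap RingConeA (Localization.Away b))
  have hv := isPoint_of_isPlucker_bivectorY hW k hu ht'
  refine isAwayIso_of_awayRange_eq_top (chartHom_injective hb v hv (fun p => ?_) hz)
    (awayRange_eq_top_of_coordU_mem fun c => ?_)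
  · have h := congrFun (bivectorY_comp (liftU v hv : RingU →+* Localization.Away b) coordU) p
    have h2 : (liftU v hv : RingU →+* Localization.Away b) ∘ coordU = v := by
      funext i
      exact liftU_coordU v hv i
    rw [h2, hw] at h
    exact h.symm
  · by_cases hc : c = .t
    · subst hc
      apply mem_awayRange_of_mul_mem
      rw [hbk, mul_comm, isPoint_coordU.ty]
      exact sharpX_mem _ _ hmem k
    · exact hmem c hc

end ConeCharts

/-! ### Solving for the coordinates in terms of a bivector and seven parameters -/

section Entries

variable {A : Type*} [CommRing A]

/-- The point of the affine `18`-space with the given coordinates. -/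
def mkPoint (s t : A) (x y : Fin 3 → A) (a11 a12 a21 b11 b12 b21 c11 c12 c21 c22 : A) :
    Coord → A
  | .s => s
  | .t => t
  | .x i => x i
  | .y i => y i
  | .a11 => a11
  | .a12 => a12
  | .a21 => a21
  | .b11 => b11
  | .b12 => b12
  | .b21 => b21
  | .c11 => c11
  | .c12 => c12
  | .c21 => c21
  | .c22 => c22

/-- The formulation with additive subgroups serves two purposes: with a subalgebra it shows that the
charts generate, with a prime ideal it describes `Δ`. -/
theorem bivectorX_mem_iff (S : AddSubgroup A) (v : Coord → A) :
    (∀ p, bivectorX v p ∈ S) ↔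
      (v .t ∈ S ∧ (∀ i, v (.y i) ∈ S) ∧ v (.x 0) ∈ S ∧ v (.x 1) ∈ S) ∧
      v .a11 * v (.x 0) + v .a12 * v (.x 1) + v .c11 * v (.x 2) ∈ S ∧
      v .b11 * v (.x 0) + v .b12 * v (.x 1) + v .c12 * v (.x 2) ∈ S ∧
      v .a21 * v (.x 0) - v .a11 * v (.x 1) + v .c21 * v (.x 2) ∈ S ∧
      v .b21 * v (.x 0) - v .b11 * v (.x 1) + v .c22 * v (.x 2) ∈ S := by
  constructor
  · intro h
    have h01 := h (ix 0 1)
    have h02 := h (ix 0 2)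
    have h12 := h (ix 1 2)
    have h03 := h (ix 0 3)
    have h13 := h (ix 1 3)
    have h23 := h (ix 2 3)
    have h04 := h (ix 0 4)
    have h14 := h (ix 1 4)
    have h24 := h (ix 2 4)
    have h34 := h (ix 3 4)
    simp [bivectorX, bivector, matP, matQ, Matrix.mulVec, dotProduct, Fin.sum_univ_three,
      Matrix.transpose_apply, vecX, vecY] at h01 h02 h12 h03 h13 h23 h04 h14 h24 h34
    refine ⟨⟨h34, ?_, h23, h24⟩, h03, h13, ?_, ?_⟩
    · intro i
      fin_cases i <;> assumption
    · rwa [sub_eq_add_neg]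
    · rwa [sub_eq_add_neg]
  · rintro ⟨⟨h34, hy, h23, h24⟩, h03, h13, h04, h14⟩
    rw [sub_eq_add_neg] at h04 h14
    refine forall_pluckerIndex ?_ ?_ ?_ ?_ ?_ ?_ ?_ ?_ ?_ ?_ <;>
    simp [bivectorX, bivector, matP, matQ, Matrix.mulVec, dotProduct, Fin.sum_univ_three,
      Matrix.transpose_apply, vecX, vecY, *]

theorem bivectorY_mem_iff (S : AddSubgroup A) (v : Coord → A) :
    (∀ p, bivectorY v p ∈ S) ↔
      (v .s ∈ S ∧ (∀ i, v (.x i) ∈ S)) ∧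
      v .a11 * v (.y 0) + v .b11 * v (.y 1) + v (.y 2) ∈ S ∧
      v .a12 * v (.y 0) + v .b12 * v (.y 1) ∈ S ∧
      v .c11 * v (.y 0) + v .c12 * v (.y 1) ∈ S ∧
      v .a21 * v (.y 0) + v .b21 * v (.y 1) ∈ S ∧
      -(v .a11 * v (.y 0)) + -(v .b11 * v (.y 1)) + v (.y 2) ∈ S ∧
      v .c21 * v (.y 0) + v .c22 * v (.y 1) ∈ S := by
  constructor
  · intro h
    have h01 := h (ix 0 1)
    have h02 := h (ix 0 2)
    have h12 := h (ix 1 2)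
    have h03 := h (ix 0 3)
    have h13 := h (ix 1 3)
    have h23 := h (ix 2 3)
    have h04 := h (ix 0 4)
    have h14 := h (ix 1 4)
    have h24 := h (ix 2 4)
    have h34 := h (ix 3 4)
    simp [bivectorY, bivector, matP, matQ, Matrix.mulVec, dotProduct, Fin.sum_univ_three,
      vecX, vecY] at h01 h02 h12 h03 h13 h23 h04 h14 h24 h34
    refine ⟨⟨h34, ?_⟩, h03, h13, h23, h04, h14, h24⟩
    intro i
    fin_cases i <;> assumption
  · rintro ⟨⟨h34, hx⟩, h03, h13, h23, h04, h14, h24⟩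
    refine forall_pluckerIndex ?_ ?_ ?_ ?_ ?_ ?_ ?_ ?_ ?_ ?_ <;>
    simp [bivectorY, bivector, matP, matQ, Matrix.mulVec, dotProduct, Fin.sum_univ_three,
      vecX, vecY, *]

theorem two_mul_algebraMap_inv_two (A : Type*) [CommRing A] [Algebra ℂ A] :
    2 * algebraMap ℂ A 2⁻¹ = 1 := by
  rw [← map_ofNat (algebraMap ℂ A) 2, ← map_mul, mul_inv_cancel₀ two_ne_zero, map_one]

/-- Applied with `u = a₁₁ y₁ + b₁₁ y₂` and `y = y₃`: the first entry of `Py` is `u + y`, the second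
entry of `Qy` is `-u + y`. -/
theorem mem_of_add_mem_of_neg_add_mem [Algebra ℂ A] (S : Subalgebra ℂ A) {u y : A}
    (h : u + y ∈ S) (h' : -u + y ∈ S) : y ∈ S := by
  have := S.mul_mem (S.algebraMap_mem 2⁻¹) (S.add_mem h h')
  convert this using 1
  linear_combination -y * two_mul_algebraMap_inv_two A

/-- Each of the four entries `c` occurs in one component of `ᵗPx` or `ᵗQx`, multiplied by `x₃`, and
is found by division. The parameters are `x₃` and the entries `a`, `b`. -/
theorem exists_bivectorX_eq_of_x2 (W : PluckerIndex → A) (ξ : Fin 7 → A) (i : A)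
    (hi : ξ 0 * i = 1) : ∃ v : Coord → A, bivectorX v = W ∧
      (∀ j, v (![.x 2, .a11, .a12, .a21, .b11, .b12, .b21] j) = ξ j) ∧
      v (.x 2) = ξ 0 ∧ v .s = i * sharpY (matP v) (matQ v) (vecY v) 2 := by
  let c11 : A := i * (W (ix 0 3) - ξ 1 * W (ix 2 3) - ξ 2 * W (ix 2 4))
  let c12 : A := i * (W (ix 1 3) - ξ 4 * W (ix 2 3) - ξ 5 * W (ix 2 4))
  let c21 : A := i * (W (ix 0 4) - ξ 3 * W (ix 2 3) + ξ 1 * W (ix 2 4))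
  let c22 : A := i * (W (ix 1 4) - ξ 6 * W (ix 2 3) + ξ 4 * W (ix 2 4))
  let v (s : A) : Coord → A := mkPoint s (W (ix 3 4)) ![W (ix 2 3), W (ix 2 4), ξ 0]
    ![W (ix 1 2), -W (ix 0 2), W (ix 0 1)]
    (ξ 1) (ξ 2) (ξ 3) (ξ 4) (ξ 5) (ξ 6) c11 c12 c21 c22
  -- `y^♯` does not depend on `s`, so it may be computed at the point with `s = 0`.
  refine ⟨v (i * sharpY (matP (v 0)) (matQ (v 0)) (vecY (v 0)) 2), ?_, ?_, rfl, rfl⟩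
  · generalize i * sharpY (matP (v 0)) (matQ (v 0)) (vecY (v 0)) 2 = r
    funext p
    revert p
    refine forall_pluckerIndex ?_ ?_ ?_ ?_ ?_ ?_ ?_ ?_ ?_ ?_ <;>
    simp [bivectorX, bivector, matP, matQ, Matrix.mulVec, dotProduct, Fin.sum_univ_three,
      Matrix.transpose_apply, vecX, vecY, v, mkPoint, c11, c12, c21, c22]
    · linear_combination (W (ix 0 3) - ξ 1 * W (ix 2 3) - ξ 2 * W (ix 2 4)) * hi
    · linear_combination (W (ix 0 4) - ξ 3 * W (ix 2 3) + ξ 1 * W (ix 2 4)) * hi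
    · linear_combination (W (ix 1 3) - ξ 4 * W (ix 2 3) - ξ 5 * W (ix 2 4)) * hi
    · linear_combination (W (ix 1 4) - ξ 6 * W (ix 2 3) + ξ 4 * W (ix 2 4)) * hi
  · intro j
    fin_cases j <;> rfl

theorem mem_of_bivectorX_mem_of_x2 [Algebra ℂ A] (S : Subalgebra ℂ A) (v : Coord → A)
    (h : ∀ p, bivectorX v p ∈ S) (hz : ∀ j, v (![.x 2, .a11, .a12, .a21, .b11, .b12, .b21] j) ∈ S)
    (hd : ∀ r, v (.x 2) * r ∈ S → r ∈ S) (c : Coord) (hc : c ≠ .s) : v c ∈ S := by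
  obtain ⟨⟨ht, hy, hx0, hx1⟩, h03, h13, h04, h14⟩ :=
    (bivectorX_mem_iff (Subalgebra.toSubring S).toAddSubgroup v).1 h
  change ∀ j, v (.y j) ∈ S at hy
  change v .t ∈ S at ht
  change v (.x 0) ∈ S at hx0
  change v (.x 1) ∈ S at hx1
  have hx2 : v (.x 2) ∈ S := hz 0
  have ha11 : v .a11 ∈ S := hz 1
  have ha12 : v .a12 ∈ S := hz 2
  have ha21 : v .a21 ∈ S := hz 3
  have hb11 : v .b11 ∈ S := hz 4
  have hb12 : v .b12 ∈ S := hz 5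
  have hb21 : v .b21 ∈ S := hz 6
  have hc11 : v .c11 ∈ S := hd _ (by
    convert S.sub_mem (S.sub_mem h03 (S.mul_mem ha11 hx0)) (S.mul_mem ha12 hx1) using 1; ring)
  have hc12 : v .c12 ∈ S := hd _ (by
    convert S.sub_mem (S.sub_mem h13 (S.mul_mem hb11 hx0)) (S.mul_mem hb12 hx1) using 1; ring)
  have hc21 : v .c21 ∈ S := hd _ (by
    convert S.add_mem (S.sub_mem h04 (S.mul_mem ha21 hx0)) (S.mul_mem ha11 hx1) using 1; ring)
  have hc22 : v .c22 ∈ S := hd _ (by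
    convert S.add_mem (S.sub_mem h14 (S.mul_mem hb21 hx0)) (S.mul_mem hb11 hx1) using 1; ring)
  rcases c with _ | _ | i | i | _ | _ | _ | _ | _ | _ | _ | _ | _ | _
  any_goals assumption
  · exact absurd rfl hc
  · fin_cases i <;> assumption
  · exact hy i

/-- Here `x₁` is itself a component of the bivector. `ᵗPx` gives `a₁₁` and `b₁₁`; these enter `ᵗQx`,
which then gives `a₂₁` and `b₂₁`. -/
theorem exists_bivectorX_eq_of_x0 (W : PluckerIndex → A) (ξ : Fin 7 → A) (i : A)
    (hi : W (ix 2 3) * i = 1) : ∃ v : Coord → A, bivectorX v = W ∧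
      (∀ j, v (![.x 2, .a12, .c11, .b12, .c12, .c21, .c22] j) = ξ j) ∧
      v (.x 0) = W (ix 2 3) ∧ v .s = i * sharpY (matP v) (matQ v) (vecY v) 0 := by
  let a11 : A := i * (W (ix 0 3) - ξ 1 * W (ix 2 4) - ξ 2 * ξ 0)
  let b11 : A := i * (W (ix 1 3) - ξ 3 * W (ix 2 4) - ξ 4 * ξ 0)
  let a21 : A := i * (W (ix 0 4) + a11 * W (ix 2 4) - ξ 5 * ξ 0)
  let b21 : A := i * (W (ix 1 4) + b11 * W (ix 2 4) - ξ 6 * ξ 0)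
  let v (s : A) : Coord → A := mkPoint s (W (ix 3 4)) ![W (ix 2 3), W (ix 2 4), ξ 0]
    ![W (ix 1 2), -W (ix 0 2), W (ix 0 1)]
    a11 (ξ 1) a21 b11 (ξ 3) b21 (ξ 2) (ξ 4) (ξ 5) (ξ 6)
  refine ⟨v (i * sharpY (matP (v 0)) (matQ (v 0)) (vecY (v 0)) 0), ?_, ?_, rfl, rfl⟩
  · generalize i * sharpY (matP (v 0)) (matQ (v 0)) (vecY (v 0)) 0 = r
    funext p
    revert p
    refine forall_pluckerIndex ?_ ?_ ?_ ?_ ?_ ?_ ?_ ?_ ?_ ?_ <;>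
    simp [bivectorX, bivector, matP, matQ, Matrix.mulVec, dotProduct, Fin.sum_univ_three,
      Matrix.transpose_apply, vecX, vecY, v, mkPoint, a11, b11, a21, b21]
    · linear_combination (W (ix 0 3) - ξ 1 * W (ix 2 4) - ξ 2 * ξ 0) * hi
    · linear_combination (W (ix 0 4) + a11 * W (ix 2 4) - ξ 5 * ξ 0) * hi
    · linear_combination (W (ix 1 3) - ξ 3 * W (ix 2 4) - ξ 4 * ξ 0) * hi
    · linear_combination (W (ix 1 4) + b11 * W (ix 2 4) - ξ 6 * ξ 0) * hi
  · intro j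
    fin_cases j <;> rfl

theorem mem_of_bivectorX_mem_of_x0 [Algebra ℂ A] (S : Subalgebra ℂ A) (v : Coord → A)
    (h : ∀ p, bivectorX v p ∈ S) (hz : ∀ j, v (![.x 2, .a12, .c11, .b12, .c12, .c21, .c22] j) ∈ S)
    (hd : ∀ r, v (.x 0) * r ∈ S → r ∈ S) (c : Coord) (hc : c ≠ .s) : v c ∈ S := by
  obtain ⟨⟨ht, hy, hx0, hx1⟩, h03, h13, h04, h14⟩ :=
    (bivectorX_mem_iff (Subalgebra.toSubring S).toAddSubgroup v).1 h
  change ∀ j, v (.y j) ∈ S at hy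
  change v .t ∈ S at ht
  change v (.x 0) ∈ S at hx0
  change v (.x 1) ∈ S at hx1
  have hx2 : v (.x 2) ∈ S := hz 0
  have ha12 : v .a12 ∈ S := hz 1
  have hc11 : v .c11 ∈ S := hz 2
  have hb12 : v .b12 ∈ S := hz 3
  have hc12 : v .c12 ∈ S := hz 4
  have hc21 : v .c21 ∈ S := hz 5
  have hc22 : v .c22 ∈ S := hz 6
  have ha11 : v .a11 ∈ S := hd _ (by
    convert S.sub_mem (S.sub_mem h03 (S.mul_mem ha12 hx1)) (S.mul_mem hc11 hx2) using 1; ring)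
  have hb11 : v .b11 ∈ S := hd _ (by
    convert S.sub_mem (S.sub_mem h13 (S.mul_mem hb12 hx1)) (S.mul_mem hc12 hx2) using 1; ring)
  have ha21 : v .a21 ∈ S := hd _ (by
    convert S.sub_mem (S.add_mem h04 (S.mul_mem ha11 hx1)) (S.mul_mem hc21 hx2) using 1; ring)
  have hb21 : v .b21 ∈ S := hd _ (by
    convert S.sub_mem (S.add_mem h14 (S.mul_mem hb11 hx1)) (S.mul_mem hc22 hx2) using 1; ring)
  rcases c with _ | _ | i | i | _ | _ | _ | _ | _ | _ | _ | _ | _ | _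
  any_goals assumption
  · exact absurd rfl hc
  · fin_cases i <;> assumption
  · exact hy i

/-- The order is reversed: `ᵗQx` gives `-a₁₁` and `-b₁₁` after division by `x₂`, and then `ᵗPx`
gives `a₁₂` and `b₁₂`. -/
theorem exists_bivectorX_eq_of_x1 (W : PluckerIndex → A) (ξ : Fin 7 → A) (i : A)
    (hi : W (ix 2 4) * i = 1) : ∃ v : Coord → A, bivectorX v = W ∧
      (∀ j, v (![.x 2, .a21, .b21, .c11, .c12, .c21, .c22] j) = ξ j) ∧
      v (.x 1) = W (ix 2 4) ∧ v .s = i * sharpY (matP v) (matQ v) (vecY v) 1 := by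
  let a11 : A := -(i * (W (ix 0 4) - ξ 1 * W (ix 2 3) - ξ 5 * ξ 0))
  let b11 : A := -(i * (W (ix 1 4) - ξ 2 * W (ix 2 3) - ξ 6 * ξ 0))
  let a12 : A := i * (W (ix 0 3) - a11 * W (ix 2 3) - ξ 3 * ξ 0)
  let b12 : A := i * (W (ix 1 3) - b11 * W (ix 2 3) - ξ 4 * ξ 0)
  let v (s : A) : Coord → A := mkPoint s (W (ix 3 4)) ![W (ix 2 3), W (ix 2 4), ξ 0]
    ![W (ix 1 2), -W (ix 0 2), W (ix 0 1)]
    a11 a12 (ξ 1) b11 b12 (ξ 2) (ξ 3) (ξ 4) (ξ 5) (ξ 6)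
  refine ⟨v (i * sharpY (matP (v 0)) (matQ (v 0)) (vecY (v 0)) 1), ?_, ?_, rfl, rfl⟩
  · generalize i * sharpY (matP (v 0)) (matQ (v 0)) (vecY (v 0)) 1 = r
    funext p
    revert p
    refine forall_pluckerIndex ?_ ?_ ?_ ?_ ?_ ?_ ?_ ?_ ?_ ?_ <;>
    simp [bivectorX, bivector, matP, matQ, Matrix.mulVec, dotProduct, Fin.sum_univ_three,
      Matrix.transpose_apply, vecX, vecY, v, mkPoint, a11, b11, a12, b12]
    · linear_combination (W (ix 0 3) - a11 * W (ix 2 3) - ξ 3 * ξ 0) * hi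
    · linear_combination (W (ix 0 4) - ξ 1 * W (ix 2 3) - ξ 5 * ξ 0) * hi
    · linear_combination (W (ix 1 3) - b11 * W (ix 2 3) - ξ 4 * ξ 0) * hi
    · linear_combination (W (ix 1 4) - ξ 2 * W (ix 2 3) - ξ 6 * ξ 0) * hi
  · intro j
    fin_cases j <;> rfl

theorem mem_of_bivectorX_mem_of_x1 [Algebra ℂ A] (S : Subalgebra ℂ A) (v : Coord → A)
    (h : ∀ p, bivectorX v p ∈ S) (hz : ∀ j, v (![.x 2, .a21, .b21, .c11, .c12, .c21, .c22] j) ∈ S)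
    (hd : ∀ r, v (.x 1) * r ∈ S → r ∈ S) (c : Coord) (hc : c ≠ .s) : v c ∈ S := by
  obtain ⟨⟨ht, hy, hx0, hx1⟩, h03, h13, h04, h14⟩ :=
    (bivectorX_mem_iff (Subalgebra.toSubring S).toAddSubgroup v).1 h
  change ∀ j, v (.y j) ∈ S at hy
  change v .t ∈ S at ht
  change v (.x 0) ∈ S at hx0
  change v (.x 1) ∈ S at hx1
  have hx2 : v (.x 2) ∈ S := hz 0
  have ha21 : v .a21 ∈ S := hz 1
  have hb21 : v .b21 ∈ S := hz 2
  have hc11 : v .c11 ∈ S := hz 3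
  have hc12 : v .c12 ∈ S := hz 4
  have hc21 : v .c21 ∈ S := hz 5
  have hc22 : v .c22 ∈ S := hz 6
  have ha11 : v .a11 ∈ S := hd _ (by
    convert S.neg_mem (S.sub_mem (S.sub_mem h04 (S.mul_mem ha21 hx0)) (S.mul_mem hc21 hx2)) using 1; ring)
  have hb11 : v .b11 ∈ S := hd _ (by
    convert S.neg_mem (S.sub_mem (S.sub_mem h14 (S.mul_mem hb21 hx0)) (S.mul_mem hc22 hx2)) using 1; ring)
  have ha12 : v .a12 ∈ S := hd _ (by
    convert S.sub_mem (S.sub_mem h03 (S.mul_mem ha11 hx0)) (S.mul_mem hc11 hx2) using 1; ring)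
  have hb12 : v .b12 ∈ S := hd _ (by
    convert S.sub_mem (S.sub_mem h13 (S.mul_mem hb11 hx0)) (S.mul_mem hc12 hx2) using 1; ring)
  rcases c with _ | _ | i | i | _ | _ | _ | _ | _ | _ | _ | _ | _ | _
  any_goals assumption
  · exact absurd rfl hc
  · fin_cases i <;> assumption
  · exact hy i

/-- The half sum and half difference of the first entry of `Py` and the second entry of `Qy` are
`y₃` and `a₁₁ y₁ + b₁₁ y₂`. The first column of the matrices is then found by division by `y₁`. -/
theorem exists_bivectorY_eq_of_y0 [Algebra ℂ A] (W : PluckerIndex → A) (ξ : Fin 7 → A) (i : A)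
    (hi : ξ 0 * i = 1) : ∃ v : Coord → A, bivectorY v = W ∧
      (∀ j, v (![.y 0, .y 1, .b11, .b12, .b21, .c12, .c22] j) = ξ j) ∧
      v (.y 0) = ξ 0 ∧ v .t = i * sharpX (matP v) (matQ v) (vecX v) 0 := by
  obtain ⟨e, he⟩ : ∃ e : A, 2 * e = 1 := ⟨_, two_mul_algebraMap_inv_two A⟩
  let a11 : A := i * (e * (W (ix 0 3) - W (ix 1 4)) - ξ 2 * ξ 1)
  let a12 : A := i * (W (ix 1 3) - ξ 3 * ξ 1)
  let c11 : A := i * (W (ix 2 3) - ξ 5 * ξ 1)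
  let a21 : A := i * (W (ix 0 4) - ξ 4 * ξ 1)
  let c21 : A := i * (W (ix 2 4) - ξ 6 * ξ 1)
  let v (t : A) : Coord → A := mkPoint (W (ix 3 4)) t ![W (ix 1 2), -W (ix 0 2), W (ix 0 1)]
    ![ξ 0, ξ 1, e * (W (ix 0 3) + W (ix 1 4))]
    a11 a12 a21 (ξ 2) (ξ 3) (ξ 4) c11 (ξ 5) c21 (ξ 6)
  refine ⟨v (i * sharpX (matP (v 0)) (matQ (v 0)) (vecX (v 0)) 0), ?_, ?_, rfl, rfl⟩
  · generalize i * sharpX (matP (v 0)) (matQ (v 0)) (vecX (v 0)) 0 = r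
    funext p
    revert p
    refine forall_pluckerIndex ?_ ?_ ?_ ?_ ?_ ?_ ?_ ?_ ?_ ?_ <;>
    simp [bivectorY, bivector, matP, matQ, Matrix.mulVec, dotProduct, Fin.sum_univ_three,
      vecX, vecY, v, mkPoint, a11, a12, c11, a21, c21]
    · linear_combination (e * (W (ix 0 3) - W (ix 1 4)) - ξ 2 * ξ 1) * hi + W (ix 0 3) * he
    · linear_combination (W (ix 0 4) - ξ 4 * ξ 1) * hi
    · linear_combination (W (ix 1 3) - ξ 3 * ξ 1) * hi
    · linear_combination -(e * (W (ix 0 3) - W (ix 1 4)) - ξ 2 * ξ 1) * hi + W (ix 1 4) * he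
    · linear_combination (W (ix 2 3) - ξ 5 * ξ 1) * hi
    · linear_combination (W (ix 2 4) - ξ 6 * ξ 1) * hi
  · intro j
    fin_cases j <;> rfl

theorem mem_of_bivectorY_mem_of_y0 [Algebra ℂ A] (S : Subalgebra ℂ A) (v : Coord → A)
    (h : ∀ p, bivectorY v p ∈ S) (hz : ∀ j, v (![.y 0, .y 1, .b11, .b12, .b21, .c12, .c22] j) ∈ S)
    (hd : ∀ r, v (.y 0) * r ∈ S → r ∈ S) (c : Coord) (hc : c ≠ .t) : v c ∈ S := by
  obtain ⟨⟨hs, hx⟩, h03, h13, h23, h04, h14, h24⟩ :=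
    (bivectorY_mem_iff (Subalgebra.toSubring S).toAddSubgroup v).1 h
  change ∀ j, v (.x j) ∈ S at hx
  change v .s ∈ S at hs
  have hy2 := mem_of_add_mem_of_neg_add_mem S h03 (by rw [neg_add]; exact h14)
  have hy0 : v (.y 0) ∈ S := hz 0
  have hy1 : v (.y 1) ∈ S := hz 1
  have hb11 : v .b11 ∈ S := hz 2
  have hb12 : v .b12 ∈ S := hz 3
  have hb21 : v .b21 ∈ S := hz 4
  have hc12 : v .c12 ∈ S := hz 5
  have hc22 : v .c22 ∈ S := hz 6
  have ha11 : v .a11 ∈ S := hd _ (by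
    convert S.sub_mem (S.sub_mem h03 hy2) (S.mul_mem hb11 hy1) using 1; ring)
  have ha12 : v .a12 ∈ S := hd _ (by
    convert S.sub_mem h13 (S.mul_mem hb12 hy1) using 1; ring)
  have hc11 : v .c11 ∈ S := hd _ (by
    convert S.sub_mem h23 (S.mul_mem hc12 hy1) using 1; ring)
  have ha21 : v .a21 ∈ S := hd _ (by
    convert S.sub_mem h04 (S.mul_mem hb21 hy1) using 1; ring)
  have hc21 : v .c21 ∈ S := hd _ (by
    convert S.sub_mem h24 (S.mul_mem hc22 hy1) using 1; ring)
  rcases c with _ | _ | i | i | _ | _ | _ | _ | _ | _ | _ | _ | _ | _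
  any_goals assumption
  · exact absurd rfl hc
  · exact hx i
  · fin_cases i <;> assumption

theorem exists_bivectorY_eq_of_y1 [Algebra ℂ A] (W : PluckerIndex → A) (ξ : Fin 7 → A) (i : A)
    (hi : ξ 1 * i = 1) : ∃ v : Coord → A, bivectorY v = W ∧
      (∀ j, v (![.y 0, .y 1, .a11, .a12, .a21, .c11, .c21] j) = ξ j) ∧
      v (.y 1) = ξ 1 ∧ v .t = i * sharpX (matP v) (matQ v) (vecX v) 1 := by
  obtain ⟨e, he⟩ : ∃ e : A, 2 * e = 1 := ⟨_, two_mul_algebraMap_inv_two A⟩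
  let b11 : A := i * (e * (W (ix 0 3) - W (ix 1 4)) - ξ 2 * ξ 0)
  let b12 : A := i * (W (ix 1 3) - ξ 3 * ξ 0)
  let c12 : A := i * (W (ix 2 3) - ξ 5 * ξ 0)
  let b21 : A := i * (W (ix 0 4) - ξ 4 * ξ 0)
  let c22 : A := i * (W (ix 2 4) - ξ 6 * ξ 0)
  let v (t : A) : Coord → A := mkPoint (W (ix 3 4)) t ![W (ix 1 2), -W (ix 0 2), W (ix 0 1)]
    ![ξ 0, ξ 1, e * (W (ix 0 3) + W (ix 1 4))]
    (ξ 2) (ξ 3) (ξ 4) b11 b12 b21 (ξ 5) c12 (ξ 6) c22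
  refine ⟨v (i * sharpX (matP (v 0)) (matQ (v 0)) (vecX (v 0)) 1), ?_, ?_, rfl, rfl⟩
  · generalize i * sharpX (matP (v 0)) (matQ (v 0)) (vecX (v 0)) 1 = r
    funext p
    revert p
    refine forall_pluckerIndex ?_ ?_ ?_ ?_ ?_ ?_ ?_ ?_ ?_ ?_ <;>
    simp [bivectorY, bivector, matP, matQ, Matrix.mulVec, dotProduct, Fin.sum_univ_three,
      vecX, vecY, v, mkPoint, b11, b12, c12, b21, c22]
    · linear_combination (e * (W (ix 0 3) - W (ix 1 4)) - ξ 2 * ξ 0) * hi + W (ix 0 3) * he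
    · linear_combination (W (ix 0 4) - ξ 4 * ξ 0) * hi
    · linear_combination (W (ix 1 3) - ξ 3 * ξ 0) * hi
    · linear_combination -(e * (W (ix 0 3) - W (ix 1 4)) - ξ 2 * ξ 0) * hi + W (ix 1 4) * he
    · linear_combination (W (ix 2 3) - ξ 5 * ξ 0) * hi
    · linear_combination (W (ix 2 4) - ξ 6 * ξ 0) * hi
  · intro j
    fin_cases j <;> rfl

theorem mem_of_bivectorY_mem_of_y1 [Algebra ℂ A] (S : Subalgebra ℂ A) (v : Coord → A)
    (h : ∀ p, bivectorY v p ∈ S) (hz : ∀ j, v (![.y 0, .y 1, .a11, .a12, .a21, .c11, .c21] j) ∈ S)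
    (hd : ∀ r, v (.y 1) * r ∈ S → r ∈ S) (c : Coord) (hc : c ≠ .t) : v c ∈ S := by
  obtain ⟨⟨hs, hx⟩, h03, h13, h23, h04, h14, h24⟩ :=
    (bivectorY_mem_iff (Subalgebra.toSubring S).toAddSubgroup v).1 h
  change ∀ j, v (.x j) ∈ S at hx
  change v .s ∈ S at hs
  have hy2 := mem_of_add_mem_of_neg_add_mem S h03 (by rw [neg_add]; exact h14)
  have hy0 : v (.y 0) ∈ S := hz 0
  have hy1 : v (.y 1) ∈ S := hz 1
  have ha11 : v .a11 ∈ S := hz 2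
  have ha12 : v .a12 ∈ S := hz 3
  have ha21 : v .a21 ∈ S := hz 4
  have hc11 : v .c11 ∈ S := hz 5
  have hc21 : v .c21 ∈ S := hz 6
  have hb11 : v .b11 ∈ S := hd _ (by
    convert S.sub_mem (S.sub_mem h03 hy2) (S.mul_mem ha11 hy0) using 1; ring)
  have hb12 : v .b12 ∈ S := hd _ (by
    convert S.sub_mem h13 (S.mul_mem ha12 hy0) using 1; ring)
  have hc12 : v .c12 ∈ S := hd _ (by
    convert S.sub_mem h23 (S.mul_mem hc11 hy0) using 1; ring)
  have hb21 : v .b21 ∈ S := hd _ (by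
    convert S.sub_mem h04 (S.mul_mem ha21 hy0) using 1; ring)
  have hc22 : v .c22 ∈ S := hd _ (by
    convert S.sub_mem h24 (S.mul_mem hc21 hy0) using 1; ring)
  rcases c with _ | _ | i | i | _ | _ | _ | _ | _ | _ | _ | _ | _ | _
  any_goals assumption
  · exact absurd rfl hc
  · exact hx i
  · fin_cases i <;> assumption

end Entries

/-! ### The five cone charts -/

section ConcreteCharts

open MvPolynomial

theorem coneCoord_ne_zero (p : PluckerIndex) : coneCoord p ≠ 0 := by
  intro h
  have h1 := mem_vanishingIdeal_decomposable.1 (Ideal.Quotient.eq_zero_iff_mem.1 h)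
    (Pi.single p.1.1 1) (Pi.single p.1.2 1)
  simp [p.2.ne] at h1

/-- For `x₁` and `x₂` the inverted element is a Plücker coordinate, so these charts miss the vertex;
for `x₃` it is a coordinate of `𝔸⁷`. -/
theorem exists_isAwayIso_chartX (k : Fin 3) : ∃ (z : Fin 7 → Coord) (b : RingConeA),
    chartX z b = coordU (.x k) ∧ IsAwayIso (chartX z : RingConeA →+* RingU) b := by
  have hw (z : Fin 7 → Coord) (b : RingConeA) (p : PluckerIndex) :
      bivectorX coordU p ∈ awayRange (chartX z) b := by
    rw [← chartHom_C _ isPoint_coordU.isPlucker_bivectorX z]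
    exact map_mem_awayRange _ _ _
  have hz (z : Fin 7 → Coord) (b : RingConeA) (i : Fin 7) :
      coordU (z i) ∈ awayRange (chartX z) b := by
    rw [← chartHom_X _ isPoint_coordU.isPlucker_bivectorX z]
    exact map_mem_awayRange _ _ _
  have key (z : Fin 7 → Coord) (b : RingConeA) (k : Fin 3) (hb : b ≠ 0)
      (hbk : chartX z b = coordU (.x k))
      (h : ∃ v : Coord → Localization.Away b,
        bivectorX v = (fun p => algebraMap RingConeA _ (C (coneCoord p))) ∧
        (∀ j, v (z j) = algebraMap RingConeA _ (X j)) ∧ v (.x k) = algebraMap RingConeA _ b ∧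
        v .s = IsLocalization.Away.invSelf b * sharpY (matP v) (matQ v) (vecY v) k)
      (hmem : ∀ S : Subalgebra ℂ RingU, (∀ p, bivectorX coordU p ∈ S) → (∀ j, coordU (z j) ∈ S) →
        (∀ r, coordU (.x k) * r ∈ S → r ∈ S) → ∀ c ≠ .s, coordU c ∈ S) :
      ∃ (z : Fin 7 → Coord) (b : RingConeA),
        chartX z b = coordU (.x k) ∧ IsAwayIso (chartX z : RingConeA →+* RingU) b := by
    obtain ⟨v, h1, h2, h3, h4⟩ := h
    exact ⟨z, b, hbk, isAwayIso_chartX hb v h1 h2 k h3 h4 hbk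
      (hmem _ (hw z b) (hz z b) fun r hr => mem_awayRange_of_mul_mem (hbk ▸ hr))⟩
  match k with
  | 0 =>
    let q : PluckerIndex := ix 2 3
    refine key ![.x 2, .a12, .c11, .b12, .c12, .c21, .c22]
      (C (coneCoord q)) 0 ((C_eq_zero.not).2 (coneCoord_ne_zero _)) ?_
      (exists_bivectorX_eq_of_x0 (fun p => algebraMap RingConeA _ (C (coneCoord p)))
        (fun j => algebraMap RingConeA _ (X j)) _ (IsLocalization.Away.mul_invSelf _))
      (fun S => mem_of_bivectorX_mem_of_x0 S coordU)
    rw [chartHom_C]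
    simp [q, bivectorX, bivector, matP, Matrix.mulVec, dotProduct, Fin.sum_univ_three, vecX]
  | 1 =>
    let q : PluckerIndex := ix 2 4
    refine key ![.x 2, .a21, .b21, .c11, .c12, .c21, .c22]
      (C (coneCoord q)) 1 ((C_eq_zero.not).2 (coneCoord_ne_zero _)) ?_
      (exists_bivectorX_eq_of_x1 (fun p => algebraMap RingConeA _ (C (coneCoord p)))
        (fun j => algebraMap RingConeA _ (X j)) _ (IsLocalization.Away.mul_invSelf _))
      (fun S => mem_of_bivectorX_mem_of_x1 S coordU)
    rw [chartHom_C]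
    simp [q, bivectorX, bivector, matQ, Matrix.mulVec, dotProduct, Fin.sum_univ_three, vecX]
  | 2 =>
    exact key ![.x 2, .a11, .a12, .a21, .b11, .b12, .b21] (X 0) 2 (X_ne_zero 0)
      (chartHom_X _ isPoint_coordU.isPlucker_bivectorX ![.x 2, .a11, .a12, .a21, .b11, .b12, .b21] 0)
      (exists_bivectorX_eq_of_x2 (fun p => algebraMap RingConeA _ (C (coneCoord p)))
        (fun j => algebraMap RingConeA _ (X j)) _ (IsLocalization.Away.mul_invSelf _))
      (fun S => mem_of_bivectorX_mem_of_x2 S coordU)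

theorem exists_isAwayIso_chartY (k : Fin 2) : ∃ (z : Fin 7 → Coord) (b : RingConeA),
    chartY z b = coordU (.y k.castSucc) ∧ IsAwayIso (chartY z : RingConeA →+* RingU) b := by
  have hw (z : Fin 7 → Coord) (b : RingConeA) (p : PluckerIndex) :
      bivectorY coordU p ∈ awayRange (chartY z) b := by
    rw [← chartHom_C _ isPoint_coordU.isPlucker_bivectorY z]
    exact map_mem_awayRange _ _ _
  have hz (z : Fin 7 → Coord) (b : RingConeA) (i : Fin 7) :
      coordU (z i) ∈ awayRange (chartY z) b := by
    rw [← chartHom_X _ isPoint_coordU.isPlucker_bivectorY z]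
    exact map_mem_awayRange _ _ _
  have key (z : Fin 7 → Coord) (b : RingConeA) (k : Fin 3) (hb : b ≠ 0)
      (hbk : chartY z b = coordU (.y k))
      (h : ∃ v : Coord → Localization.Away b,
        bivectorY v = (fun p => algebraMap RingConeA _ (C (coneCoord p))) ∧
        (∀ j, v (z j) = algebraMap RingConeA _ (X j)) ∧ v (.y k) = algebraMap RingConeA _ b ∧
        v .t = IsLocalization.Away.invSelf b * sharpX (matP v) (matQ v) (vecX v) k)
      (hmem : ∀ S : Subalgebra ℂ RingU, (∀ p, bivectorY coordU p ∈ S) → (∀ j, coordU (z j) ∈ S) →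
        (∀ r, coordU (.y k) * r ∈ S → r ∈ S) → ∀ c ≠ .t, coordU c ∈ S) :
      ∃ (z : Fin 7 → Coord) (b : RingConeA),
        chartY z b = coordU (.y k) ∧ IsAwayIso (chartY z : RingConeA →+* RingU) b := by
    obtain ⟨v, h1, h2, h3, h4⟩ := h
    exact ⟨z, b, hbk, isAwayIso_chartY hb v h1 h2 k h3 h4 hbk
      (hmem _ (hw z b) (hz z b) fun r hr => mem_awayRange_of_mul_mem (hbk ▸ hr))⟩
  match k with
  | 0 =>
    exact key ![.y 0, .y 1, .b11, .b12, .b21, .c12, .c22] (X 0) 0 (X_ne_zero 0)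
      (chartHom_X _ isPoint_coordU.isPlucker_bivectorY ![.y 0, .y 1, .b11, .b12, .b21, .c12, .c22] 0)
      (exists_bivectorY_eq_of_y0 (fun p => algebraMap RingConeA _ (C (coneCoord p)))
        (fun j => algebraMap RingConeA _ (X j)) _ (IsLocalization.Away.mul_invSelf _))
      (fun S => mem_of_bivectorY_mem_of_y0 S coordU)
  | 1 =>
    exact key ![.y 0, .y 1, .a11, .a12, .a21, .c11, .c21] (X 1) 1 (X_ne_zero 1)
      (chartHom_X _ isPoint_coordU.isPlucker_bivectorY ![.y 0, .y 1, .a11, .a12, .a21, .c11, .c21] 1)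
      (exists_bivectorY_eq_of_y1 (fun p => algebraMap RingConeA _ (C (coneCoord p)))
        (fun j => algebraMap RingConeA _ (X j)) _ (IsLocalization.Away.mul_invSelf _))
      (fun S => mem_of_bivectorY_mem_of_y1 S coordU)

end ConcreteCharts

/-! ### The two charts in `𝔸¹⁴` -/

section SmoothCharts

open MvPolynomial

/-- The coordinates other than `t` and `x`. -/
abbrev CoordS : Type := {c : Coord // c ≠ .t ∧ ∀ i, c ≠ .x i}

/-- The coordinates other than `s` and `y`. -/
abbrev CoordT : Type := {c : Coord // c ≠ .s ∧ ∀ i, c ≠ .y i}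

theorem card_coordS : Nat.card CoordS = 14 := by
  rw [Nat.card_eq_fintype_card]
  decide

theorem card_coordT : Nat.card CoordT = 14 := by
  rw [Nat.card_eq_fintype_card]
  decide

/-- The chart of `𝔘` at points with `s ≠ 0`. -/
def chartS : MvPolynomial CoordS ℂ →ₐ[ℂ] RingU := aeval fun c => coordU c

/-- The chart of `𝔘` at points with `t ≠ 0`. -/
def chartT : MvPolynomial CoordT ℂ →ₐ[ℂ] RingU := aeval fun c => coordU c

theorem beta_mem {A : Type*} [CommRing A] [Algebra ℂ A] (S : Subalgebra ℂ A) (v : Coord → A)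
    (h : ∀ c, c ≠ .s → c ≠ .t → v c ∈ S) :
    beta (matP v) (matQ v) (vecX v) (vecY v) ∈ S := by
  let v' : Coord → S := fun c => if hc : c ≠ .s ∧ c ≠ .t then ⟨v c, h c hc.1 hc.2⟩ else 0
  have hP : matP v = matP ((S.val : S →+* A) ∘ v') := by
    simp [matP, v']
  have hQ : matQ v = matQ ((S.val : S →+* A) ∘ v') := by
    simp [matQ, v']
  have hX : vecX v = (S.val : S →+* A) ∘ vecX v' := by
    funext i
    simp [vecX, v']
  have hY : vecY v = (S.val : S →+* A) ∘ vecY v' := by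
    funext i
    simp [vecY, v']
  rw [hP, hQ, hX, hY, matP_comp, matQ_comp, beta_map]
  exact (beta (matP v') (matQ v') (vecX v') (vecY v')).2

theorem isAwayIso_chartS :
    IsAwayIso (chartS : MvPolynomial CoordS ℂ →+* RingU) (X ⟨.s, by simp⟩) := by
  let b : MvPolynomial CoordS ℂ := X ⟨.s, by simp⟩
  let A := Localization.Away b
  let i : A := IsLocalization.Away.invSelf b
  have hi : algebraMap _ A b * i = 1 := IsLocalization.Away.mul_invSelf _
  let w : Coord → A := fun c => if h : c ≠ .t ∧ ∀ i, c ≠ .x i then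
    algebraMap (MvPolynomial CoordS ℂ) A (X ⟨c, h⟩) else 0
  let v : Coord → A := fun c => match c with
    | .t => i ^ 2 * normY (matP w) (matQ w) (vecY w)
    | .x k => i * sharpY (matP w) (matQ w) (vecY w) k
    | c => w c
  have hvs : v .s = algebraMap _ A b := dif_pos _
  have hv : IsPoint v := by
    refine isPoint_of_isUnit_s v (IsUnit.of_mul_eq_one i (by rw [hvs, hi])) (fun k => ?_) ?_
    · change v .s * (i * sharpY (matP w) (matQ w) (vecY w) k) =
        sharpY (matP w) (matQ w) (vecY w) k
      rw [hvs, ← mul_assoc, hi, one_mul]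
    · change v .s ^ 2 * (i ^ 2 * normY (matP w) (matQ w) (vecY w)) =
        normY (matP w) (matQ w) (vecY w)
      rw [hvs, ← mul_assoc, ← mul_pow, hi, one_pow, one_mul]
  have hw (c : CoordS) : v c = algebraMap (MvPolynomial CoordS ℂ) A (X c) := by
    obtain ⟨c, hc⟩ := c
    cases c
    any_goals exact dif_pos hc
    · exact absurd rfl hc.1
    · exact absurd rfl (hc.2 _)
  refine isAwayIso_of_awayRange_eq_top ?_ ?_
  · refine injective_of_comp_eq_algebraMap (X_ne_zero _) (f := (chartS : _ →+* RingU))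
      (liftU v hv : RingU →+* A) ?_
    have : (liftU v hv).comp chartS = IsScalarTower.toAlgHom ℂ _ _ := by
      ext c
      simp [chartS, hw]
    exact RingHom.ext fun p => DFunLike.congr_fun this p
  · have h0 (c : CoordS) : coordU c ∈ awayRange chartS b := by
      have := map_mem_awayRange chartS b (X c)
      simpa [chartS] using this
    have hs (r : RingU) (h : coordU .s * r ∈ awayRange chartS b) : r ∈ awayRange chartS b := by
      refine mem_awayRange_of_mul_mem ?_
      simpa [chartS, b] using h
    have hx (k : Fin 3) : coordU (.x k) ∈ awayRange chartS b := by
      apply hs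
      rw [isPoint_coordU.sx]
      refine sharpY_mem (awayRange chartS b)
        (fun c => if h : c ≠ .t ∧ ∀ i, c ≠ .x i then coordU c else 0) (fun c _ => ?_) k
      split_ifs with h
      · exact h0 ⟨c, h⟩
      · exact zero_mem _
    have h1 (c : Coord) (hc : c ≠ .t) : coordU c ∈ awayRange chartS b := by
      by_cases h : ∀ i, c ≠ .x i
      · exact h0 ⟨c, hc, h⟩
      · push Not at h
        obtain ⟨i, rfl⟩ := h
        exact hx i
    refine awayRange_eq_top_of_coordU_mem fun c => ?_
    by_cases hc : c = .t
    · subst hc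
      apply hs
      rw [isPoint_coordU.st]
      exact Subalgebra.smul_mem _ (beta_mem _ _ fun c _ h => h1 c h) _
    · exact h1 c hc

theorem isAwayIso_chartT :
    IsAwayIso (chartT : MvPolynomial CoordT ℂ →+* RingU) (X ⟨.t, by simp⟩) := by
  let b : MvPolynomial CoordT ℂ := X ⟨.t, by simp⟩
  let A := Localization.Away b
  let i : A := IsLocalization.Away.invSelf b
  have hi : algebraMap _ A b * i = 1 := IsLocalization.Away.mul_invSelf _
  let w : Coord → A := fun c => if h : c ≠ .s ∧ ∀ i, c ≠ .y i then
    algebraMap (MvPolynomial CoordT ℂ) A (X ⟨c, h⟩) else 0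
  let v : Coord → A := fun c => match c with
    | .s => i ^ 2 * normX (matP w) (matQ w) (vecX w)
    | .y k => i * sharpX (matP w) (matQ w) (vecX w) k
    | c => w c
  have hvt : v .t = algebraMap _ A b := dif_pos _
  have hv : IsPoint v := by
    refine isPoint_of_isUnit_t v (IsUnit.of_mul_eq_one i (by rw [hvt, hi])) (fun k => ?_) ?_
    · change v .t * (i * sharpX (matP w) (matQ w) (vecX w) k) =
        sharpX (matP w) (matQ w) (vecX w) k
      rw [hvt, ← mul_assoc, hi, one_mul]
    · change v .t ^ 2 * (i ^ 2 * normX (matP w) (matQ w) (vecX w)) =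
        normX (matP w) (matQ w) (vecX w)
      rw [hvt, ← mul_assoc, ← mul_pow, hi, one_pow, one_mul]
  have hw (c : CoordT) : v c = algebraMap (MvPolynomial CoordT ℂ) A (X c) := by
    obtain ⟨c, hc⟩ := c
    cases c
    any_goals exact dif_pos hc
    · exact absurd rfl hc.1
    · exact absurd rfl (hc.2 _)
  refine isAwayIso_of_awayRange_eq_top ?_ ?_
  · refine injective_of_comp_eq_algebraMap (X_ne_zero _) (f := (chartT : _ →+* RingU))
      (liftU v hv : RingU →+* A) ?_
    have : (liftU v hv).comp chartT = IsScalarTower.toAlgHom ℂ _ _ := by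
      ext c
      simp [chartT, hw]
    exact RingHom.ext fun p => DFunLike.congr_fun this p
  · have h0 (c : CoordT) : coordU c ∈ awayRange chartT b := by
      have := map_mem_awayRange chartT b (X c)
      simpa [chartT] using this
    have ht (r : RingU) (h : coordU .t * r ∈ awayRange chartT b) : r ∈ awayRange chartT b := by
      refine mem_awayRange_of_mul_mem ?_
      simpa [chartT, b] using h
    have hy (k : Fin 3) : coordU (.y k) ∈ awayRange chartT b := by
      apply ht
      rw [isPoint_coordU.ty]
      refine sharpX_mem (awayRange chartT b)
        (fun c => if h : c ≠ .s ∧ ∀ i, c ≠ .y i then coordU c else 0) (fun c _ => ?_) k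
      split_ifs with h
      · exact h0 ⟨c, h⟩
      · exact zero_mem _
    have h1 (c : Coord) (hc : c ≠ .s) : coordU c ∈ awayRange chartT b := by
      by_cases h : ∀ i, c ≠ .y i
      · exact h0 ⟨c, hc, h⟩
      · push Not at h
        obtain ⟨i, rfl⟩ := h
        exact hy i
    refine awayRange_eq_top_of_coordU_mem fun c => ?_
    by_cases hc : c = .s
    · subst hc
      apply ht
      rw [mul_comm, isPoint_coordU.st]
      exact Subalgebra.smul_mem _ (beta_mem _ _ fun c h _ => h1 c h) _
    · exact h1 c hc

end SmoothCharts

/-! ### The loci in terms of prime ideals -/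

section Loci

theorem crossProduct_mem {A : Type*} [CommRing A] (I : Ideal A) {p q : Fin 3 → A}
    (hp : ∀ i, p i ∈ I) (k : Fin 3) : crossProduct p q k ∈ I := by
  fin_cases k <;> simp [cross_apply] <;>
  exact I.sub_mem (I.mul_mem_right _ (hp _)) (I.mul_mem_right _ (hp _))

theorem mulVec_mem {A : Type*} [CommRing A] (I : Ideal A) (M : Matrix (Fin 3) (Fin 3) A)
    {y : Fin 3 → A} (hy : ∀ i, y i ∈ I) (k : Fin 3) : (M *ᵥ y) k ∈ I := by
  rw [Matrix.mulVec, dotProduct]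
  exact I.sum_mem fun i _ => I.mul_mem_left _ (hy i)

theorem mem_baseLocus {p : PrimeSpectrum RingU} : (p : schemeU) ∈ baseLocus ↔
    (∀ i, coordU (.x i) ∈ p.asIdeal) ∧ (∀ i, coordU (.y i) ∈ p.asIdeal) ∧
      coordU .s ∈ p.asIdeal ∧ coordU .t ∈ p.asIdeal := by
  change p ∈ PrimeSpectrum.zeroLocus _ ↔ _
  simp [PrimeSpectrum.mem_zeroLocus, Set.range_subset_iff, Set.insert_subset_iff]
  tauto

theorem mem_locusSx {p : PrimeSpectrum RingU} : (p : schemeU) ∈ locusSx ↔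
    (∀ i, coordU (.y i) ∈ p.asIdeal) ∧ coordU (.x 0) ∈ p.asIdeal ∧ coordU (.x 1) ∈ p.asIdeal ∧
      coordU .s ∈ p.asIdeal ∧ coordU .t ∈ p.asIdeal ∧ coordU .c11 ∈ p.asIdeal ∧
      coordU .c12 ∈ p.asIdeal ∧ coordU .c21 ∈ p.asIdeal ∧ coordU .c22 ∈ p.asIdeal := by
  change p ∈ PrimeSpectrum.zeroLocus _ ↔ _
  simp [PrimeSpectrum.mem_zeroLocus, Set.range_subset_iff, Set.insert_subset_iff]
  tauto

theorem mem_locusPreSy {p : PrimeSpectrum RingU} : (p : schemeU) ∈ locusPreSy ↔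
    ((∀ i, coordU (.x i) ∈ p.asIdeal) ∧ coordU .s ∈ p.asIdeal ∧ coordU .t ∈ p.asIdeal ∧
      coordU (.y 2) ∈ p.asIdeal) ∧
    coordU .a11 * coordU (.y 0) + coordU .b11 * coordU (.y 1) ∈ p.asIdeal ∧
    coordU .a12 * coordU (.y 0) + coordU .b12 * coordU (.y 1) ∈ p.asIdeal ∧
    coordU .a21 * coordU (.y 0) + coordU .b21 * coordU (.y 1) ∈ p.asIdeal ∧
    coordU .c11 * coordU (.y 0) + coordU .c12 * coordU (.y 1) ∈ p.asIdeal ∧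
    coordU .c21 * coordU (.y 0) + coordU .c22 * coordU (.y 1) ∈ p.asIdeal := by
  change p ∈ PrimeSpectrum.zeroLocus _ ↔ _
  simp [PrimeSpectrum.mem_zeroLocus, Set.range_subset_iff, Set.insert_subset_iff,
    Fin.forall_fin_succ]
  simp only [mul_comm]
  tauto

/-- The locus before taking the closure is closed, so the closure adds nothing outside `L`. -/
theorem locusDelta_eq : locusDelta = (locusSx ∪ locusPreSy) \ baseLocus := by
  refine Set.Subset.antisymm ?_ ?_
  · refine Set.sdiff_subset_sdiff_left (Set.union_subset_union_right _ ?_)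
    exact closure_minimal Set.sdiff_subset (isClosed_locus _)
  · rintro p ⟨hp | hp, h⟩
    · exact ⟨Or.inl hp, h⟩
    · exact ⟨Or.inr (subset_closure ⟨hp, h⟩), h⟩

/-- No chart is needed for `y₃`: in `s x₃ = (y^♯)₃` the only term outside the ideal `(s, y₁, y₂)` is
`y₃²`. -/
theorem exists_coordU_notMem {p : PrimeSpectrum RingU} (hp : (p : schemeU) ∉ baseLocus) :
    coordU .s ∉ p.asIdeal ∨ coordU .t ∉ p.asIdeal ∨ (∃ k, coordU (.x k) ∉ p.asIdeal) ∨
      ∃ k : Fin 2, coordU (.y k.castSucc) ∉ p.asIdeal := by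
  by_contra! h
  obtain ⟨hs, ht, hx, hy⟩ := h
  refine hp (mem_baseLocus.2 ⟨hx, ?_, hs, ht⟩)
  have h0 : coordU (.y 0) ∈ p.asIdeal := hy 0
  have h1 : coordU (.y 1) ∈ p.asIdeal := hy 1
  have h2 : coordU (.y 2) ∈ p.asIdeal := by
    have h := isPoint_coordU.sx 2
    simp [sharpY, cross_apply, matP, matQ, dotProduct, Fin.sum_univ_three, vecY] at h
    refine p.2.mem_of_pow_mem 2 ?_
    have h3 : coordU (.y 2) ^ 2 = coordU .s * coordU (.x 2) -
        (coordU .a11 * coordU (.y 2) - coordU .a11 * (coordU .a11 * coordU (.y 0)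
          + coordU .b11 * coordU (.y 1)) - coordU .a11 * coordU (.y 2)
          - coordU .a12 * (coordU .a21 * coordU (.y 0) + coordU .b21 * coordU (.y 1)))
          * coordU (.y 0)
        - (coordU .b11 * coordU (.y 2) - coordU .b11 * (coordU .a11 * coordU (.y 0)
          + coordU .b11 * coordU (.y 1)) - coordU .b11 * coordU (.y 2)
          - coordU .b12 * (coordU .a21 * coordU (.y 0) + coordU .b21 * coordU (.y 1)))
          * coordU (.y 1) := by
      linear_combination -h
    rw [h3]
    exact sub_mem (sub_mem (Ideal.mul_mem_right _ _ hs) (Ideal.mul_mem_left _ _ h0))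
      (Ideal.mul_mem_left _ _ h1)
  intro i
  fin_cases i <;> assumption

/-- Vanishing of the bivector kills `t`, `y`, `x₁`, `x₂`, so the nonzero coordinate is `x₃`. What
remains of `ᵗPx` and `ᵗQx` is `x₃` times the entries of `C`, and `s x₃ = (y^♯)₃ = 0` gives `s = 0`.
`S_y` does not enter because `x = 0` there. -/
theorem mem_locusDelta_iff_bivectorX {p : PrimeSpectrum RingU} {k : Fin 3}
    (hk : coordU (.x k) ∉ p.asIdeal) :
    (p : schemeU) ∈ locusDelta ↔ ∀ q, bivectorX coordU q ∈ p.asIdeal := by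
  have hb : (p : schemeU) ∉ baseLocus := fun h => hk ((mem_baseLocus.1 h).1 k)
  rw [locusDelta_eq]
  refine Iff.trans ?_ (bivectorX_mem_iff p.asIdeal.toAddSubgroup coordU).symm
  constructor
  · rintro ⟨h | h, -⟩
    · obtain ⟨hy, h0, h1, hs, ht, h11, h12, h21, h22⟩ := mem_locusSx.1 h
      refine ⟨⟨ht, hy, h0, h1⟩, ?_, ?_, ?_, ?_⟩
      · exact add_mem (add_mem (Ideal.mul_mem_left _ _ h0) (Ideal.mul_mem_left _ _ h1))
          (Ideal.mul_mem_right _ _ h11)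
      · exact add_mem (add_mem (Ideal.mul_mem_left _ _ h0) (Ideal.mul_mem_left _ _ h1))
          (Ideal.mul_mem_right _ _ h12)
      · exact add_mem (sub_mem (Ideal.mul_mem_left _ _ h0) (Ideal.mul_mem_left _ _ h1))
          (Ideal.mul_mem_right _ _ h21)
      · exact add_mem (sub_mem (Ideal.mul_mem_left _ _ h0) (Ideal.mul_mem_left _ _ h1))
          (Ideal.mul_mem_right _ _ h22)
    · exact absurd ((mem_locusPreSy.1 h).1.1 k) hk
  · rintro ⟨⟨ht, hy, h0, h1⟩, h03, h13, h04, h14⟩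
    change coordU .t ∈ p.asIdeal at ht
    change ∀ i, coordU (.y i) ∈ p.asIdeal at hy
    change coordU (.x 0) ∈ p.asIdeal at h0
    change coordU (.x 1) ∈ p.asIdeal at h1
    have h2 : coordU (.x 2) ∉ p.asIdeal := by
      fin_cases k
      · exact absurd h0 hk
      · exact absurd h1 hk
      · exact hk
    have key {c : RingU} (h : c * coordU (.x 2) ∈ p.asIdeal) : c ∈ p.asIdeal :=
      (p.2.mem_or_mem h).resolve_right h2
    refine ⟨Or.inl (mem_locusSx.2 ⟨hy, h0, h1, ?_, ht, ?_, ?_, ?_, ?_⟩), hb⟩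
    · refine key ?_
      rw [isPoint_coordU.sx]
      exact crossProduct_mem _ (mulVec_mem _ _ hy) _
    · exact key ((add_mem_cancel_left (add_mem (Ideal.mul_mem_left _ _ h0)
        (Ideal.mul_mem_left _ _ h1))).1 h03)
    · exact key ((add_mem_cancel_left (add_mem (Ideal.mul_mem_left _ _ h0)
        (Ideal.mul_mem_left _ _ h1))).1 h13)
    · exact key ((add_mem_cancel_left (sub_mem (Ideal.mul_mem_left _ _ h0)
        (Ideal.mul_mem_left _ _ h1))).1 h04)
    · exact key ((add_mem_cancel_left (sub_mem (Ideal.mul_mem_left _ _ h0)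
        (Ideal.mul_mem_left _ _ h1))).1 h14)

/-- Vanishing of the bivector kills `s` and `x`, and then `y₃` by halving a sum of two components.
The other components are the five rows of the matrix in `locusPreSy` applied to `(y₁, y₂)`, and `t
y_k = (x^♯)_k = 0` gives `t = 0`. -/
theorem mem_locusDelta_iff_bivectorY {p : PrimeSpectrum RingU} {k : Fin 3}
    (hk : coordU (.y k) ∉ p.asIdeal) :
    (p : schemeU) ∈ locusDelta ↔ ∀ q, bivectorY coordU q ∈ p.asIdeal := by
  have hb : (p : schemeU) ∉ baseLocus := fun h => hk ((mem_baseLocus.1 h).2.1 k)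
  rw [locusDelta_eq]
  refine Iff.trans ?_ (bivectorY_mem_iff p.asIdeal.toAddSubgroup coordU).symm
  constructor
  · rintro ⟨h | h, -⟩
    · exact absurd ((mem_locusSx.1 h).1 k) hk
    · obtain ⟨⟨hx, hs, ht, hy⟩, h1, h2, h3, h4, h5⟩ := mem_locusPreSy.1 h
      refine ⟨⟨hs, hx⟩, add_mem h1 hy, h2, h4, h3, ?_, h5⟩
      rw [← neg_add]
      exact add_mem (neg_mem h1) hy
  · rintro ⟨⟨hs, hx⟩, h03, h13, h23, h04, h14, h24⟩
    change ∀ i, coordU (.x i) ∈ p.asIdeal at hx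
    have hy : coordU (.y 2) ∈ p.asIdeal := by
      have h := Ideal.mul_mem_left p.asIdeal (algebraMap ℂ RingU 2⁻¹) (add_mem h03 h14)
      convert h using 1
      linear_combination -coordU (.y 2) * two_mul_algebraMap_inv_two RingU
    refine ⟨Or.inr (mem_locusPreSy.2 ⟨⟨hx, hs, ?_, hy⟩,
      (add_mem_cancel_right hy).1 h03, h13, h04, h23, h24⟩), hb⟩
    refine (p.2.mem_or_mem ?_).resolve_right hk
    rw [isPoint_coordU.ty]
    exact crossProduct_mem _ (mulVec_mem _ _ hx) _

theorem notMem_locusDelta {p : PrimeSpectrum RingU}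
    (h : coordU .s ∉ p.asIdeal ∨ coordU .t ∉ p.asIdeal) : (p : schemeU) ∉ locusDelta := by
  rw [locusDelta_eq]
  rintro ⟨hp | hp, -⟩
  · obtain ⟨-, -, -, hs, ht, -⟩ := mem_locusSx.1 hp
    exact h.elim (absurd hs) (absurd ht)
  · obtain ⟨⟨-, hs, ht, -⟩, -⟩ := mem_locusPreSy.1 hp
    exact h.elim (absurd hs) (absurd ht)

end Loci

/-! ### The chart cover and the regular points of `𝔘 ∖ L` -/

section Charts

open MvPolynomial

/-- The functions whose non-vanishing loci are the charts. -/
def chartFunctions : Set RingU :=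
  {coordU .s, coordU .t, coordU (.x 0), coordU (.x 1), coordU (.x 2), coordU (.y 0), coordU (.y 1)}

theorem exists_mem_chartFunctions {p : PrimeSpectrum RingU} (hp : (p : schemeU) ∉ baseLocus) :
    ∃ e ∈ chartFunctions, e ∉ p.asIdeal := by
  rcases exists_coordU_notMem hp with h | h | ⟨k, h⟩ | ⟨k, h⟩
  · exact ⟨_, by simp [chartFunctions], h⟩
  · exact ⟨_, by simp [chartFunctions], h⟩
  · exact ⟨_, by fin_cases k <;> simp [chartFunctions], h⟩
  · exact ⟨_, by fin_cases k <;> simp [chartFunctions], h⟩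

theorem notMem_baseLocus {e : RingU} (he : e ∈ chartFunctions) {p : PrimeSpectrum RingU}
    (hp : e ∉ p.asIdeal) : (p : schemeU) ∉ baseLocus := by
  rw [mem_baseLocus]
  rintro ⟨hx, hy, hs, ht⟩
  rcases he with rfl | rfl | rfl | rfl | rfl | rfl | rfl
  exacts [hp hs, hp ht, hp (hx 0), hp (hx 1), hp (hx 2), hp (hy 0), hp (hy 1)]

/-- Each chart is either an open part of an affine space outside `Δ`, or an open part of
`c(G(2,5)) × 𝔸⁷` on which `Δ` is given by the vertex. -/
theorem exists_chart {e : RingU} (he : e ∈ chartFunctions) :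
    (∃ (σ : Type) (_ : Finite σ) (f : MvPolynomial σ ℂ →ₐ[ℂ] RingU) (b : MvPolynomial σ ℂ),
      Nat.card σ = 14 ∧ f b = e ∧ IsAwayIso (f : MvPolynomial σ ℂ →+* RingU) b ∧
      ∀ q : PrimeSpectrum RingU, e ∉ q.asIdeal → (q : schemeU) ∉ locusDelta) ∨
    ∃ (f : RingConeA →ₐ[ℂ] RingU) (b : RingConeA),
      f b = e ∧ IsAwayIso (f : RingConeA →+* RingU) b ∧
      ∀ q : PrimeSpectrum RingU, e ∉ q.asIdeal →
        ((q : schemeU) ∈ locusDelta ↔ ∀ i, f (C (coneCoord i)) ∈ q.asIdeal) := by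
  have hx (k : Fin 3) : ∃ (f : RingConeA →ₐ[ℂ] RingU) (b : RingConeA),
      f b = coordU (.x k) ∧ IsAwayIso (f : RingConeA →+* RingU) b ∧
      ∀ q : PrimeSpectrum RingU, coordU (.x k) ∉ q.asIdeal →
        ((q : schemeU) ∈ locusDelta ↔ ∀ i, f (C (coneCoord i)) ∈ q.asIdeal) := by
    obtain ⟨z, b, hb, hf⟩ := exists_isAwayIso_chartX k
    refine ⟨chartX z, b, hb, hf, fun q hq => ?_⟩
    simp only [chartHom_C]
    exact mem_locusDelta_iff_bivectorX hq
  have hy (k : Fin 2) : ∃ (f : RingConeA →ₐ[ℂ] RingU) (b : RingConeA),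
      f b = coordU (.y k.castSucc) ∧ IsAwayIso (f : RingConeA →+* RingU) b ∧
      ∀ q : PrimeSpectrum RingU, coordU (.y k.castSucc) ∉ q.asIdeal →
        ((q : schemeU) ∈ locusDelta ↔ ∀ i, f (C (coneCoord i)) ∈ q.asIdeal) := by
    obtain ⟨z, b, hb, hf⟩ := exists_isAwayIso_chartY k
    refine ⟨chartY z, b, hb, hf, fun q hq => ?_⟩
    simp only [chartHom_C]
    exact mem_locusDelta_iff_bivectorY hq
  rcases he with rfl | rfl | rfl | rfl | rfl | rfl | rfl
  · exact Or.inl ⟨CoordS, inferInstance, chartS, X ⟨.s, by simp⟩, card_coordS, by simp [chartS],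
      isAwayIso_chartS, fun q hq => notMem_locusDelta (Or.inl hq)⟩
  · exact Or.inl ⟨CoordT, inferInstance, chartT, X ⟨.t, by simp⟩, card_coordT, by simp [chartT],
      isAwayIso_chartT, fun q hq => notMem_locusDelta (Or.inr hq)⟩
  exacts [Or.inr (hx 0), Or.inr (hx 1), Or.inr (hx 2), Or.inr (hy 0), Or.inr (hy 1)]

theorem isRegularLocalRing_iff_notMem_locusDelta {p : PrimeSpectrum RingU}
    (hp : (p : schemeU) ∉ baseLocus) (L : Type) [CommRing L] [Algebra RingU L]
    [IsLocalization.AtPrime L p.asIdeal] :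
    IsRegularLocalRing L ↔ (p : schemeU) ∉ locusDelta := by
  obtain ⟨_, he, hb⟩ := exists_mem_chartFunctions hp
  obtain ⟨σ, _, f, b, -, rfl, hf, h⟩ | ⟨f, b, rfl, hf, h⟩ := exists_chart he
  · obtain ⟨e⟩ := hf.nonempty_ringEquiv p.asIdeal hb L
    have := IsRegularRing.isRegularLocalRing_localization
      (p.asIdeal.comap (f : MvPolynomial σ ℂ →+* RingU))
    exact iff_of_true (IsRegularLocalRing.of_ringEquiv e) (h p hb)
  · obtain ⟨e⟩ := hf.nonempty_ringEquiv p.asIdeal hb L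
    rw [h p hb, not_forall]
    refine Iff.trans ?_ (isRegularLocalRing_localization_iff
      (p.asIdeal.comap (f : RingConeA →+* RingU)))
    exact ⟨fun _ => IsRegularLocalRing.of_ringEquiv e.symm,
      fun _ => IsRegularLocalRing.of_ringEquiv e⟩

end Charts

/-! ### Comparing dimensions and irreducibility through charts -/

section Topology

open PrimeSpectrum

/-- Closed sets are zero loci, so it suffices that on `S` each function has the same zeros as one
pulled back along `φ`. Inducing maps bound the dimension of `S` by that of `A`. -/
theorem isInducing_comap_of_forall_exists {A R : Type*} [CommRing A] [CommRing R] (φ : A →+* R)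
    (S : Set (PrimeSpectrum R)) (h : ∀ r, ∃ a, ∀ q ∈ S, r ∈ q.asIdeal ↔ φ a ∈ q.asIdeal) :
    Topology.IsInducing fun q : S => comap φ q.1 := by
  have hc : Continuous fun q : S => comap φ q.1 :=
    (PrimeSpectrum.continuous_comap φ).comp continuous_subtype_val
  choose a ha using h
  refine ⟨TopologicalSpace.ext_isClosed fun Z => ⟨fun hZ => ?_, fun hZ => ?_⟩⟩
  · obtain ⟨Y, hY, rfl⟩ := isClosed_induced_iff.1 hZ
    obtain ⟨T, rfl⟩ := (isClosed_iff_zeroLocus _).1 hY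
    refine isClosed_induced_iff.2 ⟨zeroLocus (a '' T), isClosed_zeroLocus _, ?_⟩
    ext q
    simp only [Set.mem_preimage, mem_zeroLocus, Set.image_subset_iff]
    exact forall₂_congr fun r _ => (ha r q.1 q.2).symm
  · obtain ⟨Y, hY, rfl⟩ := isClosed_induced_iff.1 hZ
    exact hY.preimage hc

theorem IsAwayIso.isInducing_comap_inter {B R : Type*} [CommRing B] [CommRing R] {f : B →+* R}
    {b : B} (h : IsAwayIso f b) (S : Set (PrimeSpectrum R)) :
    Topology.IsInducing fun q : (S ∩ basicOpen (f b) : Set (PrimeSpectrum R)) => comap f q.1 := by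
  refine isInducing_comap_of_forall_exists f _ fun r => ?_
  obtain ⟨n, b', hb'⟩ := h.surj r
  refine ⟨b', fun q hq => ?_⟩
  rw [← hb']
  exact ⟨fun hr => Ideal.mul_mem_left _ _ hr,
    fun hr => (q.2.mem_or_mem hr).resolve_left fun hn => hq.2 (q.2.mem_of_pow_mem _ hn)⟩

theorem topologicalKrullDim_le_of_basicOpen {R : Type*} [CommRing R] {S : Set (PrimeSpectrum R)}
    {n : WithBot ℕ∞} (h : ∀ p ∈ S, ∃ e, e ∉ p.asIdeal ∧
      topologicalKrullDim (S ∩ basicOpen e : Set (PrimeSpectrum R)) ≤ n) :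
    topologicalKrullDim S ≤ n := by
  refine topologicalKrullDim_le_of_cover fun p => ?_
  obtain ⟨e, he, hn⟩ := h p.1 p.2
  refine ⟨Subtype.val ⁻¹' (basicOpen e : Set (PrimeSpectrum R)),
    (basicOpen e).isOpen.preimage continuous_subtype_val, he, le_trans ?_ hn⟩
  let g : (Subtype.val ⁻¹' (basicOpen e : Set (PrimeSpectrum R)) : Set S) →
      (S ∩ basicOpen e : Set (PrimeSpectrum R)) := fun q => ⟨q.1.1, q.1.2, q.2⟩
  have hg : Topology.IsInducing g :=
    Topology.IsInducing.of_comp (g := (Subtype.val : _ → PrimeSpectrum R)) (by fun_prop)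
      continuous_subtype_val
      (show Topology.IsInducing ((Subtype.val : S → PrimeSpectrum R) ∘ Subtype.val) from
        Topology.IsInducing.subtypeVal.comp Topology.IsInducing.subtypeVal)
  exact hg.topologicalKrullDim_le

theorem ringKrullDim_le_topologicalKrullDim {A R : Type*} [CommRing A] [CommRing R]
    {S : Set (PrimeSpectrum R)} {φ : R →+* A} (hφ : Topology.IsInducing (comap φ))
    (hS : ∀ q, comap φ q ∈ S) : ringKrullDim A ≤ topologicalKrullDim S := by
  rw [← topologicalKrullDim_eq_ringKrullDim]
  exact (hφ.codRestrict hS).topologicalKrullDim_le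

theorem isPreirreducible_basicOpen {B R : Type*} [CommRing B] [IsDomain B] [CommRing R]
    {f : B →+* R} {b : B} (h : IsAwayIso f b) :
    IsPreirreducible (basicOpen (f b) : Set (PrimeSpectrum R)) := by
  by_cases hb : b = 0
  · have : (basicOpen (f b) : Set (PrimeSpectrum R)) = ∅ := by simp [hb]
    rw [this]
    exact isPreirreducible_empty
  let L := Localization.Away (f b)
  let _ : Algebra B L := ((algebraMap R L).comp f).toAlgebra
  have hL := h.isLocalization_away L rfl
  have : IsDomain L :=
    IsLocalization.isDomain_of_le_nonZeroDivisors L (powers_le_nonZeroDivisors_of_noZeroDivisors hb)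
  rw [← localization_away_comap_range L (f b), ← Set.image_univ]
  exact (PreirreducibleSpace.isPreirreducible_univ).image _
    (PrimeSpectrum.continuous_comap _).continuousOn

end Topology

/-! ### Dimension and irreducibility of `𝔘 ∖ L`; dimension of `Δ` -/

section Global

open MvPolynomial

theorem topologicalKrullDim_compl_baseLocus :
    topologicalKrullDim (baseLocusᶜ : Set (PrimeSpectrum RingU)) = 14 := by
  refine le_antisymm (topologicalKrullDim_le_of_basicOpen fun p hp => ?_) ?_
  · obtain ⟨e, he, hep⟩ := exists_mem_chartFunctions hp
    refine ⟨e, hep, ?_⟩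
    obtain ⟨σ, _, f, b, hσ, rfl, hf, -⟩ | ⟨f, b, rfl, hf, -⟩ := exists_chart he
    · refine (hf.isInducing_comap_inter _).topologicalKrullDim_le.trans ?_
      rw [PrimeSpectrum.topologicalKrullDim_eq_ringKrullDim, ringKrullDim_mvPolynomial_complex, hσ]
      rfl
    · refine (hf.isInducing_comap_inter _).topologicalKrullDim_le.trans ?_
      rw [PrimeSpectrum.topologicalKrullDim_eq_ringKrullDim]
      exact ringKrullDim_ringConeA_le
  · let b : MvPolynomial CoordS ℂ := X ⟨.s, by simp⟩
    have hb : chartS b = coordU .s := by simp [chartS, b]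
    let L := Localization.Away ((chartS : MvPolynomial CoordS ℂ →+* RingU) b)
    let _ : Algebra (MvPolynomial CoordS ℂ) L :=
      ((algebraMap RingU L).comp (chartS : MvPolynomial CoordS ℂ →+* RingU)).toAlgebra
    have hL' : IsLocalization.Away (chartS b) L := Localization.isLocalization
    have hL : IsLocalization.Away b L := isAwayIso_chartS.isLocalization_away L rfl
    have h1 := card_le_ringKrullDim_away_X (⟨.s, by simp⟩ : CoordS)
    rw [ringKrullDim_eq_of_ringEquiv
      (IsLocalization.algEquiv (Submonoid.powers b) (Localization.Away b) L).toRingEquiv,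
      card_coordS] at h1
    refine le_trans h1 (ringKrullDim_le_topologicalKrullDim (φ := algebraMap RingU L)
      (PrimeSpectrum.localization_away_isOpenEmbedding L (chartS b)).isInducing fun q => ?_)
    refine notMem_baseLocus (e := chartS b) (by rw [hb]; simp [chartFunctions]) fun h => ?_
    exact q.2.ne_top (Ideal.eq_top_of_isUnit_mem _ h (IsLocalization.Away.algebraMap_isUnit _))

/-- A complex point of `𝔘` at which `s`, `t`, `x₁`, `x₂`, `x₃`, `y₁`, `y₂` do not vanish. -/
def samplePoint : Coord → ℂ := mkPoint 1 1 ![-1, -1, 1] ![1, 1, 1] 0 0 0 0 0 0 1 0 0 1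

/-- With `C` the identity, `a = b = 0`, `y = (1, 1, 1)` and `s = 1`, the values `x = y^♯ = (-1, -1,
1)` and `t = N_y(y) = 1` are forced. -/
theorem isPoint_samplePoint : IsPoint samplePoint := by
  refine isPoint_of_isUnit_s _ isUnit_one (fun i => ?_) ?_
  · fin_cases i <;> simp [samplePoint, mkPoint, sharpY, cross_apply, matP, matQ, vecY, Matrix.vecHead,
      Matrix.vecTail]
  · simp [samplePoint, mkPoint, normY, sharpY, cross_apply, matP, matQ, vecY,
      Matrix.adjugate_fin_three, Matrix.mul_apply, Fin.sum_univ_three, Matrix.mulVec, dotProduct]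

theorem exists_forall_notMem : ∃ p : PrimeSpectrum RingU, ∀ e ∈ chartFunctions, e ∉ p.asIdeal := by
  refine ⟨⟨RingHom.ker (liftU samplePoint isPoint_samplePoint), RingHom.ker_isPrime _⟩, ?_⟩
  rintro e (rfl | rfl | rfl | rfl | rfl | rfl | rfl) <;>
  simp [RingHom.mem_ker, samplePoint, mkPoint]

theorem isIrreducible_compl_baseLocus :
    IsIrreducible (baseLocusᶜ : Set (PrimeSpectrum RingU)) := by
  obtain ⟨p, hp⟩ := exists_forall_notMem
  refine ⟨⟨p, notMem_baseLocus (e := coordU .s) (by simp [chartFunctions])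
    (hp _ (by simp [chartFunctions]))⟩, ?_⟩
  refine IsPreirreducible.of_subset_iUnion
    (U := fun e : chartFunctions => PrimeSpectrum.basicOpen e.1) (fun e e' _ h => ?_) (fun e => ?_)
    (isClosed_locus _).isOpen_compl (fun q hq => ?_)
  · exact h.le_bot (show p ∈ PrimeSpectrum.basicOpen e.1 ⊓ PrimeSpectrum.basicOpen e'.1 from
      ⟨hp _ e.2, hp _ e'.2⟩)
  · obtain ⟨e, he⟩ := e
    obtain ⟨σ, _, f, b, -, rfl, hf, -⟩ | ⟨f, b, rfl, hf, -⟩ := exists_chart he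
    · exact isPreirreducible_basicOpen hf
    · exact isPreirreducible_basicOpen hf
  · obtain ⟨e, he, hq⟩ := exists_mem_chartFunctions hq
    exact Set.mem_iUnion.2 ⟨⟨e, he⟩, hq⟩

/-- Along the vertex a function on the product is its restriction to `𝔸⁷`, because the cone ring
modulo its coordinates consists of constants. The same `g` works for all `Q`. -/
theorem exists_map_sub_mem (a : RingConeA) : ∃ g : MvPolynomial (Fin 7) ℂ,
    ∀ Q : Ideal RingConeA, (∀ i, C (coneCoord i) ∈ Q) → a - map (algebraMap ℂ RingCone) g ∈ Q := by
  induction a using MvPolynomial.induction_on with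
  | C r =>
    obtain ⟨c, hc⟩ := exists_sub_algebraMap_mem r
    refine ⟨C c, fun Q hQ => ?_⟩
    have h : Ideal.span (Set.range coneCoord) ≤ Q.comap C := by
      rw [Ideal.span_le]
      rintro _ ⟨i, rfl⟩
      exact hQ i
    rw [map_C, ← map_sub]
    exact h hc
  | add f g hf hg =>
    obtain ⟨f', hf⟩ := hf
    obtain ⟨g', hg⟩ := hg
    refine ⟨f' + g', fun Q hQ => ?_⟩
    rw [map_add, add_sub_add_comm]
    exact add_mem (hf Q hQ) (hg Q hQ)
  | mul_X f i hf =>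
    obtain ⟨f', hf⟩ := hf
    refine ⟨f' * X i, fun Q hQ => ?_⟩
    rw [map_mul, map_X, ← sub_mul]
    exact Ideal.mul_mem_right _ _ (hf Q hQ)

/-- The point of `Δ` with the given `x₃`, `a`, `b`. -/
def deltaPoint : Coord → MvPolynomial (Fin 7) ℂ :=
  mkPoint 0 0 ![0, 0, X 0] ![0, 0, 0] (X 1) (X 2) (X 3) (X 4) (X 5) (X 6) 0 0 0 0

theorem isPoint_deltaPoint : IsPoint deltaPoint := by
  have hy : vecY deltaPoint = 0 := by
    funext i
    fin_cases i <;> rfl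
  constructor
  · intro i
    have hs : deltaPoint .s = 0 := rfl
    simp [hy, hs, sharpY]
  · intro i
    fin_cases i <;> simp [deltaPoint, mkPoint, sharpX, cross_apply, matP, matQ, vecX,
      Matrix.mulVec, dotProduct, Fin.sum_univ_three, Matrix.transpose_apply]
  · have hs : deltaPoint .s = 0 := rfl
    simp [hy, hs, beta]
  · simp [hy]
  · simp [hy]

theorem topologicalKrullDim_locusDelta :
    topologicalKrullDim (locusDelta : Set (PrimeSpectrum RingU)) = 7 := by
  refine le_antisymm (topologicalKrullDim_le_of_basicOpen fun p hp => ?_) ?_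
  · obtain ⟨e, he, hep⟩ := exists_mem_chartFunctions hp.2
    refine ⟨e, hep, ?_⟩
    obtain ⟨σ, _, f, b, hσ, rfl, hf, h⟩ | ⟨f, b, rfl, hf, h⟩ := exists_chart he
    · exact absurd hp (h p hep)
    · let φ : MvPolynomial (Fin 7) ℂ →+* RingU :=
        (f : RingConeA →+* RingU).comp (map (algebraMap ℂ RingCone))
      -- On the chart every function has, up to a power of the unit `f b`, the same restriction to
      -- `Δ` as a polynomial in the seven affine coordinates.
      have key : Topology.IsInducing
          fun q : (locusDelta ∩ PrimeSpectrum.basicOpen (f b) : Set (PrimeSpectrum RingU)) =>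
            PrimeSpectrum.comap φ q.1 := by
        refine isInducing_comap_of_forall_exists φ _ fun r => ?_
        obtain ⟨n, b', hb'⟩ := hf.surj r
        obtain ⟨g, hg⟩ := exists_map_sub_mem b'
        refine ⟨g, fun q hq => ?_⟩
        have h1 := hg (q.asIdeal.comap (f : RingConeA →+* RingU)) ((h q hq.2).1 hq.1)
        rw [Ideal.mem_comap, map_sub, ← hb'] at h1
        have h2 : φ g ∈ q.asIdeal ↔ (f : RingConeA →+* RingU) b ^ n * r ∈ q.asIdeal := by
          refine ⟨fun h3 => ?_, fun h3 => ?_⟩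
          · exact (Submodule.sub_mem_iff_left _ h3).1 h1
          · exact (Submodule.sub_mem_iff_right _ h3).1 h1
        rw [h2]
        exact ⟨fun hr => Ideal.mul_mem_left _ _ hr,
          fun hr => (q.2.mem_or_mem hr).resolve_left fun hn => hq.2 (q.2.mem_of_pow_mem _ hn)⟩
      refine key.topologicalKrullDim_le.trans ?_
      rw [PrimeSpectrum.topologicalKrullDim_eq_ringKrullDim, ringKrullDim_mvPolynomial_complex]
      simp
  -- Lower bound: the part of `S_x` with `x₃ ≠ 0` is the open set `x₃ ≠ 0` in the affine space with
  -- coordinates `x₃`, `a`, `b`.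
  · let L := Localization.Away (X 0 : MvPolynomial (Fin 7) ℂ)
    let φ : RingU →+* MvPolynomial (Fin 7) ℂ := liftU deltaPoint isPoint_deltaPoint
    have hφ (c : Coord) : φ (coordU c) = deltaPoint c :=
      liftU_coordU _ isPoint_deltaPoint _
    have hsurj : Function.Surjective φ := by
      have : (liftU deltaPoint isPoint_deltaPoint).range = ⊤ := by
        rw [eq_top_iff, ← MvPolynomial.adjoin_range_X, Algebra.adjoin_le_iff]
        rintro _ ⟨i, rfl⟩
        fin_cases i
        exacts [⟨coordU (.x 2), hφ _⟩, ⟨coordU .a11, hφ _⟩, ⟨coordU .a12, hφ _⟩,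
          ⟨coordU .a21, hφ _⟩, ⟨coordU .b11, hφ _⟩, ⟨coordU .b12, hφ _⟩, ⟨coordU .b21, hφ _⟩]
      exact AlgHom.range_eq_top _ |>.1 this
    have h1 := card_le_ringKrullDim_away_X (0 : Fin 7)
    rw [Nat.card_fin] at h1
    refine le_trans h1 (ringKrullDim_le_topologicalKrullDim
      (φ := (algebraMap (MvPolynomial (Fin 7) ℂ) L).comp φ) ?_ fun q => ?_)
    · exact (PrimeSpectrum.isClosedEmbedding_comap_of_surjective _ _ hsurj).isInducing.comp
        (PrimeSpectrum.localization_away_isOpenEmbedding L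
          (X 0 : MvPolynomial (Fin 7) ℂ)).isInducing
    · have hx : coordU (.x 2) ∉
          (PrimeSpectrum.comap ((algebraMap (MvPolynomial (Fin 7) ℂ) L).comp φ) q).asIdeal := by
        intro h
        refine q.2.ne_top (Ideal.eq_top_of_isUnit_mem _ h ?_)
        rw [RingHom.comp_apply, hφ]
        exact IsLocalization.Away.algebraMap_isUnit (X 0)
      have h0 {c : Coord} (hc : deltaPoint c = 0) : coordU c ∈
          (PrimeSpectrum.comap ((algebraMap (MvPolynomial (Fin 7) ℂ) L).comp φ) q).asIdeal := by
        change ((algebraMap (MvPolynomial (Fin 7) ℂ) L).comp φ) _ ∈ q.asIdeal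
        rw [RingHom.comp_apply, hφ, hc, map_zero]
        exact zero_mem _
      rw [locusDelta_eq]
      refine ⟨Or.inl (mem_locusSx.2 ⟨fun i => h0 ?_, h0 rfl, h0 rfl, h0 rfl, h0 rfl, h0 rfl,
        h0 rfl, h0 rfl, h0 rfl⟩), notMem_baseLocus (by simp [chartFunctions]) hx⟩
      fin_cases i <;> rfl

end Global

/-! ### From prime ideals to schemes -/

section Schemes

open MvPolynomial

/-- The map `i` factors through `Spec R_{f b}`, and `R_{f b}` is also `B_b`, whose spectrum is open
in `Spec B`. -/
theorem isOpenImmersion_of_isAwayIso {B R : Type} [CommRing B] [CommRing R] {f : B →+* R} {b : B}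
    (h : IsAwayIso f b) {V : Scheme} (i : V ⟶ Spec (.of R)) [IsOpenImmersion i]
    (hi : ∀ q, f b ∉ (i q).asIdeal) : IsOpenImmersion (i ≫ Spec.map (CommRingCat.ofHom f)) := by
  let L := Localization.Away (f b)
  let _ : Algebra B L := ((algebraMap R L).comp f).toAlgebra
  have hL := h.isLocalization_away L rfl
  let g : Spec (.of L) ⟶ Spec (.of R) := Spec.map (CommRingCat.ofHom (algebraMap R L))
  have hg : IsOpenImmersion g := IsOpenImmersion.of_isLocalization (f b)
  have hr : Set.range i ⊆ Set.range g := by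
    rintro _ ⟨q, rfl⟩
    have h1 := PrimeSpectrum.localization_away_comap_range L (f b)
    change i q ∈ Set.range (PrimeSpectrum.comap (algebraMap R L))
    rw [h1]
    exact hi q
  let l := IsOpenImmersion.lift g i hr
  have hl : l ≫ g = i := IsOpenImmersion.lift_fac g i hr
  have : IsOpenImmersion (l ≫ g) := by rwa [hl]
  have : IsOpenImmersion l := IsOpenImmersion.of_comp l g
  have hB : IsOpenImmersion (Spec.map (CommRingCat.ofHom (algebraMap B L))) :=
    IsOpenImmersion.of_isLocalization b
  have h2 : g ≫ Spec.map (CommRingCat.ofHom f) =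
      Spec.map (CommRingCat.ofHom (algebraMap B L)) := by
    rw [← Spec.map_comp, ← CommRingCat.ofHom_comp]
  rw [← hl, Category.assoc, h2]
  infer_instance

theorem hasConeSingularitiesAlong_locusDelta :
    HasConeSingularitiesAlong (openU.ι ≫ schemeUToC) (openU.ι ⁻¹' locusDelta) 7 := by
  intro p hp
  obtain ⟨e, he, hep⟩ := exists_mem_chartFunctions (p := openU.ι p) p.2
  obtain ⟨σ, _, f, b, hσ, rfl, hf, h⟩ | ⟨f, b, rfl, hf, h⟩ := exists_chart he
  -- A point of `Δ` lies on no smooth chart.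
  · exact absurd hp (h _ hep)
  let V : (openU : Scheme).Opens := openU.ι ⁻¹ᵁ PrimeSpectrum.basicOpen (f b)
  have hV (q : V) : f b ∉ ((V.ι ≫ openU.ι) q).asIdeal := q.2
  let k : (V : Scheme) ⟶ Spec (.of RingConeA) :=
    (V.ι ≫ openU.ι) ≫ Spec.map (CommRingCat.ofHom (f : RingConeA →+* RingU))
  have hk : IsOpenImmersion k := isOpenImmersion_of_isAwayIso hf _ hV
  have hover : (k ≫ (AffineSpace.SpecIso (Fin 7) (.of RingCone)).inv) ≫
      (𝔸(Fin 7; coneG) ↘ coneG) = (V.ι ≫ openU.ι) ≫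
        Spec.map (CommRingCat.ofHom ((f : RingConeA →+* RingU).comp C)) := by
    rw [Category.assoc, AffineSpace.SpecIso_inv_over, Category.assoc, ← Spec.map_comp,
      ← CommRingCat.ofHom_comp]
  refine ⟨V, hep, k ≫ (AffineSpace.SpecIso (Fin 7) (.of RingCone)).inv, inferInstance, ?_,
    fun q => ?_⟩
  · rw [← Category.assoc, hover, Category.assoc, coneGToC, schemeUToC, ← Spec.map_comp,
      ← CommRingCat.ofHom_comp, Category.assoc]
    congr 4
    ext c
    exact f.commutes c
  · have h1 : (𝔸(Fin 7; coneG) ↘ coneG)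
        ((k ≫ (AffineSpace.SpecIso (Fin 7) (.of RingCone)).inv) q) = ((V.ι ≫ openU.ι) ≫
          Spec.map (CommRingCat.ofHom ((f : RingConeA →+* RingU).comp C))) q := by
      rw [← hover]
      rfl
    refine (h _ (hV q)).trans (Iff.trans ?_ (iff_of_eq (congrArg (· ∈ coneVertex) h1.symm)))
    change _ ↔ Set.range coneCoord ⊆ _
    rw [Set.range_subset_iff]
    rfl

theorem isRegularLocalRing_stalk_iff (x : PrimeSpectrum RingU) (hx : (x : schemeU) ∉ baseLocus) :
    IsRegularLocalRing (schemeU.presheaf.stalk x) ↔ (x : schemeU) ∉ locusDelta := by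
  let _ : Algebra RingU (schemeU.presheaf.stalk x) :=
    StructureSheaf.stalkAlgebra RingU x
  have : IsLocalization.AtPrime (schemeU.presheaf.stalk x) x.asIdeal :=
    StructureSheaf.IsLocalization.to_stalk RingU x
  exact isRegularLocalRing_iff_notMem_locusDelta hx _

theorem singularLocus_openU : singularLocus openU = openU.ι ⁻¹' locusDelta := by
  ext p
  let e : (openU : Scheme).presheaf.stalk p ≃+* schemeU.presheaf.stalk (openU.ι p) :=
    (openU.stalkIso p).commRingCatIsoToRingEquiv
  have h : IsRegularLocalRing ((openU : Scheme).presheaf.stalk p) ↔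
      openU.ι p ∉ locusDelta := by
    refine Iff.trans ?_ (isRegularLocalRing_stalk_iff (openU.ι p) p.2)
    exact ⟨fun _ => IsRegularLocalRing.of_ringEquiv e,
      fun _ => IsRegularLocalRing.of_ringEquiv e.symm⟩
  exact h.not.trans not_not

theorem topologicalKrullDim_openU : topologicalKrullDim openU = 14 :=
  topologicalKrullDim_compl_baseLocus

theorem irreducibleSpace_openU : IrreducibleSpace openU :=
  Subtype.irreducibleSpace isIrreducible_compl_baseLocus

end Schemes


end KeyVariety

end

open KeyVariety in
theorem mainTheorem4 :
    topologicalKrullDim openU = 14 ∧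
    IrreducibleSpace openU ∧
    singularLocus openU = openU.ι ⁻¹' locusDelta ∧
    topologicalKrullDim locusDelta = 7 ∧
    HasConeSingularitiesAlong (openU.ι ≫ schemeUToC) (openU.ι ⁻¹' locusDelta) 7 :=
  ⟨topologicalKrullDim_openU, irreducibleSpace_openU, singularLocus_openU,
    topologicalKrullDim_locusDelta, hasConeSingularitiesAlong_locusDelta⟩
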